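/- Fix a commutative ring $\Bbbk$, an abelian group $\Gamma$ with a symmetric bilinear form $\langle\ ,\ \rangle\colon\Gamma\times\Gamma\to\mathbb Z/2$, and $\iota\in\Gamma$ with $\langle\iota,\iota\rangle=1$. All dg modules are $\Gamma$-graded $\Bbbk$-modules with a differential of degree $\iota$ (with Koszul signs governed by $\langle\ ,\ \rangle$), and dg categories are categories enriched in them; write $\langle X|Y\rangle=\operatorname{Hom}(Y,X)$ for the hom complexes. $q^i$ denotes the shift by $i\in\Gamma$, $(q^iM)^l=M^{l-i}$. For a dg category $\mathcal D$ and a set of objects $\mathcal X\subset\operatorname{Obj}(\mathcal D)$, the two-sided bar complex $\operatorname{Bar}(\mathcal D,\mathcal X)$ is the $(\mathcal D,\mathcal D)$-bimodule with $$\langle Y|\operatorname{Bar}(\mathcal D,\mathcal X)|Y'\rangle=\bigoplus_{r\ge 0}q^{-r\iota}\bigoplus_{X_0,\dots,X_r\in\mathcal X}\langle Y|X_0\rangle\otimes_{\Bbbk}\langle X_0|X_1\rangle\otimes_{\Bbbk}\cdots\otimes_{\Bbbk}\langle X_{r-1}|X_r\rangle\otimes_{\Bbbk}\langle X_r|Y'\rangle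 ,$$ action $g\cdot[f_0,\dots,f_{r+1}]\cdot g'=(-1)^{r\langle\iota,|g|\rangle}[g\circ f_0,f_1,\dots,f_r,f_{r+1}\circ g']$, and differential $$d[f_0,\dots,f_{r+1}]=\sum_{i=0}^{r+1}(-1)^{r+k_0+\cdots+k_{i-1}}[f_0,\dots,d(f_i),\dots,f_{r+1}]+\sum_{i=0}^{r}(-1)^i[f_0,\dots,f_i\circ f_{i+1},\dots,f_{r+1}],\qquad k_i=\langle\iota,|f_i|\rangle,$$ where the second sum is omitted for $r=0$. Put $\operatorname{Bar}(\mathcal D)=\operatorname{Bar}(\mathcal D,\operatorname{Obj}(\mathcal D))$. Two bimodules $M,N$ are homotopy equivalent, $M\simeq N$, if there are closed degree-zero bimodule maps $M\to N$ and $N\to M$ that are mutually inverse up to differentials of bimodule maps of degree $-\iota$. The envelopes of a dg category $\mathcal C$ are: $\mathrm{SB}(\mathcal C)$, with objects the formal shifts $q^iX$; $\mathbf A(\mathcal C)$, with objects the formal finite direct sums and matrices as morphisms; and $\operatorname{pretr}(\mathcal C)$, the dg category of finite one-sided twisted complexes $\operatorname{tw}_\alpha(\bigoplus_{a\in A}q^{i_a}X_a)$,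 where $A$ is a finite set, $\alpha$ is a degree-$\iota$ endomorphism of $\bigoplus_a q^{i_a}X_a$ with $d(\alpha)+\alpha^2=0$, and, for some partial order on $A$, $\alpha_{a,b}=0$ unless $a>b$. In each case $\operatorname{Obj}(\mathcal C)$ is regarded as a set of objects of the envelope in the evident way. The set $\mathcal X$ generates $\mathcal D$ if every object of $\mathcal D$ is homotopy equivalent, in $\operatorname{pretr}(\mathcal D)$, to a finite one-sided twisted complex $\operatorname{tw}_\alpha(\bigoplus_a q^{i_a}X_a)$ with all $X_a\in\mathcal X$. **Theorem.** If $\mathcal X\subset\operatorname{Obj}(\mathcal D)$ generates $\mathcal D$, then $\operatorname{Bar}(\mathcal D)\simeq\operatorname{Bar}(\mathcal D,\mathcal X)$ as $(\mathcal D,\mathcal D)$-bimodules. In particular, for every dg category $\mathcal C$ and every $\mathbf E\in\{\mathrm{SB},\mathbf A,\operatorname{pretr}\}$, $\operatorname{Bar}(\mathbf E(\mathcal C))\simeq\operatorname{Bar}(\mathbf E(\mathcal C),\operatorname{Obj}(\mathcal C))$. -/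

import Mathlib

universe v w u t

open scoped TensorProduct DirectSum

noncomputable section

/-- The sign `(-1) ^ z` in `k`. -/
def ksign (k : Type*) [CommRing k] (z : ZMod 2) : k := (-1) ^ z.val

theorem ksign_zero (k : Type*) [CommRing k] : ksign k 0 = 1 := by simp [ksign]

theorem ksign_one (k : Type*) [CommRing k] : ksign k 1 = -1 := by
  simp [ksign, ZMod.val_one]

theorem ksign_add (k : Type*) [CommRing k] (a b : ZMod 2) :
    ksign k (a + b) = ksign k a * ksign k b := by
  have h : ∀ z : ZMod 2, z = 0 ∨ z = 1 := by decide
  rcases h a with rfl | rfl <;> rcases h b with rfl | rfl <;>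
    simp [ksign_zero, ksign_one, show (1 + 1 : ZMod 2) = 0 by decide]

theorem ksign_mul_self (k : Type*) [CommRing k] (a : ZMod 2) : ksign k a * ksign k a = 1 := by
  rw [← ksign_add, CharTwo.add_self_eq_zero, ksign_zero]

/-- The grading conventions on an abelian group `Γ`: a symmetric bilinear form with values in
`ℤ/2` (it controls the signs) and the degree `ι` of all differentials. -/
structure GradingDatum (Γ : Type t) [AddCommGroup Γ] where
  pairing : Γ →+ Γ →+ ZMod 2
  symm : ∀ i j, pairing i j = pairing j i
  ι : Γ
  pairing_ι : pairing ι ι = 1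

/-- A dg module over `k`: a `k`-module that is the internal direct sum of its submodules `gr i` of
homogeneous elements of degree `i ∈ Γ`, with a differential of degree `ι`. -/
structure DGMod (k : Type u) [CommRing k] {Γ : Type t} [AddCommGroup Γ] (S : GradingDatum Γ) where
  carrier : Type v
  [addCommGroup : AddCommGroup carrier]
  [module : Module k carrier]
  gr : Γ → Submodule k carrier
  indep : iSupIndep gr
  iSup_gr : ⨆ i, gr i = ⊤
  d : carrier →ₗ[k] carrier
  d_mem : ∀ {i : Γ} {m : carrier}, m ∈ gr i → d m ∈ gr (i + S.ι)
  d_d : ∀ m, d (d m) = 0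

instance {k : Type u} [CommRing k] {Γ : Type t} [AddCommGroup Γ] {S : GradingDatum Γ} :
    CoeSort (DGMod.{v} k S) (Type v) := ⟨DGMod.carrier⟩

attribute [instance] DGMod.addCommGroup DGMod.module

section GradedHelpers

theorem iSupIndep_of_dec {k : Type*} [CommRing k] {Γ : Type*} {M : Type*}
    [AddCommGroup M] [Module k M] (gr : Γ → Submodule k M) (dec : M →ₗ[k] (Γ →₀ M))
    (h : ∀ i, ∀ m ∈ gr i, dec m = Finsupp.single i m) : iSupIndep gr := by
  classical
  intro i
  rw [Submodule.disjoint_def]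
  intro x hx hx'
  have hle : (⨆ (j) (_ : j ≠ i), gr j) ≤ LinearMap.ker (Finsupp.lapply (R := k) i ∘ₗ dec) := by
    refine iSup₂_le fun j hj m hm => ?_
    simp [h j m hm, hj]
  have h1 := hle hx'
  simpa [h i x hx] using h1

namespace DGMod

variable {k : Type u} [CommRing k] {Γ : Type t} [AddCommGroup Γ] {S : GradingDatum Γ}

theorem hom_induction (M : DGMod.{v} k S) {P : M → Prop} (m : M)
    (h0 : P 0) (hadd : ∀ x y, P x → P y → P (x + y)) (hom : ∀ i, ∀ x ∈ M.gr i, P x) : P m := by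
  have hm : m ∈ ⨆ i, M.gr i := by rw [M.iSup_gr]; trivial
  exact Submodule.iSup_induction (p := M.gr) (motive := P) hm hom h0 hadd

theorem exists_dec (M : DGMod.{v} k S) :
    ∃ dec : M →ₗ[k] (Γ →₀ M), ∀ i, ∀ m ∈ M.gr i, dec m = Finsupp.single i m := by
  classical
  have hI : DirectSum.IsInternal M.gr :=
    (DirectSum.isInternal_submodule_iff_iSupIndep_and_iSup_eq_top _).2 ⟨M.indep, M.iSup_gr⟩
  let e := LinearEquiv.ofBijective (DirectSum.coeLinearMap M.gr) hI
  refine ⟨(DirectSum.toModule k Γ (Γ →₀ M)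
    fun i => Finsupp.lsingle i ∘ₗ (M.gr i).subtype) ∘ₗ e.symm.toLinearMap, fun i m hm => ?_⟩
  have : e.symm m = DirectSum.lof k Γ (fun i => M.gr i) i ⟨m, hm⟩ := by
    rw [LinearEquiv.symm_apply_eq]
    exact (DirectSum.coeLinearMap_lof M.gr i ⟨m, hm⟩).symm
  simp [this]

/-- The decomposition of an element into its homogeneous components. -/
def dec (M : DGMod.{v} k S) : M →ₗ[k] (Γ →₀ M) := M.exists_dec.choose

theorem dec_of_mem (M : DGMod.{v} k S) {i : Γ} {m : M} (hm : m ∈ M.gr i) :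
    M.dec m = Finsupp.single i m := M.exists_dec.choose_spec i m hm

/-- The sign operator `m ↦ (-1) ^ ⟨j, |m|⟩ m`. -/
def koszul (M : DGMod.{v} k S) (j : Γ) : M →ₗ[k] M :=
  (Finsupp.lsum k fun i => ksign k (S.pairing j i) • LinearMap.id) ∘ₗ M.dec

theorem koszul_of_mem (M : DGMod.{v} k S) (j : Γ) {i : Γ} {m : M} (hm : m ∈ M.gr i) :
    M.koszul j m = ksign k (S.pairing j i) • m := by
  simp [koszul, M.dec_of_mem hm]

theorem koszul_mem (M : DGMod.{v} k S) (j : Γ) {i : Γ} {m : M} (hm : m ∈ M.gr i) :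
    M.koszul j m ∈ M.gr i := by
  rw [M.koszul_of_mem j hm]; exact Submodule.smul_mem _ _ hm

theorem koszul_koszul (M : DGMod.{v} k S) (j : Γ) (m : M) : M.koszul j (M.koszul j m) = m := by
  refine M.hom_induction (P := fun m => M.koszul j (M.koszul j m) = m) m (by simp) ?_ ?_
  · intro x y hx hy; simp [hx, hy]
  · intro i x hx
    rw [M.koszul_of_mem j hx, map_smul, M.koszul_of_mem j hx, smul_smul, ksign_mul_self, one_smul]

theorem koszul_d (M : DGMod.{v} k S) (j : Γ) (m : M) :
    M.koszul j (M.d m) = ksign k (S.pairing j S.ι) • M.d (M.koszul j m) := by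
  refine M.hom_induction
    (P := fun m => M.koszul j (M.d m) = ksign k (S.pairing j S.ι) • M.d (M.koszul j m)) m
    (by simp) ?_ ?_
  · intro x y hx hy; simp [hx, hy]
  · intro i x hx
    rw [M.koszul_of_mem _ (M.d_mem hx), M.koszul_of_mem _ hx, map_smul, smul_smul, map_add,
      ksign_add, mul_comm]

theorem d_koszul_ι (M : DGMod.{v} k S) (m : M) :
    M.d (M.koszul S.ι m) = -M.koszul S.ι (M.d m) := by
  rw [koszul_d, S.pairing_ι, ksign_one]; simp

end DGMod

end GradedHelpers

namespace DGMod

variable {k : Type u} [CommRing k] {Γ : Type t} [AddCommGroup Γ] {S : GradingDatum Γ}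

/-- The shift `q^j M q^i`: the component in degree `l` is `M^(l - (j + i))`; only the left shift
contributes a sign to the differential. -/
def shiftLR (M : DGMod.{v} k S) (j i : Γ) : DGMod.{v} k S where
  carrier := M
  gr l := M.gr (l - (j + i))
  indep := M.indep.comp (sub_left_injective (b := j + i))
  iSup_gr := by
    rw [← M.iSup_gr]
    exact (Equiv.subRight (j + i)).iSup_comp (g := M.gr)
  d := ksign k (S.pairing S.ι j) • M.d
  d_mem {l m} hm := by
    have := M.d_mem hm
    rw [show l - (j + i) + S.ι = l + S.ι - (j + i) by abel] at this
    exact Submodule.smul_mem _ _ this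
  d_d m := by simp [M.d_d]

/-- The direct sum `⨁_a q^(s a) M_a`. -/
def directSumShift {J : Type w} (M : J → DGMod.{v} k S) (s : J → Γ) : DGMod.{max v w} k S where
  carrier := ⨁ a, M a
  gr l :=
    { carrier := {m | ∀ a, m a ∈ (M a).gr (l - s a)}
      add_mem' := fun hx hy a => by
        rw [DirectSum.add_apply]; exact Submodule.add_mem _ (hx a) (hy a)
      zero_mem' := fun a => Submodule.zero_mem _
      smul_mem' := fun c x hx a => by
        rw [DirectSum.smul_apply]; exact Submodule.smul_mem _ _ (hx a) }
  indep := by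
    classical
    refine iSupIndep_of_dec _ (DirectSum.toModule k J _ fun a =>
      Finsupp.lmapDomain _ k (fun l => l + s a) ∘ₗ
        Finsupp.mapRange.linearMap (DirectSum.lof k J (fun a => M a) a) ∘ₗ (M a).dec) ?_
    intro l m hm
    conv_lhs => rw [← DirectSum.sum_support_of m]
    conv_rhs => rw [← DirectSum.sum_support_of m]
    rw [map_sum, Finsupp.single_finsetSum]
    refine Finset.sum_congr rfl fun a _ => ?_
    rw [← DirectSum.lof_eq_of k, DirectSum.toModule_lof]
    simp [(M a).dec_of_mem (hm a), Finsupp.mapDomain_single]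
  iSup_gr := by
    classical
    rw [eq_top_iff]
    intro m _
    induction m using DirectSum.induction_on with
    | zero => exact Submodule.zero_mem _
    | add x y hx hy => exact Submodule.add_mem _ (hx trivial) (hy trivial)
    | of a x =>
      refine (M a).hom_induction (P := fun x => DirectSum.of (fun a => M a) a x ∈ _) x ?_ ?_ ?_
      · rw [map_zero]; exact Submodule.zero_mem _
      · intro x y hx hy; rw [map_add]; exact Submodule.add_mem _ hx hy
      · intro i x hx
        refine Submodule.mem_iSup_of_mem (i + s a) fun b => ?_
        by_cases h : b = a
        · subst h; simpa using hx
        · rw [DirectSum.of_eq_of_ne _ _ _ h]; exact Submodule.zero_mem _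
  d := DirectSum.lmap fun a => ksign k (S.pairing S.ι (s a)) • (M a).d
  d_mem {l m} hm a := by
    have := (M a).d_mem (hm a)
    rw [show l - s a + S.ι = l + S.ι - s a by abel] at this
    simpa using Submodule.smul_mem _ _ this
  d_d m := by
    ext a; simp [(M a).d_d]

/-- The direct sum of a finite family. -/
def pi {J : Type w} [Fintype J] (M : J → DGMod.{v} k S) : DGMod.{max v w} k S where
  carrier := ∀ a, M a
  gr l := Submodule.pi Set.univ fun a => (M a).gr l
  indep := by
    classical
    refine iSupIndep_of_dec _ (∑ a, Finsupp.mapRange.linearMap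
      (LinearMap.single k (fun a => M a) a) ∘ₗ (M a).dec ∘ₗ LinearMap.proj a) ?_
    intro l m hm
    have h1 : ∀ a, (M a).dec (m a) = Finsupp.single l (m a) := fun a =>
      (M a).dec_of_mem (hm a trivial)
    simp only [LinearMap.sum_apply, LinearMap.comp_apply, LinearMap.proj_apply, h1]
    simp only [Finsupp.mapRange.linearMap_apply, Finsupp.mapRange_single,
      ← Finsupp.single_finsetSum]
    congr 1
    exact Finset.univ_sum_single m
  iSup_gr := by
    classical
    rw [eq_top_iff]
    intro m _
    rw [← Finset.univ_sum_single m]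
    refine Submodule.sum_mem _ fun a _ => ?_
    refine (M a).hom_induction (P := fun x => (Pi.single a x : ∀ a, M a) ∈ _) (m a) ?_ ?_ ?_
    · rw [Pi.single_zero]; exact Submodule.zero_mem _
    · intro x y hx hy; rw [Pi.single_add]; exact Submodule.add_mem _ hx hy
    · intro i x hx
      refine Submodule.mem_iSup_of_mem i fun b _ => ?_
      by_cases h : b = a
      · subst h; simpa using hx
      · rw [Pi.single_eq_of_ne h]; exact Submodule.zero_mem _
  d := LinearMap.pi fun a => (M a).d ∘ₗ LinearMap.proj a
  d_mem hm a _ := (M a).d_mem (hm a trivial)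
  d_d m := by ext a; simp [(M a).d_d]

/-- The tensor product of dg modules: `m ⊗ n` has degree `|m| + |n|`, and
`d (m ⊗ n) = d m ⊗ n + (-1) ^ ⟨ι, |m|⟩ m ⊗ d n`. -/
def tensor (M : DGMod.{v} k S) (N : DGMod.{w} k S) : DGMod.{max v w} k S where
  carrier := M ⊗[k] N
  gr l := Submodule.span k {x | ∃ i j, i + j = l ∧ ∃ m ∈ M.gr i, ∃ n ∈ N.gr j, m ⊗ₜ[k] n = x}
  indep := by
    classical
    refine iSupIndep_of_dec _ (Finsupp.lmapDomain _ k (fun p : Γ × Γ => p.1 + p.2) ∘ₗ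
      (finsuppTensorFinsupp k k M N Γ Γ).toLinearMap ∘ₗ TensorProduct.map M.dec N.dec) ?_
    intro l x hx
    induction hx using Submodule.span_induction with
    | mem x h =>
      obtain ⟨i, j, rfl, m, hm, n, hn, rfl⟩ := h
      simp [M.dec_of_mem hm, N.dec_of_mem hn]
    | zero => simp
    | add x y _ _ hx hy => rw [map_add, hx, hy, Finsupp.single_add]
    | smul c x _ hx => rw [map_smul, hx, Finsupp.smul_single]
  iSup_gr := by
    rw [eq_top_iff]
    intro x _
    induction x using TensorProduct.induction_on with
    | zero => exact Submodule.zero_mem _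
    | add x y hx hy => exact Submodule.add_mem _ (hx trivial) (hy trivial)
    | tmul m n =>
      refine M.hom_induction (P := fun m => m ⊗ₜ[k] n ∈ _) m ?_ ?_ ?_
      · rw [TensorProduct.zero_tmul]; exact Submodule.zero_mem _
      · intro x y hx hy; rw [TensorProduct.add_tmul]; exact Submodule.add_mem _ hx hy
      · intro i m hm
        refine N.hom_induction (P := fun n => m ⊗ₜ[k] n ∈ _) n ?_ ?_ ?_
        · rw [TensorProduct.tmul_zero]; exact Submodule.zero_mem _
        · intro x y hx hy; rw [TensorProduct.tmul_add]; exact Submodule.add_mem _ hx hy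
        · intro j n hn
          exact Submodule.mem_iSup_of_mem (i + j)
            (Submodule.subset_span ⟨i, j, rfl, m, hm, n, hn, rfl⟩)
  d := TensorProduct.map M.d LinearMap.id + TensorProduct.map (M.koszul S.ι) N.d
  d_mem {l x} hx := by
    induction hx using Submodule.span_induction with
    | mem x h =>
      obtain ⟨i, j, rfl, m, hm, n, hn, rfl⟩ := h
      simp only [LinearMap.add_apply, TensorProduct.map_tmul, LinearMap.id_apply]
      exact Submodule.add_mem _
        (Submodule.subset_span ⟨i + S.ι, j, by abel, _, M.d_mem hm, _, hn, rfl⟩)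
        (Submodule.subset_span ⟨i, j + S.ι, by abel, _, M.koszul_mem _ hm, _, N.d_mem hn, rfl⟩)
    | zero => rw [map_zero]; exact Submodule.zero_mem _
    | add x y _ _ hx hy => rw [map_add]; exact Submodule.add_mem _ hx hy
    | smul c x _ hx => rw [map_smul]; exact Submodule.smul_mem _ _ hx
  d_d x := by
    induction x using TensorProduct.induction_on with
    | zero => simp
    | add x y hx hy => rw [map_add, map_add, hx, hy, add_zero]
    | tmul m n =>
      simp [M.d_d, N.d_d, M.d_koszul_ι, TensorProduct.neg_tmul]

theorem tmul_mem_tensor {M : DGMod.{v} k S} {N : DGMod.{w} k S} {i j : Γ} {m : M} {n : N}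
    (hm : m ∈ M.gr i) (hn : n ∈ N.gr j) :
    (m ⊗ₜ[k] n : M ⊗[k] N) ∈ (M.tensor N).gr (i + j) :=
  Submodule.subset_span (R := k) (M := M ⊗[k] N) ⟨i, j, rfl, m, hm, n, hn, rfl⟩

theorem tensor_gr_induction {M : DGMod.{v} k S} {N : DGMod.{w} k S} {P : M ⊗[k] N → Prop} {l : Γ}
    {t : M ⊗[k] N} (ht : t ∈ (M.tensor N).gr l)
    (h0 : P 0) (hadd : ∀ s t, P s → P t → P (s + t)) (hsmul : ∀ (c : k) t, P t → P (c • t))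
    (h : ∀ i j, i + j = l → ∀ f ∈ M.gr i, ∀ w ∈ N.gr j, P (f ⊗ₜ[k] w)) : P t := by
  have ht' : t ∈ Submodule.span k {x : M ⊗[k] N | ∃ i j, i + j = l ∧
    ∃ m ∈ M.gr i, ∃ n ∈ N.gr j, m ⊗ₜ[k] n = x} := ht
  induction ht' using Submodule.span_induction with
  | mem x hx =>
    obtain ⟨i, j, hij, m, hm, n, hn, rfl⟩ := hx
    exact h i j hij m hm n hn
  | zero => exact h0
  | add x y hx hy ihx ihy => exact hadd _ _ (ihx hx) (ihy hy)
  | smul c x hx ih => exact hsmul _ _ (ih hx)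

/-- The twist of `M` by a degree `ι` endomorphism `α` with `(d + α)² = 0`. -/
def twist (M : DGMod.{v} k S) (α : M →ₗ[k] M)
    (hα : ∀ {i : Γ} {m : M}, m ∈ M.gr i → α m ∈ M.gr (i + S.ι))
    (hMC : ∀ m, M.d (α m) + α (M.d m) + α (α m) = 0) : DGMod.{v} k S where
  carrier := M
  gr := M.gr
  indep := M.indep
  iSup_gr := M.iSup_gr
  d := M.d + α
  d_mem hm := Submodule.add_mem _ (M.d_mem hm) (hα hm)
  d_d m := by
    have := hMC m
    simp only [LinearMap.add_apply, map_add, M.d_d, zero_add]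
    rw [← this]; abel

end DGMod

/-- A dg category over `k`: a category enriched in dg modules. Composition is `k`-bilinear, of
degree zero and satisfies the Leibniz rule, i.e. it is a chain map on the tensor product of the
hom complexes. `comp f g` is `f ∘ g`, and `Hom X Y` is the complex of morphisms from `X` to `Y`,
that is `⟨Y|C|X⟩`. -/
structure DGCat (k : Type u) [CommRing k] {Γ : Type t} [AddCommGroup Γ] (S : GradingDatum Γ) where
  Obj : Type w
  Hom : Obj → Obj → DGMod.{v} k S
  one : ∀ X, Hom X X
  comp : ∀ {X Y Z}, Hom Y Z →ₗ[k] Hom X Y →ₗ[k] Hom X Z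
  one_mem : ∀ X, one X ∈ (Hom X X).gr 0
  d_one : ∀ X, (Hom X X).d (one X) = 0
  comp_mem : ∀ {X Y Z} {i j : Γ} {f : Hom Y Z} {g : Hom X Y},
    f ∈ (Hom Y Z).gr i → g ∈ (Hom X Y).gr j → comp f g ∈ (Hom X Z).gr (i + j)
  d_comp : ∀ {X Y Z} {i : Γ} {f : Hom Y Z} (g : Hom X Y), f ∈ (Hom Y Z).gr i →
    (Hom X Z).d (comp f g) =
      comp ((Hom Y Z).d f) g + ksign k (S.pairing S.ι i) • comp f ((Hom X Y).d g)
  one_comp : ∀ {X Y} (f : Hom X Y), comp (one Y) f = f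
  comp_one : ∀ {X Y} (f : Hom X Y), comp f (one X) = f
  assoc : ∀ {W X Y Z} (f : Hom Y Z) (g : Hom X Y) (h : Hom W X),
    comp (comp f g) h = comp f (comp g h)

namespace DGCat

variable {k : Type u} [CommRing k] {Γ : Type t} [AddCommGroup Γ] {S : GradingDatum Γ}

theorem d_comp' (C : DGCat.{v, w} k S) {X Y Z : C.Obj} (f : C.Hom Y Z) (g : C.Hom X Y) :
    (C.Hom X Z).d (C.comp f g) =
      C.comp ((C.Hom Y Z).d f) g + C.comp ((C.Hom Y Z).koszul S.ι f) ((C.Hom X Y).d g) := by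
  refine (C.Hom Y Z).hom_induction (P := fun f => (C.Hom X Z).d (C.comp f g) =
      C.comp ((C.Hom Y Z).d f) g + C.comp ((C.Hom Y Z).koszul S.ι f) ((C.Hom X Y).d g))
    f (by simp) ?_ ?_
  · intro x y hx hy
    simp only [map_add, LinearMap.add_apply, hx, hy]; abel
  · intro i x hx
    rw [C.d_comp g hx, DGMod.koszul_of_mem _ _ hx, map_smul, LinearMap.smul_apply]

theorem koszul_comp (C : DGCat.{v, w} k S) {X Y Z : C.Obj} (j : Γ) (f : C.Hom Y Z)
    (g : C.Hom X Y) :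
    (C.Hom X Z).koszul j (C.comp f g) =
      C.comp ((C.Hom Y Z).koszul j f) ((C.Hom X Y).koszul j g) := by
  refine (C.Hom Y Z).hom_induction (P := fun f => (C.Hom X Z).koszul j (C.comp f g) =
      C.comp ((C.Hom Y Z).koszul j f) ((C.Hom X Y).koszul j g)) f (by simp) ?_ ?_
  · intro x y hx hy
    simp only [map_add, LinearMap.add_apply, hx, hy]
  · intro i f hf
    refine (C.Hom X Y).hom_induction (P := fun g => (C.Hom X Z).koszul j (C.comp f g) =
      C.comp ((C.Hom Y Z).koszul j f) ((C.Hom X Y).koszul j g)) g (by simp) ?_ ?_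
    · intro x y hx hy
      simp only [map_add, hx, hy]
    · intro l g hg
      rw [DGMod.koszul_of_mem _ _ hf, DGMod.koszul_of_mem _ _ hg,
        DGMod.koszul_of_mem _ _ (C.comp_mem hf hg), map_smul, map_smul, LinearMap.smul_apply,
        smul_smul, map_add, ksign_add, mul_comm]

/-- `X` and `Y` are homotopy equivalent: there are closed morphisms of degree zero between them that
are mutually inverse up to exact morphisms, i.e. `X` and `Y` are isomorphic in `H⁰(C)`. -/
def HtpyEquiv (C : DGCat.{v, w} k S) (X Y : C.Obj) : Prop :=
  ∃ f ∈ (C.Hom X Y).gr 0, ∃ g ∈ (C.Hom Y X).gr 0,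
    (C.Hom X Y).d f = 0 ∧ (C.Hom Y X).d g = 0 ∧
    (∃ h ∈ (C.Hom X X).gr (-S.ι), (C.Hom X X).d h = C.comp g f - C.one X) ∧
    (∃ h ∈ (C.Hom Y Y).gr (-S.ι), (C.Hom Y Y).d h = C.comp f g - C.one Y)

theorem sb_d_comp (C : DGCat.{v, w} k S) {X Y Z : C.Obj} {i b c : Γ} {f : C.Hom Y Z}
    (g : C.Hom X Y) (hf : f ∈ (C.Hom Y Z).gr (i - (c + -b))) :
    (ksign k (S.pairing S.ι c) • (C.Hom X Z).d) (C.comp f g) =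
      C.comp ((ksign k (S.pairing S.ι c) • (C.Hom Y Z).d) f) g +
        ksign k (S.pairing S.ι i) • C.comp f ((ksign k (S.pairing S.ι b) • (C.Hom X Y).d) g) := by
  simp only [LinearMap.smul_apply, map_smul, C.d_comp g hf, smul_add, smul_smul]
  rw [← ksign_add, ← ksign_add, ← map_add, ← map_add]
  have e : c + (i - (c + -b)) = i + b := by abel
  rw [e]

/-- A formal shift `q^deg obj` of an object of `C`. -/
structure SBObj (C : DGCat.{v, w} k S) where
  deg : Γ
  obj : C.Obj

/-- The suspended envelope `SB(C)`: its objects are formal shifts `q^i X`, and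
`Hom (q^i X) (q^j Y) = q^j Hom(X, Y) q^(-i)`. -/
def SB (C : DGCat.{v, w} k S) : DGCat.{v, max t w} k S where
  Obj := C.SBObj
  Hom X Y := (C.Hom X.obj Y.obj).shiftLR Y.deg (-X.deg)
  one X := C.one X.obj
  comp {X Y Z} := C.comp (X := X.obj) (Y := Y.obj) (Z := Z.obj)
  one_mem X := by
    have := C.one_mem X.obj
    rwa [show (0 : Γ) = 0 - (X.deg + -X.deg) by abel] at this
  d_one X := by
    have : (ksign k (S.pairing S.ι X.deg) • (C.Hom X.obj X.obj).d) (C.one X.obj) = 0 := by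
      rw [LinearMap.smul_apply, C.d_one, smul_zero]
    exact this
  comp_mem {X Y Z i j f g} hf hg := by
    have := C.comp_mem hf hg
    rwa [show i - (Z.deg + -Y.deg) + (j - (Y.deg + -X.deg)) = i + j - (Z.deg + -X.deg) by abel]
      at this
  d_comp g hf := C.sb_d_comp g hf
  one_comp _ := C.one_comp _
  comp_one _ := C.comp_one _
  assoc _ _ _ := C.assoc _ _ _

/-- A formal finite direct sum of objects of `C`. -/
structure FinFamily (C : DGCat.{v, w} k S) where
  idx : Type
  [fin : Fintype idx]
  obj : idx → C.Obj

attribute [instance] FinFamily.fin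

/-- Matrices of morphisms; the entry `f (a, b)` is a morphism from `X_b` to `Y_a`. -/
abbrev Mat (C : DGCat.{v, w} k S) (X Y : C.FinFamily) : Type v :=
  ∀ p : Y.idx × X.idx, C.Hom (X.obj p.2) (Y.obj p.1)

open scoped Classical in
/-- The identity matrix. -/
def matOne (C : DGCat.{v, w} k S) (X : C.FinFamily) : C.Mat X X :=
  fun p => if h : p.2 = p.1 then
    cast (congrArg (fun a => (C.Hom (X.obj p.2) (X.obj a)).carrier) h) (C.one (X.obj p.2)) else 0

theorem matOne_self (C : DGCat.{v, w} k S) (X : C.FinFamily) (a : X.idx) :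
    C.matOne X (a, a) = C.one (X.obj a) := by
  simp [matOne]

theorem matOne_ne (C : DGCat.{v, w} k S) (X : C.FinFamily) {a b : X.idx} (h : b ≠ a) :
    C.matOne X (a, b) = 0 := by
  simp [matOne, h]

/-- Matrix multiplication. -/
def matComp (C : DGCat.{v, w} k S) {X Y Z : C.FinFamily} :
    C.Mat Y Z →ₗ[k] C.Mat X Y →ₗ[k] C.Mat X Z :=
  LinearMap.mk₂ k (fun f g p => ∑ b, C.comp (f (p.1, b)) (g (b, p.2)))
    (fun f f' g => by
      funext p
      simp only [Pi.add_apply, map_add, LinearMap.add_apply, Finset.sum_add_distrib])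
    (fun c f g => by
      funext p
      simp only [Pi.smul_apply, map_smul, LinearMap.smul_apply, Finset.smul_sum])
    (fun f g g' => by
      funext p
      simp only [Pi.add_apply, map_add, Finset.sum_add_distrib])
    (fun c f g => by
      funext p
      simp only [Pi.smul_apply, map_smul, Finset.smul_sum])

theorem matComp_apply (C : DGCat.{v, w} k S) {X Y Z : C.FinFamily} (f : C.Mat Y Z) (g : C.Mat X Y)
    (p : Z.idx × X.idx) : C.matComp f g p = ∑ b, C.comp (f (p.1, b)) (g (b, p.2)) := rfl

theorem matOne_comp (C : DGCat.{v, w} k S) {X Y : C.FinFamily} (f : C.Mat X Y) :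
    C.matComp (C.matOne Y) f = f := by
  funext ⟨a, c⟩
  rw [matComp_apply, Finset.sum_eq_single a]
  · simp [C.one_comp, matOne_self]
  · intro b _ hb; simp [C.matOne_ne _ hb]
  · simp

theorem matComp_one (C : DGCat.{v, w} k S) {X Y : C.FinFamily} (f : C.Mat X Y) :
    C.matComp f (C.matOne X) = f := by
  funext ⟨a, c⟩
  rw [matComp_apply, Finset.sum_eq_single c]
  · simp [C.comp_one, matOne_self]
  · intro b _ hb; simp [C.matOne_ne _ hb.symm]
  · simp

theorem matComp_assoc (C : DGCat.{v, w} k S) {W X Y Z : C.FinFamily} (f : C.Mat Y Z)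
    (g : C.Mat X Y) (h : C.Mat W X) :
    C.matComp (C.matComp f g) h = C.matComp f (C.matComp g h) := by
  funext ⟨a, c⟩
  simp only [matComp_apply, map_sum, LinearMap.sum_apply, C.assoc]
  exact Finset.sum_comm

/-- The additive envelope `A(C)`. The hom complex from `⨁ X_b` to `⨁ Y_a` is the direct sum of the
hom complexes from `X_b` to `Y_a`, its elements are matrices. -/
def AddEnv (C : DGCat.{v, w} k S) : DGCat.{v, max 1 w} k S where
  Obj := C.FinFamily
  Hom X Y := DGMod.pi fun p : Y.idx × X.idx => C.Hom (X.obj p.2) (Y.obj p.1)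
  one X := C.matOne X
  comp {X Y Z} := C.matComp (X := X) (Y := Y) (Z := Z)
  one_mem X := by
    rintro ⟨a, b⟩ -
    by_cases h : b = a
    · subst h
      have := C.one_mem (X.obj b)
      rw [← matOne_self] at this
      exact this
    · have : C.matOne X (a, b) ∈ (C.Hom (X.obj b) (X.obj a)).gr 0 := by
        rw [C.matOne_ne X h]; exact Submodule.zero_mem _
      exact this
  d_one X := by
    funext ⟨a, b⟩
    have : (C.Hom (X.obj b) (X.obj a)).d (C.matOne X (a, b)) = 0 := by
      by_cases h : b = a
      · subst h; rw [C.matOne_self, C.d_one]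
      · rw [C.matOne_ne X h, map_zero]
    exact this
  comp_mem {X Y Z i j f g} hf hg := by
    rintro ⟨a, c⟩ -
    exact Submodule.sum_mem _ fun b _ => C.comp_mem (hf (a, b) trivial) (hg (b, c) trivial)
  d_comp {X Y Z i f} g hf := by
    funext ⟨a, c⟩
    refine (map_sum (C.Hom (X.obj c) (Z.obj a)).d _ _).trans ?_
    refine (Finset.sum_congr rfl fun b _ => C.d_comp (g (b, c)) (hf (a, b) trivial)).trans ?_
    rw [Finset.sum_add_distrib, ← Finset.smul_sum]
    rfl
  one_comp f := C.matOne_comp f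
  comp_one f := C.matComp_one f
  assoc f g h := C.matComp_assoc f g h

/-- The endomorphism `f ↦ β ∘ f - (-1) ^ ⟨ι, |f|⟩ f ∘ α` of `Hom(X, Y)`. -/
def twMap (C : DGCat.{v, w} k S) {X Y : C.Obj} (α : C.Hom X X) (β : C.Hom Y Y) :
    C.Hom X Y →ₗ[k] C.Hom X Y :=
  C.comp β - C.comp.flip α ∘ₗ (C.Hom X Y).koszul S.ι

theorem twMap_apply (C : DGCat.{v, w} k S) {X Y : C.Obj} (α : C.Hom X X) (β : C.Hom Y Y)
    (f : C.Hom X Y) : C.twMap α β f = C.comp β f - C.comp ((C.Hom X Y).koszul S.ι f) α := rfl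

theorem twMap_mem (C : DGCat.{v, w} k S) {X Y : C.Obj} {α : C.Hom X X} {β : C.Hom Y Y}
    (hα : α ∈ (C.Hom X X).gr S.ι) (hβ : β ∈ (C.Hom Y Y).gr S.ι) {i : Γ} {f : C.Hom X Y}
    (hf : f ∈ (C.Hom X Y).gr i) : C.twMap α β f ∈ (C.Hom X Y).gr (i + S.ι) := by
  rw [twMap_apply]
  refine Submodule.sub_mem _ ?_ (C.comp_mem ((C.Hom X Y).koszul_mem _ hf) hα)
  rw [add_comm]; exact C.comp_mem hβ hf

theorem twMap_mc (C : DGCat.{v, w} k S) {X Y : C.Obj} {α : C.Hom X X} {β : C.Hom Y Y}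
    (hα : α ∈ (C.Hom X X).gr S.ι) (hα' : (C.Hom X X).d α + C.comp α α = 0)
    (hβ : β ∈ (C.Hom Y Y).gr S.ι) (hβ' : (C.Hom Y Y).d β + C.comp β β = 0) (f : C.Hom X Y) :
    (C.Hom X Y).d (C.twMap α β f) + C.twMap α β ((C.Hom X Y).d f)
      + C.twMap α β (C.twMap α β f) = 0 := by
  rw [add_eq_zero_iff_eq_neg] at hα' hβ'
  simp only [twMap_apply, map_sub,
    C.d_comp', C.koszul_comp, DGMod.koszul_koszul, DGMod.d_koszul_ι, hα', hβ',
    DGMod.koszul_of_mem _ _ hα, DGMod.koszul_of_mem _ _ hβ, S.pairing_ι, ksign_one,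
    map_neg, LinearMap.neg_apply, C.assoc, neg_smul, one_smul]
  abel

theorem tw_d_one (C : DGCat.{v, w} k S) {X : C.Obj} (α : C.Hom X X) :
    ((C.Hom X X).d + C.twMap α α) (C.one X) = 0 := by
  have h2 := DGMod.koszul_of_mem _ S.ι (C.one_mem X)
  rw [map_zero, ksign_zero, one_smul] at h2
  rw [LinearMap.add_apply, C.d_one, twMap_apply, h2, C.one_comp, C.comp_one, sub_self, add_zero]

theorem tw_d_comp (C : DGCat.{v, w} k S) {X Y Z : C.Obj} (α : C.Hom X X) (β : C.Hom Y Y)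
    (γ : C.Hom Z Z) {i : Γ} {f : C.Hom Y Z} (g : C.Hom X Y) (hf : f ∈ (C.Hom Y Z).gr i) :
    ((C.Hom X Z).d + C.twMap α γ) (C.comp f g) =
      C.comp (((C.Hom Y Z).d + C.twMap β γ) f) g +
        ksign k (S.pairing S.ι i) • C.comp f (((C.Hom X Y).d + C.twMap α β) g) := by
  simp only [LinearMap.add_apply, twMap_apply, C.d_comp g hf, C.koszul_comp,
    DGMod.koszul_of_mem _ S.ι hf, map_add, map_sub, map_smul, LinearMap.smul_apply,
    LinearMap.sub_apply, C.assoc, smul_add, smul_sub]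
  abel

/-- A formal twist `tw_α(obj)`, with `α` an endomorphism of degree `ι` that satisfies the
Maurer-Cartan equation `d α + α² = 0`. -/
structure TwObj (C : DGCat.{v, w} k S) where
  obj : C.Obj
  α : C.Hom obj obj
  α_mem : α ∈ (C.Hom obj obj).gr S.ι
  mc : (C.Hom obj obj).d α + C.comp α α = 0

/-- The twisted envelope `Tw(C)`. The differential of a morphism `f` from `tw_α(X)` to `tw_β(Y)` is
`d f + β ∘ f - (-1) ^ ⟨ι, |f|⟩ f ∘ α`. -/
def Tw (C : DGCat.{v, w} k S) : DGCat.{v, max v w} k S where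
  Obj := C.TwObj
  Hom X Y := (C.Hom X.obj Y.obj).twist (C.twMap X.α Y.α)
    (fun hm => C.twMap_mem X.α_mem Y.α_mem hm) (C.twMap_mc X.α_mem X.mc Y.α_mem Y.mc)
  one X := C.one X.obj
  comp {X Y Z} := C.comp (X := X.obj) (Y := Y.obj) (Z := Z.obj)
  one_mem X := C.one_mem X.obj
  d_one X := C.tw_d_one X.α
  comp_mem hf hg := C.comp_mem hf hg
  d_comp {X Y Z _ _} g hf := C.tw_d_comp X.α Y.α Z.α g hf
  one_comp _ := C.one_comp _
  comp_one _ := C.comp_one _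
  assoc _ _ _ := C.assoc _ _ _

/-- The full dg subcategory on the objects that satisfy `P`. -/
def fullSub (C : DGCat.{v, w} k S) (P : C.Obj → Prop) : DGCat.{v, w} k S where
  Obj := {X : C.Obj // P X}
  Hom X Y := C.Hom X.1 Y.1
  one X := C.one X.1
  comp := C.comp
  one_mem X := C.one_mem X.1
  d_one X := C.d_one X.1
  comp_mem := C.comp_mem
  d_comp := C.d_comp
  one_comp := C.one_comp
  comp_one := C.comp_one
  assoc := C.assoc

/-- The dg category of finite twisted complexes `tw_α(⨁ q^(i_a) X_a)` over `C`. -/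
abbrev Twix (C : DGCat.{v, w} k S) : DGCat k S := C.SB.AddEnv.Tw

/-- A twisted complex is one-sided if for some partial order on its (finite) indexing set the entry
`α (a, b)` vanishes unless `a > b`. -/
def OneSided {C : DGCat.{v, w} k S} (T : C.SB.AddEnv.TwObj) : Prop :=
  let A : C.SB.FinFamily := T.obj
  let α : C.SB.Mat A A := T.α
  ∃ r : PartialOrder A.idx, ∀ a b : A.idx, ¬ r.lt b a → α (a, b) = 0

/-- The pretriangulated envelope: the full subcategory of one-sided finite twisted complexes. -/
def Pretr (C : DGCat.{v, w} k S) : DGCat.{v, max 1 t v w} k S := C.Twix.fullSub OneSided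

/-- The object `X = q^0 X` of `SB(C)`. -/
def toSB (C : DGCat.{v, w} k S) (X : C.Obj) : C.SB.Obj := SBObj.mk 0 X

/-- The object `X` of `A(C)`, the direct sum of a one-element family. -/
def toAdd (C : DGCat.{v, w} k S) (X : C.Obj) : C.AddEnv.Obj := FinFamily.mk Unit fun _ => X

/-- The object `X = tw_0(X)` of `Tw(C)`. -/
def toTw (C : DGCat.{v, w} k S) (X : C.Obj) : C.Tw.Obj :=
  TwObj.mk X 0 (Submodule.zero_mem _) (by simp)

/-- The object `X = tw_0(q^0 X)` of `pretr(C)`. -/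
def toPretr (C : DGCat.{v, w} k S) (X : C.Obj) : C.Pretr.Obj :=
  ⟨C.SB.AddEnv.toTw (C.SB.toAdd (C.toSB X)), (inferInstance : PartialOrder Unit), fun _ _ _ => rfl⟩

/-- The twisted complex `tw_α(⨁ q^(i_a) X_a)` is constructed from objects `X_a` in `𝒳`. -/
def BuiltFrom {C : DGCat.{v, w} k S} (T : C.SB.AddEnv.TwObj) (𝒳 : Set C.Obj) : Prop :=
  let A : C.SB.FinFamily := T.obj
  ∀ a : A.idx, SBObj.obj (A.obj a) ∈ 𝒳

/-- `𝒳` generates `D`: every object `Y` of `D` is homotopy equivalent (in `pretr(D)`, where `Y`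
stands for `tw_0(q^0 Y)`) to a finite one-sided twisted complex constructed from objects in `𝒳`. -/
def Generates (D : DGCat.{v, w} k S) (𝒳 : Set D.Obj) : Prop :=
  ∀ Y : D.Obj, ∃ T : D.Pretr.Obj, BuiltFrom T.1 𝒳 ∧ D.Pretr.HtpyEquiv (D.toPretr Y) T

end DGCat

/-- A `(C, D)`-bimodule: dg modules `⟨X|M|Y⟩` with commuting, associative and unital actions
`⟨X'|C|X⟩ ⊗ ⟨X|M|Y⟩ → ⟨X'|M|Y⟩` and `⟨X|M|Y⟩ ⊗ ⟨Y|D|Y'⟩ → ⟨X|M|Y'⟩` that are chain maps. -/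
structure DGBimod {k : Type u} [CommRing k] {Γ : Type t} [AddCommGroup Γ] {S : GradingDatum Γ}
    (C D : DGCat.{v, w} k S) where
  obj : C.Obj → D.Obj → DGMod.{max v w} k S
  lact : ∀ {X X' Y}, C.Hom X X' →ₗ[k] obj X Y →ₗ[k] obj X' Y
  ract : ∀ {X Y Y'}, obj X Y →ₗ[k] D.Hom Y' Y →ₗ[k] obj X Y'
  one_lact : ∀ {X Y} (m : obj X Y), lact (C.one X) m = m
  comp_lact : ∀ {X X' X'' Y} (f : C.Hom X' X'') (g : C.Hom X X') (m : obj X Y),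
    lact (C.comp f g) m = lact f (lact g m)
  ract_one : ∀ {X Y} (m : obj X Y), ract m (D.one Y) = m
  ract_comp : ∀ {X Y Y' Y''} (m : obj X Y) (f : D.Hom Y' Y) (g : D.Hom Y'' Y'),
    ract m (D.comp f g) = ract (ract m f) g
  lact_ract : ∀ {X X' Y Y'} (f : C.Hom X X') (m : obj X Y) (g : D.Hom Y' Y),
    ract (lact f m) g = lact f (ract m g)
  lact_mem : ∀ {X X' Y} {i j : Γ} {f : C.Hom X X'} {m : obj X Y},
    f ∈ (C.Hom X X').gr i → m ∈ (obj X Y).gr j → lact f m ∈ (obj X' Y).gr (i + j)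
  ract_mem : ∀ {X Y Y'} {i j : Γ} {m : obj X Y} {g : D.Hom Y' Y},
    m ∈ (obj X Y).gr i → g ∈ (D.Hom Y' Y).gr j → ract m g ∈ (obj X Y').gr (i + j)
  d_lact : ∀ {X X' Y} {i : Γ} {f : C.Hom X X'} (m : obj X Y), f ∈ (C.Hom X X').gr i →
    (obj X' Y).d (lact f m) =
      lact ((C.Hom X X').d f) m + ksign k (S.pairing S.ι i) • lact f ((obj X Y).d m)
  d_ract : ∀ {X Y Y'} {i : Γ} {m : obj X Y} (g : D.Hom Y' Y), m ∈ (obj X Y).gr i →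
    (obj X Y').d (ract m g) =
      ract ((obj X Y).d m) g + ksign k (S.pairing S.ι i) • ract m ((D.Hom Y' Y).d g)

namespace DGBimod

variable {k : Type u} [CommRing k] {Γ : Type t} [AddCommGroup Γ] {S : GradingDatum Γ}
  {C D : DGCat.{v, w} k S}

/-- The morphisms of degree `l` in the dg category of `(C, D)`-bimodules: families of `k`-linear
maps of degree `l` with `φ (f · m · g) = (-1) ^ ⟨l, |f|⟩ f · φ m · g`. -/
structure HomDeg (M N : DGBimod C D) (l : Γ) where
  app : ∀ X Y, M.obj X Y →ₗ[k] N.obj X Y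
  app_mem : ∀ {X Y} {i : Γ} {m : M.obj X Y}, m ∈ (M.obj X Y).gr i → app X Y m ∈ (N.obj X Y).gr (i + l)
  app_lact : ∀ {X X' Y} {j : Γ} {f : C.Hom X X'} (m : M.obj X Y), f ∈ (C.Hom X X').gr j →
    app X' Y (M.lact f m) = ksign k (S.pairing l j) • N.lact f (app X Y m)
  app_ract : ∀ {X Y Y'} (m : M.obj X Y) (g : D.Hom Y' Y),
    app X Y' (M.ract m g) = N.ract (app X Y m) g

/-- The differential `d φ = d_N ∘ φ - (-1) ^ ⟨ι, l⟩ φ ∘ d_M` of a morphism `φ` of degree `l`, as a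
family of `k`-linear maps. -/
def HomDeg.diff {M N : DGBimod C D} {l : Γ} (φ : HomDeg M N l) (X : C.Obj) (Y : D.Obj) :
    M.obj X Y →ₗ[k] N.obj X Y :=
  (N.obj X Y).d ∘ₗ φ.app X Y - ksign k (S.pairing S.ι l) • φ.app X Y ∘ₗ (M.obj X Y).d

/-- `M` and `N` are homotopy equivalent in the dg category of `(C, D)`-bimodules: there are closed
bimodule morphisms of degree zero between them that are mutually inverse up to exact ones. -/
def HtpyEquiv (M N : DGBimod C D) : Prop :=
  ∃ (φ : HomDeg M N 0) (ψ : HomDeg N M 0),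
    (∀ X Y, φ.diff X Y = 0) ∧ (∀ X Y, ψ.diff X Y = 0) ∧
    (∃ h : HomDeg M M (-S.ι), ∀ X Y, h.diff X Y = ψ.app X Y ∘ₗ φ.app X Y - LinearMap.id) ∧
    (∃ h : HomDeg N N (-S.ι), ∀ X Y, h.diff X Y = φ.app X Y ∘ₗ ψ.app X Y - LinearMap.id)

end DGBimod

namespace DGCat

section Bar

open scoped Classical

variable {k : Type u} [CommRing k] {Γ : Type t} [AddCommGroup Γ] {S : GradingDatum Γ}
  (D : DGCat.{v, w} k S) {I : Type w} (x : I → D.Obj)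

/-- For `L = [a_0, …, a_r]` this is the dg module
`⟨Y|X_0⟩ ⊗ ⟨X_0|X_1⟩ ⊗ ⋯ ⊗ ⟨X_{r-1}|X_r⟩ ⊗ ⟨X_r|Y'⟩` where `X_i = x a_i`. -/
def barTerm (Y' : D.Obj) : List I → D.Obj → DGMod.{v} k S
  | [], Y => D.Hom Y' Y
  | a :: L, Y => (D.Hom (x a) Y).tensor (barTerm Y' L (x a))

/-- The simple tensor `f ⊗ w`. -/
def barCons (Y' : D.Obj) (a : I) (L : List I) (Y : D.Obj) :
    D.Hom (x a) Y →ₗ[k] D.barTerm x Y' L (x a) →ₗ[k] D.barTerm x Y' (a :: L) Y :=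
  TensorProduct.mk k (D.Hom (x a) Y) (D.barTerm x Y' L (x a))

/-- Composition with the first factor: `g ⊗ [f_0, …, f_{r+1}] ↦ [g ∘ f_0, …, f_{r+1}]`. -/
def termL (Y' : D.Obj) : ∀ (L : List I) {Y Z : D.Obj},
    D.Hom Y Z →ₗ[k] D.barTerm x Y' L Y →ₗ[k] D.barTerm x Y' L Z
  | [], _, _ => D.comp
  | a :: L, Y, Z => LinearMap.rTensorHom (D.barTerm x Y' L (x a)) ∘ₗ
      (D.comp : D.Hom Y Z →ₗ[k] D.Hom (x a) Y →ₗ[k] D.Hom (x a) Z)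

/-- Composition with the last factor: `[f_0, …, f_{r+1}] ⊗ g ↦ [f_0, …, f_{r+1} ∘ g]`. -/
def termR {Y' Y'' : D.Obj} : ∀ (L : List I) {Y : D.Obj},
    D.barTerm x Y' L Y →ₗ[k] D.Hom Y'' Y' →ₗ[k] D.barTerm x Y'' L Y
  | [], _ => D.comp
  | a :: L, Y => (LinearMap.lTensorHom (D.Hom (x a) Y) ∘ₗ (termR L (Y := x a)).flip).flip

section Terms

variable {D x}
variable {Y' Y'' Y''' Y Z W : D.Obj} {a : I} {L : List I}

theorem barCons_induction {P : D.barTerm x Y' (a :: L) Y → Prop} (t : D.barTerm x Y' (a :: L) Y)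
    (h0 : P 0) (hadd : ∀ s t, P s → P t → P (s + t)) (h : ∀ f w, P (D.barCons x Y' a L Y f w)) :
    P t :=
  TensorProduct.induction_on (motive := P) t h0 h hadd

theorem barCons_gr_induction {P : D.barTerm x Y' (a :: L) Y → Prop} {l : Γ}
    {t : D.barTerm x Y' (a :: L) Y} (ht : t ∈ (D.barTerm x Y' (a :: L) Y).gr l)
    (h0 : P 0) (hadd : ∀ s t, P s → P t → P (s + t)) (hsmul : ∀ (c : k) t, P t → P (c • t))
    (h : ∀ i j, i + j = l → ∀ f ∈ (D.Hom (x a) Y).gr i, ∀ w ∈ (D.barTerm x Y' L (x a)).gr j,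
      P (D.barCons x Y' a L Y f w)) :
    P t :=
  DGMod.tensor_gr_induction (P := P) ht h0 hadd hsmul h

theorem barCons_mem {i j : Γ} {f : D.Hom (x a) Y} {w : D.barTerm x Y' L (x a)}
    (hf : f ∈ (D.Hom (x a) Y).gr i) (hw : w ∈ (D.barTerm x Y' L (x a)).gr j) :
    D.barCons x Y' a L Y f w ∈ (D.barTerm x Y' (a :: L) Y).gr (i + j) :=
  DGMod.tmul_mem_tensor hf hw

theorem d_barCons (f : D.Hom (x a) Y) (w : D.barTerm x Y' L (x a)) :
    (D.barTerm x Y' (a :: L) Y).d (D.barCons x Y' a L Y f w) =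
      D.barCons x Y' a L Y ((D.Hom (x a) Y).d f) w +
        D.barCons x Y' a L Y ((D.Hom (x a) Y).koszul S.ι f) ((D.barTerm x Y' L (x a)).d w) := rfl

theorem koszul_barCons (j : Γ) (f : D.Hom (x a) Y) (w : D.barTerm x Y' L (x a)) :
    (D.barTerm x Y' (a :: L) Y).koszul j (D.barCons x Y' a L Y f w) =
      D.barCons x Y' a L Y ((D.Hom (x a) Y).koszul j f) ((D.barTerm x Y' L (x a)).koszul j w) := by
  refine (D.Hom (x a) Y).hom_induction (P := fun f => (D.barTerm x Y' (a :: L) Y).koszul j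
    (D.barCons x Y' a L Y f w) = D.barCons x Y' a L Y ((D.Hom (x a) Y).koszul j f)
      ((D.barTerm x Y' L (x a)).koszul j w)) f (by simp) ?_ ?_
  · intro f g hf hg; simp only [map_add, LinearMap.add_apply, hf, hg]
  intro i f hf
  refine (D.barTerm x Y' L (x a)).hom_induction (P := fun w => (D.barTerm x Y' (a :: L) Y).koszul j
    (D.barCons x Y' a L Y f w) = D.barCons x Y' a L Y ((D.Hom (x a) Y).koszul j f)
      ((D.barTerm x Y' L (x a)).koszul j w)) w (by simp) ?_ ?_
  · intro f g hf hg; simp only [map_add, hf, hg]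
  intro l w hw
  rw [DGMod.koszul_of_mem _ _ (barCons_mem hf hw), DGMod.koszul_of_mem _ _ hf,
    DGMod.koszul_of_mem _ _ hw, map_smul, map_smul, LinearMap.smul_apply, smul_smul, map_add,
    ksign_add, mul_comm]

theorem termL_cons (g : D.Hom Y Z) (f : D.Hom (x a) Y) (w : D.barTerm x Y' L (x a)) :
    D.termL x Y' (a :: L) g (D.barCons x Y' a L Y f w) =
      D.barCons x Y' a L Z (D.comp g f) w := rfl

theorem termR_cons (f : D.Hom (x a) Y) (w : D.barTerm x Y' L (x a)) (g : D.Hom Y'' Y') :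
    D.termR x (a :: L) (D.barCons x Y' a L Y f w) g =
      D.barCons x Y'' a L Y f (D.termR x L w g) := rfl

theorem termL_one (t : D.barTerm x Y' L Y) : D.termL x Y' L (D.one Y) t = t := by
  cases L with
  | nil => exact D.one_comp _
  | cons a L =>
    refine barCons_induction (P := fun t => D.termL x Y' (a :: L) (D.one Y) t = t) t (by simp) ?_ ?_
    · intro s t hs ht; rw [map_add, hs, ht]
    · intro f w; rw [termL_cons, D.one_comp]

theorem termL_comp (g : D.Hom Z W) (g' : D.Hom Y Z) (t : D.barTerm x Y' L Y) :
    D.termL x Y' L (D.comp g g') t = D.termL x Y' L g (D.termL x Y' L g' t) := by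
  cases L with
  | nil => exact D.assoc _ _ _
  | cons a L =>
    refine barCons_induction (P := fun t => D.termL x Y' (a :: L) (D.comp g g') t =
      D.termL x Y' (a :: L) g (D.termL x Y' (a :: L) g' t)) t (by simp) ?_ ?_
    · intro s t hs ht; rw [map_add, hs, ht, map_add, map_add]
    · intro f w; rw [termL_cons, termL_cons, termL_cons, D.assoc]

theorem termL_mem {i j : Γ} {g : D.Hom Y Z} {t : D.barTerm x Y' L Y}
    (hg : g ∈ (D.Hom Y Z).gr i) (ht : t ∈ (D.barTerm x Y' L Y).gr j) :
    D.termL x Y' L g t ∈ (D.barTerm x Y' L Z).gr (i + j) := by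
  cases L with
  | nil => exact D.comp_mem hg ht
  | cons a L =>
    refine barCons_gr_induction (P := fun t => D.termL x Y' (a :: L) g t ∈
      (D.barTerm x Y' (a :: L) Z).gr (i + j)) ht ?_ ?_ ?_ ?_
    · rw [map_zero]; exact Submodule.zero_mem _
    · intro s t hs ht; rw [map_add]; exact Submodule.add_mem _ hs ht
    · intro c t ht; rw [map_smul]; exact Submodule.smul_mem _ _ ht
    · rintro l m rfl f hf w hw
      rw [termL_cons, ← add_assoc]
      exact barCons_mem (D.comp_mem hg hf) hw

theorem d_termL (g : D.Hom Y Z) (t : D.barTerm x Y' L Y) :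
    (D.barTerm x Y' L Z).d (D.termL x Y' L g t) =
      D.termL x Y' L ((D.Hom Y Z).d g) t +
        D.termL x Y' L ((D.Hom Y Z).koszul S.ι g) ((D.barTerm x Y' L Y).d t) := by
  cases L with
  | nil => exact D.d_comp' _ _
  | cons a L =>
    refine barCons_induction (P := fun t =>
      (D.barTerm x Y' (a :: L) Z).d (D.termL x Y' (a :: L) g t) =
        D.termL x Y' (a :: L) ((D.Hom Y Z).d g) t +
        D.termL x Y' (a :: L) ((D.Hom Y Z).koszul S.ι g) ((D.barTerm x Y' (a :: L) Y).d t))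
        t (by simp) ?_ ?_
    · intro s t hs ht; simp only [map_add, hs, ht]; abel
    · intro f w
      simp only [termL_cons, d_barCons, D.d_comp', D.koszul_comp, map_add, LinearMap.add_apply]
      abel

theorem termR_one (t : D.barTerm x Y' L Y) : D.termR x L t (D.one Y') = t := by
  induction L generalizing Y with
  | nil => exact D.comp_one _
  | cons a L ih =>
    refine barCons_induction (P := fun t => D.termR x (a :: L) t (D.one Y') = t) t (by simp) ?_ ?_
    · intro s t hs ht; rw [map_add, LinearMap.add_apply, hs, ht]
    · intro f w; rw [termR_cons, ih]

theorem termR_comp (t : D.barTerm x Y' L Y) (g : D.Hom Y'' Y') (g' : D.Hom Y''' Y'') :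
    D.termR x L t (D.comp g g') = D.termR x L (D.termR x L t g) g' := by
  induction L generalizing Y with
  | nil => exact (D.assoc _ _ _).symm
  | cons a L ih =>
    refine barCons_induction (P := fun t => D.termR x (a :: L) t (D.comp g g') =
      D.termR x (a :: L) (D.termR x (a :: L) t g) g') t (by simp) ?_ ?_
    · intro s t hs ht; simp only [map_add, LinearMap.add_apply, hs, ht]
    · intro f w; rw [termR_cons, ih, termR_cons, termR_cons]

theorem termL_termR (g : D.Hom Y Z) (t : D.barTerm x Y' L Y) (h : D.Hom Y'' Y') :
    D.termR x L (D.termL x Y' L g t) h = D.termL x Y'' L g (D.termR x L t h) := by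
  cases L with
  | nil => exact D.assoc _ _ _
  | cons a L =>
    refine barCons_induction (P := fun t => D.termR x (a :: L) (D.termL x Y' (a :: L) g t) h =
      D.termL x Y'' (a :: L) g (D.termR x (a :: L) t h)) t (by simp) ?_ ?_
    · intro s t hs ht; simp only [map_add, LinearMap.add_apply, hs, ht]
    · intro f w; rw [termL_cons, termR_cons, termR_cons, termL_cons]

theorem termR_mem {i j : Γ} {t : D.barTerm x Y' L Y} {g : D.Hom Y'' Y'}
    (ht : t ∈ (D.barTerm x Y' L Y).gr i) (hg : g ∈ (D.Hom Y'' Y').gr j) :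
    D.termR x L t g ∈ (D.barTerm x Y'' L Y).gr (i + j) := by
  induction L generalizing Y i with
  | nil => exact D.comp_mem ht hg
  | cons a L ih =>
    refine barCons_gr_induction (P := fun t => D.termR x (a :: L) t g ∈
      (D.barTerm x Y'' (a :: L) Y).gr (i + j)) ht ?_ ?_ ?_ ?_
    · rw [map_zero]; exact Submodule.zero_mem _
    · intro s t hs ht; rw [map_add]; exact Submodule.add_mem _ hs ht
    · intro c t ht; rw [map_smul]; exact Submodule.smul_mem _ _ ht
    · rintro l m rfl f hf w hw
      rw [termR_cons, add_assoc]
      exact barCons_mem hf (ih hw)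

theorem d_termR (t : D.barTerm x Y' L Y) (g : D.Hom Y'' Y') :
    (D.barTerm x Y'' L Y).d (D.termR x L t g) =
      D.termR x L ((D.barTerm x Y' L Y).d t) g +
        D.termR x L ((D.barTerm x Y' L Y).koszul S.ι t) ((D.Hom Y'' Y').d g) := by
  induction L generalizing Y with
  | nil => exact D.d_comp' _ _
  | cons a L ih =>
    refine barCons_induction (P := fun t =>
      (D.barTerm x Y'' (a :: L) Y).d (D.termR x (a :: L) t g) =
        D.termR x (a :: L) ((D.barTerm x Y' (a :: L) Y).d t) g +
        D.termR x (a :: L) ((D.barTerm x Y' (a :: L) Y).koszul S.ι t) ((D.Hom Y'' Y').d g))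
        t (by simp) ?_ ?_
    · intro s t hs ht; simp only [map_add, LinearMap.add_apply, hs, ht]; abel
    · intro f w
      simp only [termR_cons, d_barCons, koszul_barCons, ih, map_add, LinearMap.add_apply]
      abel

end Terms

/-- The shift of the summand of the bar complex indexed by `X_0, …, X_r`. -/
def barShift (p : I × List I) : Γ := -(p.2.length • S.ι)

/-- The dg module
`⨁_{r ≥ 0} q^(-rι) ⨁_{X_0, …, X_r} ⟨Y|X_0⟩ ⊗ ⟨X_0|X_1⟩ ⊗ ⋯ ⊗ ⟨X_{r-1}|X_r⟩ ⊗ ⟨X_r|Y'⟩`. The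
summand of the nonempty sequence `X_0, …, X_r` is indexed by the pair `(X_0, [X_1, …, X_r])`. -/
def barSum (Y' Y : D.Obj) : DGMod.{max v w} k S :=
  DGMod.directSumShift (fun p : I × List I => D.barTerm x Y' (p.1 :: p.2) Y)
    (barShift (S := S))

/-- The inclusion of a summand. -/
def barInc (Y' Y : D.Obj) (p : I × List I) :
    D.barTerm x Y' (p.1 :: p.2) Y →ₗ[k] D.barSum x Y' Y :=
  DirectSum.lof k _ (fun p : I × List I => D.barTerm x Y' (p.1 :: p.2) Y) p

/-- The linear map on the direct sum with given restrictions to the summands. -/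
def barLift {Y' Y : D.Obj} {N : Type*} [AddCommGroup N] [Module k N]
    (f : ∀ p : I × List I, D.barTerm x Y' (p.1 :: p.2) Y →ₗ[k] N) : D.barSum x Y' Y →ₗ[k] N :=
  DirectSum.toModule k _ N f

/-- `f ⊗ [f_0, …, f_{r+1}] ↦ [f, f_0, …, f_{r+1}]`. -/
def barPrepend (Y' : D.Obj) (a : I) (Y : D.Obj) :
    D.Hom (x a) Y →ₗ[k] D.barSum x Y' (x a) →ₗ[k] D.barSum x Y' Y :=
  (D.barLift x fun p =>
    ((D.barCons x Y' a (p.1 :: p.2) Y).compr₂ (D.barInc x Y' Y (a, p.1 :: p.2))).flip).flip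

/-- The element `[f, g]` of the summand of `X_0 = x a`. -/
def barPair (Y' : D.Obj) (a : I) (Y : D.Obj) :
    D.Hom (x a) Y →ₗ[k] D.Hom Y' (x a) →ₗ[k] D.barSum x Y' Y :=
  (D.barCons x Y' a [] Y).compr₂ (D.barInc x Y' Y (a, []))

/-- The counit on the summand of `X_0, …, X_r`, here `X_0 = x a` and `L` lists the rest:
`[f_0, f_1] ↦ f_0 ∘ f_1` for `r = 0`, and zero for `r ≥ 1`. -/
def barEps (Y' : D.Obj) : ∀ (L : List I) (a : I) (Y : D.Obj),
    D.barTerm x Y' (a :: L) Y →ₗ[k] D.Hom Y' Y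
  | [], a, Y => TensorProduct.lift (D.comp : D.Hom (x a) Y →ₗ[k] D.Hom Y' (x a) →ₗ[k] D.Hom Y' Y)
  | _ :: _, _, _ => 0

/-- The counit of the bar complex. -/
def barCounit (Y' Y : D.Obj) : D.barSum x Y' Y →ₗ[k] D.Hom Y' Y :=
  D.barLift x fun p => D.barEps x Y' p.2 p.1 Y

/-- The bar differential on the summand of `X_0, …, X_r`, here `X_0 = x a` and `L` lists the rest:
`[f_0, …, f_{r+1}] ↦ ∑_{0 ≤ i ≤ r} (-1)^i [f_0, …, f_i ∘ f_{i+1}, …, f_{r+1}]` for `r ≥ 1`, and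
zero for `r = 0`. It is computed recursively from
`δ [f_0, f_1, …] = [f_0 ∘ f_1, …] - f_0 ⊗ ε [f_1, …] - f_0 ⊗ δ [f_1, …]`, where the counit `ε`
accounts for the term `[f_0, f_1 ∘ f_2]` that arises when `r = 1`. -/
def barDelta (Y' : D.Obj) : ∀ (L : List I) (a : I) (Y : D.Obj),
    D.barTerm x Y' (a :: L) Y →ₗ[k] D.barSum x Y' Y
  | [], _, _ => 0
  | b :: L, a, Y => TensorProduct.lift
      ((D.termL x Y' (b :: L)).compr₂ (D.barInc x Y' Y (b, L)) -
        (D.barPair x Y' a Y).compl₂ (D.barEps x Y' L b (x a)) -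
        (D.barPrepend x Y' a Y).compl₂ (barDelta Y' L b (x a)))

/-- The bar differential. -/
def barTwist (Y' Y : D.Obj) : D.barSum x Y' Y →ₗ[k] D.barSum x Y' Y :=
  D.barLift x fun p => D.barDelta x Y' p.2 p.1 Y

/-- The left action
`g · [f_0, f_1, …, f_{r+1}] = (-1) ^ (r ⟨ι, |g|⟩) [g ∘ f_0, f_1, …, f_{r+1}]`. -/
def barL (Y' : D.Obj) {Y Z : D.Obj} :
    D.Hom Y Z →ₗ[k] D.barSum x Y' Y →ₗ[k] D.barSum x Y' Z :=
  (D.barLift x fun p => ((D.termL x Y' (p.1 :: p.2) ∘ₗ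
    (D.Hom Y Z).koszul (barShift (S := S) p)).compr₂ (D.barInc x Y' Z p)).flip).flip

/-- The right action `[f_0, …, f_r, f_{r+1}] · g = [f_0, …, f_r, f_{r+1} ∘ g]`. -/
def barR {Y' Y'' : D.Obj} {Y : D.Obj} :
    D.barSum x Y' Y →ₗ[k] D.Hom Y'' Y' →ₗ[k] D.barSum x Y'' Y :=
  D.barLift x fun p => (D.termR x (p.1 :: p.2)).compr₂ (D.barInc x Y'' Y p)

/-- The left action without signs. -/
def barL0 (Y' : D.Obj) {Y Z : D.Obj} :
    D.Hom Y Z →ₗ[k] D.barSum x Y' Y →ₗ[k] D.barSum x Y' Z :=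
  (D.barLift x fun p => ((D.termL x Y' (p.1 :: p.2)).compr₂ (D.barInc x Y' Z p)).flip).flip

/-- The sum of the differentials of the summands, without signs. -/
def barD0 (Y' Y : D.Obj) : D.barSum x Y' Y →ₗ[k] D.barSum x Y' Y :=
  D.barLift x fun p => D.barInc x Y' Y p ∘ₗ (D.barTerm x Y' (p.1 :: p.2) Y).d

/-- The sign `(-1) ^ ⟨-rι, j⟩`. -/
def barSgn (j : Γ) (Y' Y : D.Obj) : D.barSum x Y' Y →ₗ[k] D.barSum x Y' Y :=
  D.barLift x fun p => ksign k (S.pairing (barShift (S := S) p) j) • D.barInc x Y' Y p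

section Lemmas

variable {D x}
variable {Y' Y'' Y''' Y Z W : D.Obj} {a : I} {L : List I}

theorem barLift_inc {N : Type*} [AddCommGroup N] [Module k N]
    (f : ∀ p : I × List I, D.barTerm x Y' (p.1 :: p.2) Y →ₗ[k] N) (p : I × List I)
    (t : D.barTerm x Y' (p.1 :: p.2) Y) : D.barLift x f (D.barInc x Y' Y p t) = f p t :=
  DirectSum.toModule_lof ..

theorem barSum_induction {P : D.barSum x Y' Y → Prop} (u : D.barSum x Y' Y) (h0 : P 0)
    (hadd : ∀ s t, P s → P t → P (s + t)) (h : ∀ p t, P (D.barInc x Y' Y p t)) : P u :=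
  DirectSum.induction_on (motive := P) u h0 (fun p t => h p t) (fun s t => hadd s t)

theorem barSum_gr_induction {P : D.barSum x Y' Y → Prop} {l : Γ} {u : D.barSum x Y' Y}
    (hu : u ∈ (D.barSum x Y' Y).gr l) (h0 : P 0) (hadd : ∀ s t, P s → P t → P (s + t))
    (h : ∀ p i, i + barShift (S := S) p = l → ∀ t ∈ (D.barTerm x Y' (p.1 :: p.2) Y).gr i,
      P (D.barInc x Y' Y p t)) : P u := by
  have e := DirectSum.sum_support_of
    (β := fun p : I × List I => (D.barTerm x Y' (p.1 :: p.2) Y).carrier) u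
  rw [← e]
  exact Finset.sum_induction _ P hadd h0 fun p _ => h p _ (sub_add_cancel l _) _ (hu p)

theorem barInc_mem {p : I × List I} {i : Γ} {t : D.barTerm x Y' (p.1 :: p.2) Y}
    (ht : t ∈ (D.barTerm x Y' (p.1 :: p.2) Y).gr i) :
    D.barInc x Y' Y p t ∈ (D.barSum x Y' Y).gr (i + barShift (S := S) p) := by
  have key : ∀ q : I × List I,
      (DirectSum.of (fun p : I × List I => (D.barTerm x Y' (p.1 :: p.2) Y).carrier) p t) q ∈
        (D.barTerm x Y' (q.1 :: q.2) Y).gr (i + barShift (S := S) p - barShift (S := S) q) := by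
    intro q
    by_cases h : q = p
    · subst h
      rw [DirectSum.of_eq_same, add_sub_cancel_right]; exact ht
    · rw [DirectSum.of_eq_of_ne _ _ _ h]; exact Submodule.zero_mem _
  exact key

theorem barPrepend_inc (f : D.Hom (x a) Y) (p : I × List I)
    (t : D.barTerm x Y' (p.1 :: p.2) (x a)) :
    D.barPrepend x Y' a Y f (D.barInc x Y' (x a) p t) =
      D.barInc x Y' Y (a, p.1 :: p.2) (D.barCons x Y' a (p.1 :: p.2) Y f t) := by
  simp only [barPrepend, LinearMap.flip_apply, barLift_inc, LinearMap.compr₂_apply]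

theorem barTwist_inc (p : I × List I) (t : D.barTerm x Y' (p.1 :: p.2) Y) :
    D.barTwist x Y' Y (D.barInc x Y' Y p t) = D.barDelta x Y' p.2 p.1 Y t := by
  simp only [barTwist, barLift_inc]

theorem barL_inc (g : D.Hom Y Z) (p : I × List I) (t : D.barTerm x Y' (p.1 :: p.2) Y) :
    D.barL x Y' g (D.barInc x Y' Y p t) = D.barInc x Y' Z p
      (D.termL x Y' (p.1 :: p.2) ((D.Hom Y Z).koszul (barShift (S := S) p) g) t) := by
  simp only [barL, LinearMap.flip_apply, barLift_inc, LinearMap.compr₂_apply, LinearMap.comp_apply]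

theorem barL0_inc (g : D.Hom Y Z) (p : I × List I) (t : D.barTerm x Y' (p.1 :: p.2) Y) :
    D.barL0 x Y' g (D.barInc x Y' Y p t) =
      D.barInc x Y' Z p (D.termL x Y' (p.1 :: p.2) g t) := by
  simp only [barL0, LinearMap.flip_apply, barLift_inc, LinearMap.compr₂_apply]

theorem barR_inc (p : I × List I) (t : D.barTerm x Y' (p.1 :: p.2) Y) (g : D.Hom Y'' Y') :
    D.barR x (D.barInc x Y' Y p t) g = D.barInc x Y'' Y p (D.termR x (p.1 :: p.2) t g) := by
  simp only [barR, barLift_inc, LinearMap.compr₂_apply]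

theorem barD0_inc (p : I × List I) (t : D.barTerm x Y' (p.1 :: p.2) Y) :
    D.barD0 x Y' Y (D.barInc x Y' Y p t) =
      D.barInc x Y' Y p ((D.barTerm x Y' (p.1 :: p.2) Y).d t) := by
  simp only [barD0, barLift_inc, LinearMap.comp_apply]

theorem barSgn_inc (j : Γ) (p : I × List I) (t : D.barTerm x Y' (p.1 :: p.2) Y) :
    D.barSgn x j Y' Y (D.barInc x Y' Y p t) =
      ksign k (S.pairing (barShift (S := S) p) j) • D.barInc x Y' Y p t := by
  simp only [barSgn, barLift_inc, LinearMap.smul_apply]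

theorem barSum_d_inc (p : I × List I) (t : D.barTerm x Y' (p.1 :: p.2) Y) :
    (D.barSum x Y' Y).d (D.barInc x Y' Y p t) = ksign k (S.pairing S.ι (barShift (S := S) p)) •
      D.barInc x Y' Y p ((D.barTerm x Y' (p.1 :: p.2) Y).d t) := by
  refine (DirectSum.lmap_lof (fun p : I × List I => ksign k (S.pairing S.ι (barShift (S := S) p)) •
    (D.barTerm x Y' (p.1 :: p.2) Y).d) p t).trans ?_
  rw [LinearMap.smul_apply, map_smul]; rfl

theorem barSum_d (u : D.barSum x Y' Y) :
    (D.barSum x Y' Y).d u = D.barSgn x S.ι Y' Y (D.barD0 x Y' Y u) := by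
  refine barSum_induction (P := fun u => (D.barSum x Y' Y).d u = D.barSgn x S.ι Y' Y
    (D.barD0 x Y' Y u)) u (by simp) ?_ ?_
  · intro s t hs ht; simp only [map_add, hs, ht]
  · intro p t
    rw [barSum_d_inc, barD0_inc, barSgn_inc, S.symm]

theorem barL_eq {i : Γ} {g : D.Hom Y Z} (hg : g ∈ (D.Hom Y Z).gr i) (u : D.barSum x Y' Y) :
    D.barL x Y' g u = D.barL0 x Y' g (D.barSgn x i Y' Y u) := by
  refine barSum_induction (P := fun u => D.barL x Y' g u =
    D.barL0 x Y' g (D.barSgn x i Y' Y u)) u (by simp) ?_ ?_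
  · intro s t hs ht; simp only [map_add, hs, ht]
  · intro p t
    rw [barL_inc, barSgn_inc, map_smul, barL0_inc, DGMod.koszul_of_mem _ _ hg, map_smul,
      LinearMap.smul_apply, map_smul]

theorem barDelta_nil (t : D.barTerm x Y' [a] Y) : D.barDelta x Y' [] a Y t = 0 := rfl

theorem barDelta_cons {b : I} (f : D.Hom (x a) Y) (w : D.barTerm x Y' (b :: L) (x a)) :
    D.barDelta x Y' (b :: L) a Y (D.barCons x Y' a (b :: L) Y f w) =
      D.barInc x Y' Y (b, L) (D.termL x Y' (b :: L) f w) -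
        D.barPair x Y' a Y f (D.barEps x Y' L b (x a) w) -
        D.barPrepend x Y' a Y f (D.barDelta x Y' L b (x a) w) := rfl

theorem barL0_pair (g : D.Hom Y Z) (f : D.Hom (x a) Y) (h : D.Hom Y' (x a)) :
    D.barL0 x Y' g (D.barPair x Y' a Y f h) = D.barPair x Y' a Z (D.comp g f) h :=
  barL0_inc g (a, []) (D.barCons x Y' a [] Y f h)

theorem barR_pair (f : D.Hom (x a) Y) (h : D.Hom Y' (x a)) (g : D.Hom Y'' Y') :
    D.barR x (D.barPair x Y' a Y f h) g = D.barPair x Y'' a Y f (D.comp h g) :=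
  barR_inc (a, []) (D.barCons x Y' a [] Y f h) g

theorem barTwist_pair (f : D.Hom (x a) Y) (h : D.Hom Y' (x a)) :
    D.barTwist x Y' Y (D.barPair x Y' a Y f h) = 0 :=
  barTwist_inc (a, []) (D.barCons x Y' a [] Y f h)

theorem barD0_pair (f : D.Hom (x a) Y) (h : D.Hom Y' (x a)) :
    D.barD0 x Y' Y (D.barPair x Y' a Y f h) =
      D.barPair x Y' a Y ((D.Hom (x a) Y).d f) h +
        D.barPair x Y' a Y ((D.Hom (x a) Y).koszul S.ι f) ((D.Hom Y' (x a)).d h) :=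
  (barD0_inc (a, []) (D.barCons x Y' a [] Y f h)).trans
    ((D.barInc x Y' Y (a, [])).map_add _ _)

theorem barSgn_pair (j : Γ) (f : D.Hom (x a) Y) (h : D.Hom Y' (x a)) :
    D.barSgn x j Y' Y (D.barPair x Y' a Y f h) = D.barPair x Y' a Y f h := by
  refine (barSgn_inc j (a, []) (D.barCons x Y' a [] Y f h)).trans ?_
  have : ksign k (S.pairing (barShift (S := S) (a, ([] : List I))) j) = 1 := by
    simp only [barShift, List.length_nil, zero_smul, neg_zero, map_zero,
      AddMonoidHom.zero_apply, ksign_zero]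
  rw [this, one_smul]; rfl

theorem barPair_mem {i j : Γ} {f : D.Hom (x a) Y} {h : D.Hom Y' (x a)}
    (hf : f ∈ (D.Hom (x a) Y).gr i) (hh : h ∈ (D.Hom Y' (x a)).gr j) :
    D.barPair x Y' a Y f h ∈ (D.barSum x Y' Y).gr (i + j) := by
  have := barInc_mem (p := (a, [])) (barCons_mem (L := []) hf hh)
  rw [show i + j + barShift (S := S) (a, ([] : List I)) = i + j by simp [barShift]] at this
  exact this

theorem barEps_nil (f : D.Hom (x a) Y) (g : D.Hom Y' (x a)) :
    D.barEps x Y' [] a Y (D.barCons x Y' a [] Y f g) = D.comp f g := rfl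

theorem barEps_cons {b : I} (t : D.barTerm x Y' (a :: b :: L) Y) :
    D.barEps x Y' (b :: L) a Y t = 0 := rfl

theorem barCounit_inc (p : I × List I) (t : D.barTerm x Y' (p.1 :: p.2) Y) :
    D.barCounit x Y' Y (D.barInc x Y' Y p t) = D.barEps x Y' p.2 p.1 Y t := by
  simp only [barCounit, barLift_inc]

theorem barCounit_pair (f : D.Hom (x a) Y) (h : D.Hom Y' (x a)) :
    D.barCounit x Y' Y (D.barPair x Y' a Y f h) = D.comp f h :=
  barCounit_inc (a, []) (D.barCons x Y' a [] Y f h)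

theorem barCounit_prepend (f : D.Hom (x a) Y) (u : D.barSum x Y' (x a)) :
    D.barCounit x Y' Y (D.barPrepend x Y' a Y f u) = 0 := by
  refine barSum_induction (P := fun u => D.barCounit x Y' Y (D.barPrepend x Y' a Y f u) = 0)
    u (by simp) ?_ ?_
  · intro s t hs ht; simp only [map_add, hs, ht, add_zero]
  · intro p t
    rw [barPrepend_inc, barCounit_inc, barEps_cons]

theorem barEps_termL (g : D.Hom Y Z) (t : D.barTerm x Y' (a :: L) Y) :
    D.barEps x Y' L a Z (D.termL x Y' (a :: L) g t) = D.comp g (D.barEps x Y' L a Y t) := by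
  cases L with
  | nil =>
    refine barCons_induction (P := fun t => D.barEps x Y' [] a Z (D.termL x Y' [a] g t) =
      D.comp g (D.barEps x Y' [] a Y t)) t (by simp) ?_ ?_
    · intro s t hs ht; simp only [map_add, hs, ht]
    · intro f w; exact D.assoc g f w
  | cons b L => rw [barEps_cons, barEps_cons, map_zero]

theorem barEps_termR (t : D.barTerm x Y' (a :: L) Y) (g : D.Hom Y'' Y') :
    D.barEps x Y'' L a Y (D.termR x (a :: L) t g) = D.comp (D.barEps x Y' L a Y t) g := by
  cases L with
  | nil =>
    refine barCons_induction (P := fun t => D.barEps x Y'' [] a Y (D.termR x [a] t g) =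
      D.comp (D.barEps x Y' [] a Y t) g) t (by simp) ?_ ?_
    · intro s t hs ht; simp only [map_add, LinearMap.add_apply, hs, ht]
    · intro f w; exact (D.assoc f w g).symm
  | cons b L => rw [barEps_cons, barEps_cons, map_zero, LinearMap.zero_apply]

theorem barEps_d (t : D.barTerm x Y' (a :: L) Y) :
    D.barEps x Y' L a Y ((D.barTerm x Y' (a :: L) Y).d t) =
      (D.Hom Y' Y).d (D.barEps x Y' L a Y t) := by
  cases L with
  | nil =>
    refine barCons_induction (P := fun t =>
      D.barEps x Y' [] a Y ((D.barTerm x Y' [a] Y).d t) =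
      (D.Hom Y' Y).d (D.barEps x Y' [] a Y t)) t (by simp) ?_ ?_
    · intro s t hs ht; simp only [map_add, hs, ht]
    · intro f w
      rw [d_barCons, map_add]
      exact (D.d_comp' f w).symm
  | cons b L => rw [barEps_cons, barEps_cons, map_zero]

theorem barEps_mem {l : Γ} {t : D.barTerm x Y' (a :: L) Y}
    (ht : t ∈ (D.barTerm x Y' (a :: L) Y).gr l) :
    D.barEps x Y' L a Y t ∈ (D.Hom Y' Y).gr l := by
  cases L with
  | nil =>
    refine barCons_gr_induction (P := fun t => D.barEps x Y' [] a Y t ∈ (D.Hom Y' Y).gr l)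
      ht ?_ ?_ ?_ ?_
    · rw [map_zero]; exact Submodule.zero_mem _
    · intro s t hs ht; rw [map_add]; exact Submodule.add_mem _ hs ht
    · intro c t ht; rw [map_smul]; exact Submodule.smul_mem _ _ ht
    · rintro i j rfl f hf w hw
      exact D.comp_mem hf hw
  | cons b L => rw [barEps_cons]; exact Submodule.zero_mem _

theorem barShift_cons (b : I) : barShift (S := S) (a, b :: L) = barShift (S := S) (b, L) - S.ι := by
  simp only [barShift, List.length_cons, succ_nsmul]; abel

theorem barPrepend_termL (g : D.Hom Y Z) (f : D.Hom (x a) Y) (u : D.barSum x Y' (x a)) :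
    D.barPrepend x Y' a Z (D.comp g f) u = D.barL0 x Y' g (D.barPrepend x Y' a Y f u) := by
  refine barSum_induction (P := fun u => D.barPrepend x Y' a Z (D.comp g f) u =
    D.barL0 x Y' g (D.barPrepend x Y' a Y f u)) u (by simp) ?_ ?_
  · intro s t hs ht; simp only [map_add, hs, ht]
  · intro p t
    rw [barPrepend_inc, barPrepend_inc, barL0_inc, termL_cons]

theorem barDelta_termL (g : D.Hom Y Z) (t : D.barTerm x Y' (a :: L) Y) :
    D.barDelta x Y' L a Z (D.termL x Y' (a :: L) g t) =
      D.barL0 x Y' g (D.barDelta x Y' L a Y t) := by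
  cases L with
  | nil => rw [barDelta_nil, barDelta_nil, map_zero]
  | cons b L =>
    refine barCons_induction (P := fun t =>
      D.barDelta x Y' (b :: L) a Z (D.termL x Y' (a :: b :: L) g t) =
      D.barL0 x Y' g (D.barDelta x Y' (b :: L) a Y t)) t (by simp) ?_ ?_
    · intro s t hs ht; simp only [map_add, hs, ht]
    · intro f w
      rw [termL_cons, barDelta_cons, barDelta_cons, map_sub, map_sub, barL0_inc, barL0_pair,
        termL_comp, barPrepend_termL]

theorem barTwist_barL0 (g : D.Hom Y Z) (u : D.barSum x Y' Y) :
    D.barTwist x Y' Z (D.barL0 x Y' g u) = D.barL0 x Y' g (D.barTwist x Y' Y u) := by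
  refine barSum_induction (P := fun u => D.barTwist x Y' Z (D.barL0 x Y' g u) =
    D.barL0 x Y' g (D.barTwist x Y' Y u)) u (by simp) ?_ ?_
  · intro s t hs ht; simp only [map_add, hs, ht]
  · intro p t
    rw [barL0_inc, barTwist_inc, barTwist_inc, barDelta_termL]

theorem barTwist_prepend (f : D.Hom (x a) Y) (u : D.barSum x Y' (x a)) :
    D.barTwist x Y' Y (D.barPrepend x Y' a Y f u) =
      D.barL0 x Y' f u -
        D.barPair x Y' a Y f (D.barCounit x Y' (x a) u) -
        D.barPrepend x Y' a Y f (D.barTwist x Y' (x a) u) := by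
  refine barSum_induction (P := fun u => D.barTwist x Y' Y (D.barPrepend x Y' a Y f u) =
    D.barL0 x Y' f u -
      D.barPair x Y' a Y f (D.barCounit x Y' (x a) u) -
      D.barPrepend x Y' a Y f (D.barTwist x Y' (x a) u)) u (by simp) ?_ ?_
  · intro s t hs ht; simp only [map_add, hs, ht]; abel
  · rintro ⟨b, L⟩ t
    rw [barPrepend_inc, barTwist_inc, barTwist_inc, barDelta_cons, barL0_inc, barCounit_inc]

theorem barCounit_barDelta (t : D.barTerm x Y' (a :: L) Y) :
    D.barCounit x Y' Y (D.barDelta x Y' L a Y t) = 0 := by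
  cases L with
  | nil => rw [barDelta_nil, map_zero]
  | cons b L =>
    refine barCons_induction (P := fun t =>
      D.barCounit x Y' Y (D.barDelta x Y' (b :: L) a Y t) = 0) t (by simp) ?_ ?_
    · intro s t hs ht; simp only [map_add, hs, ht, add_zero]
    · intro f w
      rw [barDelta_cons, map_sub, map_sub, barCounit_inc, barCounit_pair, barCounit_prepend,
        barEps_termL, sub_zero, sub_self]

theorem barTwist_barDelta (t : D.barTerm x Y' (a :: L) Y) :
    D.barTwist x Y' Y (D.barDelta x Y' L a Y t) = 0 := by
  induction L generalizing a Y with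
  | nil => rw [barDelta_nil, map_zero]
  | cons b L ih =>
    refine barCons_induction (P := fun t =>
      D.barTwist x Y' Y (D.barDelta x Y' (b :: L) a Y t) = 0) t (by simp) ?_ ?_
    · intro s t hs ht; simp only [map_add, hs, ht, add_zero]
    · intro f w
      rw [barDelta_cons, map_sub, map_sub, barTwist_inc, barTwist_pair, barTwist_prepend,
        barDelta_termL, barCounit_barDelta, ih, map_zero, map_zero, sub_zero, sub_zero,
        sub_self]

theorem barTwist_barTwist (u : D.barSum x Y' Y) :
    D.barTwist x Y' Y (D.barTwist x Y' Y u) = 0 := by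
  refine barSum_induction (P := fun u => D.barTwist x Y' Y (D.barTwist x Y' Y u) = 0)
    u (by simp) ?_ ?_
  · intro s t hs ht; simp only [map_add, hs, ht, add_zero]
  · intro p t; rw [barTwist_inc, barTwist_barDelta]

theorem barD0_prepend (f : D.Hom (x a) Y) (u : D.barSum x Y' (x a)) :
    D.barD0 x Y' Y (D.barPrepend x Y' a Y f u) =
      D.barPrepend x Y' a Y ((D.Hom (x a) Y).d f) u +
        D.barPrepend x Y' a Y ((D.Hom (x a) Y).koszul S.ι f) (D.barD0 x Y' (x a) u) := by
  refine barSum_induction (P := fun u => D.barD0 x Y' Y (D.barPrepend x Y' a Y f u) =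
      D.barPrepend x Y' a Y ((D.Hom (x a) Y).d f) u +
        D.barPrepend x Y' a Y ((D.Hom (x a) Y).koszul S.ι f) (D.barD0 x Y' (x a) u))
    u (by simp) ?_ ?_
  · intro s t hs ht; simp only [map_add, hs, ht]; abel
  · intro p t
    rw [barPrepend_inc, barD0_inc, barD0_inc, barPrepend_inc, barPrepend_inc, d_barCons, map_add]

theorem barDelta_d (t : D.barTerm x Y' (a :: L) Y) :
    D.barDelta x Y' L a Y ((D.barTerm x Y' (a :: L) Y).d t) =
      D.barD0 x Y' Y (D.barDelta x Y' L a Y t) := by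
  induction L generalizing a Y with
  | nil => rw [barDelta_nil, barDelta_nil, map_zero]
  | cons b L ih =>
    refine barCons_induction (P := fun t =>
      D.barDelta x Y' (b :: L) a Y ((D.barTerm x Y' (a :: b :: L) Y).d t) =
      D.barD0 x Y' Y (D.barDelta x Y' (b :: L) a Y t)) t (by simp) ?_ ?_
    · intro s t hs ht; simp only [map_add, hs, ht]
    · intro f w
      rw [d_barCons, map_add, barDelta_cons, barDelta_cons, barDelta_cons, map_sub, map_sub,
        barD0_inc, barD0_pair, barD0_prepend, d_termL, map_add, ih, barEps_d]
      abel

theorem barSgn_prepend (j : Γ) (f : D.Hom (x a) Y) (u : D.barSum x Y' (x a)) :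
    D.barSgn x j Y' Y (D.barPrepend x Y' a Y f u) =
      ksign k (S.pairing S.ι j) • D.barPrepend x Y' a Y f (D.barSgn x j Y' (x a) u) := by
  refine barSum_induction (P := fun u => D.barSgn x j Y' Y (D.barPrepend x Y' a Y f u) =
      ksign k (S.pairing S.ι j) • D.barPrepend x Y' a Y f (D.barSgn x j Y' (x a) u))
    u (by simp) ?_ ?_
  · intro s t hs ht; simp only [map_add, hs, ht, smul_add]
  · rintro ⟨b, L⟩ t
    rw [barPrepend_inc, barSgn_inc, barSgn_inc, barShift_cons, map_smul, barPrepend_inc, smul_smul,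
      ← ksign_add, map_sub, AddMonoidHom.sub_apply, CharTwo.sub_eq_add, add_comm]

theorem barSgn_barDelta (j : Γ) (t : D.barTerm x Y' (a :: L) Y) :
    D.barSgn x j Y' Y (D.barDelta x Y' L a Y t) =
      (ksign k (S.pairing S.ι j) * ksign k (S.pairing (barShift (S := S) (a, L)) j)) •
        D.barDelta x Y' L a Y t := by
  induction L generalizing a Y with
  | nil => rw [barDelta_nil, map_zero, smul_zero]
  | cons b L ih =>
    refine barCons_induction (P := fun t =>
      D.barSgn x j Y' Y (D.barDelta x Y' (b :: L) a Y t) =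
      (ksign k (S.pairing S.ι j) * ksign k (S.pairing (barShift (S := S) (a, b :: L)) j)) •
        D.barDelta x Y' (b :: L) a Y t) t (by simp) ?_ ?_
    · intro s t hs ht; simp only [map_add, hs, ht, smul_add]
    · intro f w
      have e : ksign k (S.pairing S.ι j) * ksign k (S.pairing (barShift (S := S) (a, b :: L)) j) =
          ksign k (S.pairing (barShift (S := S) (b, L)) j) := by
        rw [← ksign_add, ← AddMonoidHom.add_apply, ← map_add, barShift_cons, add_sub_cancel]
      have e2 : D.barPair x Y' a Y f (D.barEps x Y' L b (x a) w) =
          ksign k (S.pairing (barShift (S := S) (b, L)) j) • D.barPair x Y' a Y f (D.barEps x Y' L b (x a) w) := by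
        cases L with
        | nil => simp only [barShift, List.length_nil, zero_smul, neg_zero, map_zero,
            AddMonoidHom.zero_apply, ksign_zero, one_smul]
        | cons c L => rw [barEps_cons, map_zero, smul_zero]
      rw [barDelta_cons, map_sub, map_sub, barSgn_inc, barSgn_pair, barSgn_prepend, ih, e,
        map_smul, smul_smul, ← mul_assoc, ksign_mul_self, one_mul, smul_sub, smul_sub, ← e2]

theorem barTwist_mc (u : D.barSum x Y' Y) :
    (D.barSum x Y' Y).d (D.barTwist x Y' Y u) + D.barTwist x Y' Y ((D.barSum x Y' Y).d u) +
      D.barTwist x Y' Y (D.barTwist x Y' Y u) = 0 := by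
  rw [barTwist_barTwist, add_zero]
  refine barSum_induction (P := fun u => (D.barSum x Y' Y).d (D.barTwist x Y' Y u) +
    D.barTwist x Y' Y ((D.barSum x Y' Y).d u) = 0) u (by simp) ?_ ?_
  · intro s t hs ht
    simp only [map_add]
    rw [add_add_add_comm, hs, ht, add_zero]
  · rintro ⟨a, L⟩ t
    rw [barSum_d_inc, map_smul, barTwist_inc, barTwist_inc, barSum_d, ← barDelta_d,
      barSgn_barDelta, S.pairing_ι, ksign_one, S.symm S.ι, neg_one_mul, neg_smul]
    exact neg_add_cancel _

theorem barPrepend_mem {i j : Γ} {f : D.Hom (x a) Y} {u : D.barSum x Y' (x a)}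
    (hf : f ∈ (D.Hom (x a) Y).gr i) (hu : u ∈ (D.barSum x Y' (x a)).gr j) :
    D.barPrepend x Y' a Y f u ∈ (D.barSum x Y' Y).gr (i + j - S.ι) := by
  refine barSum_gr_induction (P := fun u => D.barPrepend x Y' a Y f u ∈
    (D.barSum x Y' Y).gr (i + j - S.ι)) hu ?_ ?_ ?_
  · rw [map_zero]; exact Submodule.zero_mem _
  · intro s t hs ht; rw [map_add]; exact Submodule.add_mem _ hs ht
  · rintro ⟨b, L⟩ l rfl t ht
    have := barInc_mem (p := (a, b :: L)) (barCons_mem hf ht)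
    rw [barShift_cons] at this
    rw [barPrepend_inc, show i + (l + barShift (S := S) (b, L)) - S.ι =
      i + l + (barShift (S := S) (b, L) - S.ι) by abel]
    exact this

theorem barDelta_mem {l : Γ} {t : D.barTerm x Y' (a :: L) Y}
    (ht : t ∈ (D.barTerm x Y' (a :: L) Y).gr l) :
    D.barDelta x Y' L a Y t ∈
      (D.barSum x Y' Y).gr (l + barShift (S := S) (a, L) + S.ι) := by
  induction L generalizing a Y l with
  | nil => rw [barDelta_nil]; exact Submodule.zero_mem _
  | cons b L ih =>
    refine barCons_gr_induction (P := fun t => D.barDelta x Y' (b :: L) a Y t ∈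
      (D.barSum x Y' Y).gr (l + barShift (S := S) (a, b :: L) + S.ι)) ht ?_ ?_ ?_ ?_
    · rw [map_zero]; exact Submodule.zero_mem _
    · intro s t hs ht; rw [map_add]; exact Submodule.add_mem _ hs ht
    · intro c t ht; rw [map_smul]; exact Submodule.smul_mem _ _ ht
    · rintro i j rfl f hf w hw
      rw [barDelta_cons, barShift_cons]
      refine Submodule.sub_mem _ (Submodule.sub_mem _ ?_ ?_) ?_
      · have := barInc_mem (p := (b, L)) (termL_mem hf hw)
        rwa [show i + j + (barShift (S := S) (b, L) - S.ι) + S.ι =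
          i + j + barShift (S := S) (b, L) by abel]
      · cases L with
        | nil =>
          have := barPair_mem hf (barEps_mem hw)
          rwa [show i + j + (barShift (S := S) (b, ([] : List I)) - S.ι) + S.ι = i + j by
            simp [barShift]]
        | cons c L =>
          rw [barEps_cons, map_zero]
          exact Submodule.zero_mem _
      · have := barPrepend_mem hf (ih hw)
        rwa [show i + j + (barShift (S := S) (b, L) - S.ι) + S.ι =
          i + (j + barShift (S := S) (b, L) + S.ι) - S.ι by abel]

theorem barTwist_mem {l : Γ} {u : D.barSum x Y' Y} (hu : u ∈ (D.barSum x Y' Y).gr l) :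
    D.barTwist x Y' Y u ∈ (D.barSum x Y' Y).gr (l + S.ι) := by
  refine barSum_gr_induction (P := fun u => D.barTwist x Y' Y u ∈
    (D.barSum x Y' Y).gr (l + S.ι)) hu ?_ ?_ ?_
  · rw [map_zero]; exact Submodule.zero_mem _
  · intro s t hs ht; rw [map_add]; exact Submodule.add_mem _ hs ht
  · rintro p i rfl t ht
    rw [barTwist_inc]; exact barDelta_mem ht

theorem barL_one (u : D.barSum x Y' Y) : D.barL x Y' (D.one Y) u = u := by
  rw [barL_eq (D.one_mem Y)]
  refine barSum_induction (P := fun u => D.barL0 x Y' (D.one Y) (D.barSgn x 0 Y' Y u) = u)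
    u (by simp) ?_ ?_
  · intro s t hs ht; simp only [map_add, hs, ht]
  · intro p t
    rw [barSgn_inc, map_zero, ksign_zero, one_smul, barL0_inc, termL_one]

theorem barL_comp (g : D.Hom Z W) (g' : D.Hom Y Z) (u : D.barSum x Y' Y) :
    D.barL x Y' (D.comp g g') u = D.barL x Y' g (D.barL x Y' g' u) := by
  refine barSum_induction (P := fun u => D.barL x Y' (D.comp g g') u =
    D.barL x Y' g (D.barL x Y' g' u)) u (by simp) ?_ ?_
  · intro s t hs ht; simp only [map_add, hs, ht]
  · intro p t
    rw [barL_inc, barL_inc, barL_inc, D.koszul_comp, termL_comp]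

theorem barR_one (u : D.barSum x Y' Y) : D.barR x u (D.one Y') = u := by
  refine barSum_induction (P := fun u => D.barR x u (D.one Y') = u) u (by simp) ?_ ?_
  · intro s t hs ht; simp only [map_add, LinearMap.add_apply, hs, ht]
  · intro p t; rw [barR_inc, termR_one]

theorem barR_comp (u : D.barSum x Y' Y) (g : D.Hom Y'' Y') (g' : D.Hom Y''' Y'') :
    D.barR x u (D.comp g g') = D.barR x (D.barR x u g) g' := by
  refine barSum_induction (P := fun u => D.barR x u (D.comp g g') =
    D.barR x (D.barR x u g) g') u (by simp) ?_ ?_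
  · intro s t hs ht; simp only [map_add, LinearMap.add_apply, hs, ht]
  · intro p t; rw [barR_inc, barR_inc, barR_inc, termR_comp]

theorem barL_barR (g : D.Hom Y Z) (u : D.barSum x Y' Y) (h : D.Hom Y'' Y') :
    D.barR x (D.barL x Y' g u) h = D.barL x Y'' g (D.barR x u h) := by
  refine barSum_induction (P := fun u => D.barR x (D.barL x Y' g u) h =
    D.barL x Y'' g (D.barR x u h)) u (by simp) ?_ ?_
  · intro s t hs ht; simp only [map_add, LinearMap.add_apply, hs, ht]
  · intro p t; rw [barR_inc, barL_inc, barL_inc, barR_inc, termL_termR]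

theorem barL_mem {i j : Γ} {g : D.Hom Y Z} {u : D.barSum x Y' Y} (hg : g ∈ (D.Hom Y Z).gr i)
    (hu : u ∈ (D.barSum x Y' Y).gr j) : D.barL x Y' g u ∈ (D.barSum x Y' Z).gr (i + j) := by
  refine barSum_gr_induction (P := fun u => D.barL x Y' g u ∈ (D.barSum x Y' Z).gr (i + j))
    hu ?_ ?_ ?_
  · rw [map_zero]; exact Submodule.zero_mem _
  · intro s t hs ht; rw [map_add]; exact Submodule.add_mem _ hs ht
  · rintro p i rfl t ht
    rw [barL_inc, ← add_assoc]
    exact barInc_mem (termL_mem ((D.Hom Y Z).koszul_mem _ hg) ht)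

theorem barR_mem {i j : Γ} {u : D.barSum x Y' Y} {g : D.Hom Y'' Y'}
    (hu : u ∈ (D.barSum x Y' Y).gr i) (hg : g ∈ (D.Hom Y'' Y').gr j) :
    D.barR x u g ∈ (D.barSum x Y'' Y).gr (i + j) := by
  refine barSum_gr_induction (P := fun u => D.barR x u g ∈ (D.barSum x Y'' Y).gr (i + j))
    hu ?_ ?_ ?_
  · rw [map_zero]; exact Submodule.zero_mem _
  · intro s t hs ht; rw [map_add]; exact Submodule.add_mem _ hs ht
  · rintro p i rfl t ht
    rw [barR_inc, add_right_comm]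
    exact barInc_mem (termR_mem ht hg)

theorem bar_d_lact {i : Γ} {g : D.Hom Y Z} (u : D.barSum x Y' Y) (hg : g ∈ (D.Hom Y Z).gr i) :
    ((D.barSum x Y' Z).d + D.barTwist x Y' Z) (D.barL x Y' g u) =
      D.barL x Y' ((D.Hom Y Z).d g) u + ksign k (S.pairing S.ι i) •
        D.barL x Y' g (((D.barSum x Y' Y).d + D.barTwist x Y' Y) u) := by
  refine barSum_induction (P := fun u =>
    ((D.barSum x Y' Z).d + D.barTwist x Y' Z) (D.barL x Y' g u) =
      D.barL x Y' ((D.Hom Y Z).d g) u + ksign k (S.pairing S.ι i) •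
        D.barL x Y' g (((D.barSum x Y' Y).d + D.barTwist x Y' Y) u)) u (by simp) ?_ ?_
  · intro s t hs ht
    rw [map_add, map_add, map_add, map_add, map_add, hs, ht, smul_add]; abel
  · intro p t
    have h1 : ksign k (S.pairing S.ι i) * ksign k (S.pairing S.ι i) = 1 := ksign_mul_self _ _
    have h2 : D.barSgn x i Y' Y (D.barDelta x Y' p.2 p.1 Y t) =
        (ksign k (S.pairing S.ι i) * ksign k (S.pairing (barShift (S := S) p) i)) •
          D.barDelta x Y' p.2 p.1 Y t := barSgn_barDelta i t
    rw [LinearMap.add_apply, LinearMap.add_apply, map_add (D.barL x Y' g), barL_inc, barSum_d_inc,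
      barTwist_inc, barSum_d_inc, barTwist_inc, barL_inc, barL_eq hg, barL_eq hg, h2, map_smul,
      barSgn_inc, map_smul, map_smul, map_smul, barL0_inc, ← barDelta_termL,
      DGMod.koszul_of_mem _ _ hg, DGMod.koszul_of_mem _ _ ((D.Hom Y Z).d_mem hg),
      map_smul, map_smul, LinearMap.smul_apply, LinearMap.smul_apply, map_smul, map_smul, map_smul,
      map_smul, d_termL, DGMod.koszul_of_mem _ _ hg, map_smul, LinearMap.smul_apply, map_add,
      map_smul, map_add, ksign_add, S.symm S.ι (barShift p)]
    simp only [smul_add, smul_smul]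
    rw [← add_assoc]
    refine congrArg₂ (· + ·) (congrArg₂ (· + ·) ?_ ?_) ?_
    · rw [mul_comm]
    · congr 1; ring
    · rw [← mul_assoc, h1, one_mul]

theorem bar_d_ract {i : Γ} {u : D.barSum x Y' Y} (g : D.Hom Y'' Y')
    (hu : u ∈ (D.barSum x Y' Y).gr i) :
    ((D.barSum x Y'' Y).d + D.barTwist x Y'' Y) (D.barR x u g) =
      D.barR x (((D.barSum x Y' Y).d + D.barTwist x Y' Y) u) g +
        ksign k (S.pairing S.ι i) • D.barR x u ((D.Hom Y'' Y').d g) := by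
  have hpre : ∀ {a : I} {Y : D.Obj} (f : D.Hom (x a) Y) (u : D.barSum x Y' (x a)),
      D.barR x (D.barPrepend x Y' a Y f u) g = D.barPrepend x Y'' a Y f (D.barR x u g) := by
    intro a Y f u
    refine barSum_induction (P := fun u => D.barR x (D.barPrepend x Y' a Y f u) g =
      D.barPrepend x Y'' a Y f (D.barR x u g)) u (by simp) ?_ ?_
    · intro s t hs ht; simp only [map_add, LinearMap.add_apply, hs, ht]
    · intro p t; rw [barPrepend_inc, barR_inc, barR_inc, barPrepend_inc, termR_cons]
  have hdel : ∀ (L : List I) (a : I) (Y : D.Obj) (t : D.barTerm x Y' (a :: L) Y),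
      D.barDelta x Y'' L a Y (D.termR x (a :: L) t g) =
        D.barR x (D.barDelta x Y' L a Y t) g := by
    intro L
    induction L with
    | nil => intro a Y t; rw [barDelta_nil, barDelta_nil, map_zero, LinearMap.zero_apply]
    | cons b L ih =>
      intro a Y t
      refine barCons_induction (P := fun t =>
        D.barDelta x Y'' (b :: L) a Y (D.termR x (a :: b :: L) t g) =
        D.barR x (D.barDelta x Y' (b :: L) a Y t) g) t (by simp) ?_ ?_
      · intro s t hs ht; simp only [map_add, LinearMap.add_apply, hs, ht]
      · intro f w
        rw [termR_cons, barDelta_cons, barDelta_cons, ih, map_sub, map_sub, LinearMap.sub_apply,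
          LinearMap.sub_apply, barR_inc, barR_pair, termL_termR, hpre, barEps_termR]
  refine barSum_gr_induction (P := fun u =>
    ((D.barSum x Y'' Y).d + D.barTwist x Y'' Y) (D.barR x u g) =
      D.barR x (((D.barSum x Y' Y).d + D.barTwist x Y' Y) u) g +
        ksign k (S.pairing S.ι i) • D.barR x u ((D.Hom Y'' Y').d g)) hu (by simp) ?_ ?_
  · intro s t hs ht
    rw [map_add (D.barR x), LinearMap.add_apply (D.barR x s), LinearMap.add_apply (D.barR x s),
      map_add ((D.barSum x Y'' Y).d + D.barTwist x Y'' Y), hs, ht,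
      map_add ((D.barSum x Y' Y).d + D.barTwist x Y' Y), map_add (D.barR x),
      LinearMap.add_apply (D.barR x _), smul_add]
    abel
  · rintro p l rfl t ht
    rw [LinearMap.add_apply, LinearMap.add_apply, map_add (D.barR x), barR_inc, barSum_d_inc,
      barTwist_inc, barSum_d_inc, barTwist_inc, hdel, d_termR, DGMod.koszul_of_mem _ _ ht,
      LinearMap.add_apply, map_smul, map_smul, LinearMap.smul_apply, LinearMap.smul_apply,
      barR_inc, barR_inc, map_add, map_smul, map_add, ksign_add, smul_add, smul_smul,
      add_right_comm, mul_comm (ksign k (S.pairing S.ι l))]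

end Lemmas

/-- The two-sided bar complex of `D` built from the family of objects `x`,
`tw_δ (⨁_{r ≥ 0} q^(-rι) ⨁_{X_0, …, X_r} |X_0⟩ ⊗ ⟨X_0|X_1⟩ ⊗ ⋯ ⊗ ⟨X_{r-1}|X_r⟩ ⊗ ⟨X_r|)`, where the
`X_i` run over the objects `x a`, and `δ` is the bar differential. -/
def barFamily : DGBimod.{v, w} D D where
  obj Y Y' := (D.barSum x Y' Y).twist (D.barTwist x Y' Y) barTwist_mem barTwist_mc
  lact {_ _ Y'} := D.barL x Y'
  ract := D.barR x
  one_lact := barL_one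
  comp_lact := barL_comp
  ract_one := barR_one
  ract_comp := barR_comp
  lact_ract := barL_barR
  lact_mem := barL_mem
  ract_mem := barR_mem
  d_lact := bar_d_lact
  d_ract := bar_d_ract

/-- The two-sided bar complex of `D`. -/
def bar : DGBimod D D := D.barFamily fun X : D.Obj => X

/-- The two-sided bar complex of `D` relative to a set of objects `𝒳`. -/
def relBar (𝒳 : Set D.Obj) : DGBimod D D := D.barFamily fun X : 𝒳 => X.1

end Bar

end DGCat

end

/-!
Write `Bar` for the bar complex of `D` built from a family of objects `x`, `ε : Bar → D` for its
counit, and `Aug` for the cone of `ε` (`augBar`), again a bimodule. The proof compares two bar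
complexes through the universal property that each of them has as a resolution of the diagonal
bimodule `D`.

* As a bimodule without differential, `Bar` is free on the elements `[1, f_1, …, f_r, 1]`. Hence a
  closed bimodule morphism from `Bar` to a bimodule `N` is exact as soon as all right modules
  `⟨x a|N` are contractible: a primitive is constructed by recursion on `r` (`exists_diff_eq`).
* For `N = Aug` of a second family `y` this says that bimodule maps to `Bar` of `y` are, up to
  homotopy, the same as bimodule maps to `D`. The two counits then lift to maps between the two bar
  complexes, and these are mutually inverse up to homotopy, because they are so after composition
  with the counits (`htpyEquiv_barFamily`). The only requirement is that `⟨Y|Aug` is contractible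
  for every object `Y` of `D`, for both families.
* Prepending an identity contracts `⟨y b|Aug` (`rightContractible_augBar`). The contractible objects
  of a bimodule are closed under finite one-sided twisted complexes and homotopy retracts
  (`RightContractible.of_twisted`): on `tw_α(⨁ q^(i_a) X_a)` the sum `σ` of the contractions of the
  `X_a` satisfies `d σ + σ d = 1 + ν`, where `ν` is nilpotent since `α` is strictly triangular, and
  `σ (1 + ν)⁻¹` is a contraction. So `⟨Y|Aug` is contractible for all `Y` if `y` generates `D`.

In each envelope of `C`, every object is a finite one-sided twisted complex of objects of `C`
within the envelope itself, and the closure property applies to it directly.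
-/

noncomputable section

/-! ### Contractible right modules -/

/-- The geometric series inverts `1 + ν` for nilpotent `ν`, which turns a contraction up to `ν`
into a contraction. -/
theorem contraction_mul_geom_sum {R : Type*} [Ring R] {d σ ν : R} (hd : d * d = 0)
    (h : d * σ + σ * d = 1 + ν) {n : ℕ} (hn : (-ν) ^ n = 0) :
    d * (σ * ∑ i ∈ Finset.range n, (-ν) ^ i) + (σ * ∑ i ∈ Finset.range n, (-ν) ^ i) * d = 1 := by
  have hν : ν = d * σ + σ * d - 1 := by rw [h]; abel
  have hc : Commute d (-ν) := by
    refine Commute.neg_right ?_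
    rw [commute_iff_eq, hν]
    simp only [mul_sub, sub_mul, mul_add, add_mul, mul_one, one_mul, ← mul_assoc, hd, zero_mul]
    simp only [mul_assoc, hd, mul_zero]
    abel
  have hG : Commute d (∑ i ∈ Finset.range n, (-ν) ^ i) :=
    Commute.sum_right _ _ _ fun i _ => hc.pow_right i
  rw [mul_assoc, ← hG.eq, ← mul_assoc, ← mul_assoc, ← add_mul, h]
  have := mul_neg_geom_sum (-ν) n
  rwa [sub_neg_eq_add, hn, sub_zero] at this

theorem ksign_neg (k : Type*) [CommRing k] (a : ZMod 2) : ksign k (-a) = ksign k a := by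
  rw [CharTwo.neg_eq]

namespace DGBimod

variable {k : Type u} [CommRing k] {Γ : Type t} [AddCommGroup Γ] {S : GradingDatum Γ}
  {C D : DGCat.{v, w} k S}

/-- The right module `⟨X|M` is contractible: its identity is the boundary of a right linear map of
degree `-ι`. -/
def RightContractible (M : DGBimod C D) (X : C.Obj) : Prop :=
  ∃ s : ∀ Y, M.obj X Y →ₗ[k] M.obj X Y,
    (∀ {Y i m}, m ∈ (M.obj X Y).gr i → s Y m ∈ (M.obj X Y).gr (i - S.ι)) ∧
    (∀ {Y Y'} (m : M.obj X Y) (g : D.Hom Y' Y), s Y' (M.ract m g) = M.ract (s Y m) g) ∧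
    ∀ Y m, (M.obj X Y).d (s Y m) + s Y ((M.obj X Y).d m) = m

/-- A homotopy retract of a one-sided twisted complex `tw_α(⨁ q^(i_a) X_a)` of contractible objects
is contractible. The closed morphisms `f` and `g` to and from the twisted complex and the
Maurer-Cartan element `α` are given by their entries. -/
theorem RightContractible.of_twisted (M : DGBimod C D) {A : Type*} [Fintype A] (r : PartialOrder A)
    {X : A → C.Obj} (hX : ∀ a, M.RightContractible (X a)) {Y : C.Obj} (i : A → Γ)
    (f : ∀ a, C.Hom Y (X a)) (g : ∀ a, C.Hom (X a) Y) (α : ∀ a b, C.Hom (X b) (X a))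
    (h : C.Hom Y Y)
    (f_mem : ∀ a, f a ∈ (C.Hom Y (X a)).gr (-i a))
    (g_mem : ∀ a, g a ∈ (C.Hom (X a) Y).gr (i a))
    (α_mem : ∀ a b, α a b ∈ (C.Hom (X b) (X a)).gr (S.ι - i a + i b))
    (h_mem : h ∈ (C.Hom Y Y).gr (-S.ι))
    (d_f : ∀ a, ksign k (S.pairing S.ι (i a)) • (C.Hom Y (X a)).d (f a) +
      ∑ b, C.comp (α a b) (f b) = 0)
    (d_g : ∀ b, (C.Hom (X b) Y).d (g b) = ∑ a, C.comp (g a) (α a b))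
    (mc : ∀ a b, ksign k (S.pairing S.ι (i a)) • (C.Hom (X b) (X a)).d (α a b) +
      ∑ c, C.comp (α a c) (α c b) = 0)
    (one_sided : ∀ a b, ¬ r.lt b a → α a b = 0)
    (d_h : (C.Hom Y Y).d h = ∑ a, C.comp (g a) (f a) - C.one Y) :
    M.RightContractible Y := by
  classical
  choose s s_mem s_ract s_d using hX
  let κ : A → k := fun a => ksign k (S.pairing S.ι (i a))
  have κκ : ∀ a, κ a * κ a = 1 := fun a => ksign_mul_self _ _
  -- The family over `Z` of the modules `∏ a, M.obj (X a) Z` is the right module of the twisted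
  -- complex, with differential `dV + αV`; `σ` contracts it with respect to `dV`, and `F`, `G` are
  -- the chain maps induced by `f` and `g`.
  let dV : ∀ Z, Module.End k (∀ a, M.obj (X a) Z) := fun Z =>
    LinearMap.pi fun a => κ a • (M.obj (X a) Z).d ∘ₗ LinearMap.proj a
  let αV : ∀ Z, Module.End k (∀ a, M.obj (X a) Z) := fun Z =>
    LinearMap.pi fun a => ∑ b, M.lact (α a b) ∘ₗ LinearMap.proj b
  let σ : ∀ Z, Module.End k (∀ a, M.obj (X a) Z) := fun Z =>
    LinearMap.pi fun a => κ a • s a Z ∘ₗ LinearMap.proj a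
  let F : ∀ Z, M.obj Y Z →ₗ[k] ∀ a, M.obj (X a) Z := fun Z => LinearMap.pi fun a => M.lact (f a)
  let G : ∀ Z, (∀ a, M.obj (X a) Z) →ₗ[k] M.obj Y Z := fun Z =>
    ∑ a, M.lact (g a) ∘ₗ LinearMap.proj a
  let ρ : ∀ {Z Z'}, D.Hom Z' Z → (∀ a, M.obj (X a) Z) → ∀ a, M.obj (X a) Z' :=
    fun q m a => M.ract (m a) q
  have dV_apply : ∀ Z (m : ∀ a, M.obj (X a) Z) a, dV Z m a =
      κ a • (M.obj (X a) Z).d (m a) := fun _ _ _ => rfl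
  have σ_apply : ∀ Z (m : ∀ a, M.obj (X a) Z) a, σ Z m a = κ a • s a Z (m a) := fun _ _ _ => rfl
  have αV_apply : ∀ Z (m : ∀ a, M.obj (X a) Z) a, αV Z m a = ∑ b, M.lact (α a b) (m b) :=
    fun Z m a => by simp [αV]
  have F_apply : ∀ Z m a, F Z m a = M.lact (f a) m := fun _ _ _ => rfl
  have G_apply : ∀ Z m, G Z m = ∑ a, M.lact (g a) (m a) := fun Z m => by simp [G]
  -- The twisted differential squares to zero by the Maurer-Cartan equation.
  have hd : ∀ Z, (dV Z + αV Z) * (dV Z + αV Z) = 0 := by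
    intro Z
    refine LinearMap.ext fun m => ?_
    funext a
    have e1 : ∀ b, (M.obj (X a) Z).d (M.lact (α a b) (m b)) =
        M.lact ((C.Hom (X b) (X a)).d (α a b)) (m b) -
          (κ a * κ b) • M.lact (α a b) ((M.obj (X b) Z).d (m b)) := by
      intro b
      have : ksign k (S.pairing S.ι (S.ι - i a + i b)) = -(κ a * κ b) := by
        rw [map_add, map_sub, S.pairing_ι, CharTwo.sub_eq_add, ksign_add, ksign_add, ksign_one]
        ring
      rw [M.d_lact _ (α_mem a b), this, neg_smul, sub_eq_add_neg]
    have e2 := congrArg (fun z : ∀ b, C.Hom (X b) (X a) => ∑ b, M.lact (z b) (m b))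
      (funext fun b => mc a b)
    simp only [map_add, map_smul, LinearMap.add_apply, LinearMap.smul_apply, map_sum,
      LinearMap.sum_apply, M.comp_lact, map_zero, LinearMap.zero_apply, Finset.sum_const_zero,
      Finset.sum_add_distrib] at e2
    rw [Finset.sum_comm] at e2
    simp only [Module.End.mul_apply, LinearMap.add_apply, Pi.add_apply, dV_apply, αV_apply,
      map_add, map_smul, map_sum, e1, (M.obj _ _).d_d, smul_zero, zero_add, smul_sub, smul_smul,
      ← mul_assoc, κκ, one_mul, Finset.sum_sub_distrib, Finset.smul_sum,
      LinearMap.zero_apply, Pi.zero_apply]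
    rw [← e2]
    simp only [κ]
    abel
  have hσ : ∀ Z, (dV Z + αV Z) * σ Z + σ Z * (dV Z + αV Z) =
      1 + (αV Z * σ Z + σ Z * αV Z) := by
    intro Z
    have : dV Z * σ Z + σ Z * dV Z = 1 := by
      refine LinearMap.ext fun m => ?_
      funext a
      simp only [Module.End.mul_apply, LinearMap.add_apply, Pi.add_apply, dV_apply, σ_apply,
        map_smul, smul_smul, κκ, one_smul, s_d, Module.End.one_apply]
    rw [← this]
    noncomm_ring
  let ν : ∀ Z, Module.End k (∀ a, M.obj (X a) Z) := fun Z => αV Z * σ Z + σ Z * αV Z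
  let τ : ∀ Z, Module.End k (∀ a, M.obj (X a) Z) := fun Z =>
    σ Z * ∑ j ∈ Finset.range (Fintype.card A + 1), (-ν Z) ^ j
  -- The entry of `ν m` at `a` depends only on the entries of `m` at the elements below `a`.
  have hν : ∀ Z, (-ν Z) ^ (Fintype.card A + 1) = 0 := by
    intro Z
    have key : ∀ n (m : ∀ a, M.obj (X a) Z) a, (Finset.univ.filter fun b => r.lt b a).card < n →
        ((-ν Z) ^ n) m a = 0 := by
      intro n
      induction n with
      | zero => intro m a ha; exact absurd ha (Nat.not_lt_zero _)
      | succ n ih =>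
        intro m a ha
        have h0 : ∀ b, r.lt b a → ((-ν Z) ^ n) m b = 0 := by
          intro b hb
          refine ih m b (lt_of_lt_of_le (Finset.card_lt_card ?_) (Nat.lt_succ_iff.1 ha))
          refine Finset.ssubset_iff_of_subset (fun c hc => ?_) |>.2 ⟨b, ?_, ?_⟩
          · simp only [Finset.mem_filter, Finset.mem_univ, true_and] at hc ⊢
            exact lt_trans hc hb
          · simpa using hb
          · simp
        have h1 : ∀ m' : (∀ a, M.obj (X a) Z), (∀ b, r.lt b a → m' b = 0) → αV Z m' a = 0 := by
          intro m' hm'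
          rw [αV_apply]
          refine Finset.sum_eq_zero fun b _ => ?_
          by_cases hb : r.lt b a
          · rw [hm' b hb, map_zero]
          · rw [one_sided a b hb, map_zero, LinearMap.zero_apply]
        rw [pow_succ']
        simp only [Module.End.mul_apply, LinearMap.neg_apply, Pi.neg_apply, ν, LinearMap.add_apply,
          Pi.add_apply]
        rw [h1 _ fun b hb => by rw [σ_apply, h0 b hb, map_zero, smul_zero], σ_apply, h1 _ h0,
          map_zero, smul_zero, add_zero, neg_zero]
    refine LinearMap.ext fun m => ?_
    funext a
    exact key _ m a (Nat.lt_succ_iff.2 (Finset.card_le_univ _))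
  have hτ : ∀ Z, (dV Z + αV Z) * τ Z + τ Z * (dV Z + αV Z) = 1 := fun Z =>
    contraction_mul_geom_sum (hd Z) (hσ Z) (hν Z)
  have F_d : ∀ Z m, (dV Z + αV Z) (F Z m) = F Z ((M.obj Y Z).d m) := by
    intro Z m
    funext a
    have e := congrArg (fun z => M.lact z m) (d_f a)
    simp only [map_add, map_smul, LinearMap.add_apply, LinearMap.smul_apply, map_sum,
      LinearMap.sum_apply, M.comp_lact, map_zero, LinearMap.zero_apply] at e
    simp only [LinearMap.add_apply, Pi.add_apply, dV_apply, αV_apply, F_apply, M.d_lact m (f_mem a),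
      smul_add, smul_smul, map_neg, ksign_neg]
    simp only [κ, ksign_mul_self, one_smul]
    rw [add_right_comm, e, zero_add]
  have G_d : ∀ Z m, (M.obj Y Z).d (G Z m) = G Z ((dV Z + αV Z) m) := by
    intro Z m
    simp only [G_apply, map_sum, M.d_lact _ (g_mem _), d_g, LinearMap.sum_apply, M.comp_lact,
      LinearMap.add_apply, Pi.add_apply, dV_apply, αV_apply, map_add, map_smul,
      Finset.sum_add_distrib]
    rw [Finset.sum_comm, add_comm]
  have GF : ∀ Z m, G Z (F Z m) = m + M.lact ((C.Hom Y Y).d h) m := by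
    intro Z m
    rw [d_h]
    simp only [G_apply, F_apply, map_sub, map_sum, LinearMap.sub_apply, LinearMap.sum_apply,
      M.comp_lact, M.one_lact]
    abel
  -- All operators commute with the right action `ρ`.
  have ρ_add : ∀ {Z Z'} (q : D.Hom Z' Z) (m n : ∀ a, M.obj (X a) Z),
      ρ q (m + n) = ρ q m + ρ q n := by
    intro Z Z' q m n; funext a
    simp only [ρ, Pi.add_apply, map_add, LinearMap.add_apply]
  have ρ_neg : ∀ {Z Z'} (q : D.Hom Z' Z) (m : ∀ a, M.obj (X a) Z), ρ q (-m) = -ρ q m := by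
    intro Z Z' q m; funext a
    simp only [ρ, Pi.neg_apply, map_neg, LinearMap.neg_apply]
  have ρσ : ∀ {Z Z'} (q : D.Hom Z' Z) (m : ∀ a, M.obj (X a) Z), σ Z' (ρ q m) = ρ q (σ Z m) := by
    intro Z Z' q m; funext a
    simp only [ρ, σ_apply, s_ract, map_smul, LinearMap.smul_apply]
  have ρα : ∀ {Z Z'} (q : D.Hom Z' Z) (m : ∀ a, M.obj (X a) Z), αV Z' (ρ q m) = ρ q (αV Z m) := by
    intro Z Z' q m; funext a
    simp only [ρ, αV_apply, map_sum, LinearMap.sum_apply, M.lact_ract]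
  have ρν : ∀ {Z Z'} (q : D.Hom Z' Z) (n : ℕ) (m : ∀ a, M.obj (X a) Z),
      ((-ν Z') ^ n) (ρ q m) = ρ q (((-ν Z) ^ n) m) := by
    intro Z Z' q n
    induction n with
    | zero => intro m; rfl
    | succ n ih =>
      intro m
      simp only [pow_succ', Module.End.mul_apply, ih, ν, LinearMap.neg_apply, LinearMap.add_apply,
        ρσ, ρα, ρ_add, ρ_neg]
  have ρ_sum : ∀ {Z Z'} (q : D.Hom Z' Z) (T : Finset ℕ) (m : ℕ → ∀ a, M.obj (X a) Z),
      ρ q (∑ j ∈ T, m j) = ∑ j ∈ T, ρ q (m j) := by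
    intro Z Z' q T m; funext a
    simp only [ρ, Finset.sum_apply, map_sum, LinearMap.sum_apply]
  have ρτ : ∀ {Z Z'} (q : D.Hom Z' Z) (m : ∀ a, M.obj (X a) Z), τ Z' (ρ q m) = ρ q (τ Z m) := by
    intro Z Z' q m
    simp only [τ, Module.End.mul_apply, LinearMap.sum_apply, ρν, ← ρ_sum, ρσ]
  -- Degrees in `∏ a, M.obj (X a) Z` take the shifts `i a` into account.
  let gr : ∀ Z, Γ → Submodule k (∀ a, M.obj (X a) Z) := fun Z l =>
    Submodule.pi Set.univ fun a => (M.obj (X a) Z).gr (l - i a)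
  have σ_mem : ∀ {Z l} {m : ∀ a, M.obj (X a) Z}, m ∈ gr Z l → σ Z m ∈ gr Z (l - S.ι) := by
    intro Z l m hm a _
    have := Submodule.smul_mem _ (κ a) (s_mem a (hm a trivial))
    rw [sub_right_comm] at this
    exact this
  have αV_mem : ∀ {Z l} {m : ∀ a, M.obj (X a) Z}, m ∈ gr Z l → αV Z m ∈ gr Z (l + S.ι) := by
    intro Z l m hm a _
    rw [αV_apply]
    refine Submodule.sum_mem _ fun b _ => ?_
    have := M.lact_mem (α_mem a b) (hm b trivial)
    rwa [show S.ι - i a + i b + (l - i b) = l + S.ι - i a by abel] at this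
  have ν_mem : ∀ {Z l} {m : ∀ a, M.obj (X a) Z}, m ∈ gr Z l →
      ∀ n : ℕ, ((-ν Z) ^ n) m ∈ gr Z l := by
    intro Z l m hm n
    induction n with
    | zero => exact hm
    | succ n ih =>
      rw [pow_succ', Module.End.mul_apply, LinearMap.neg_apply]
      refine Submodule.neg_mem _ (Submodule.add_mem _ ?_ ?_)
      · have := αV_mem (σ_mem ih)
        rwa [sub_add_cancel] at this
      · have := σ_mem (αV_mem ih)
        rwa [add_sub_cancel_right] at this
  -- `G τ F` is a primitive of `G F = 1 + d h`.
  refine ⟨fun Z => G Z ∘ₗ τ Z ∘ₗ F Z - M.lact h, ?_, ?_, ?_⟩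
  · intro Z l m hm
    refine Submodule.sub_mem _ ?_ ?_
    · have hF : F Z m ∈ gr Z l := fun a _ => by
        have := M.lact_mem (f_mem a) hm
        rwa [neg_add_eq_sub] at this
      have hT : τ Z (F Z m) ∈ gr Z (l - S.ι) := by
        refine σ_mem ?_
        rw [LinearMap.sum_apply]
        exact Submodule.sum_mem _ fun j _ => ν_mem hF j
      rw [LinearMap.comp_apply, LinearMap.comp_apply, G_apply]
      refine Submodule.sum_mem _ fun a _ => ?_
      have := M.lact_mem (g_mem a) (hT a trivial)
      rwa [add_sub_cancel] at this
    · have := M.lact_mem h_mem hm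
      rwa [neg_add_eq_sub] at this
  · intro Z Z' m q
    have e1 : F Z' (M.ract m q) = ρ q (F Z m) := by
      funext a
      simp only [F_apply, ρ, M.lact_ract]
    have e2 : ∀ n : (∀ a, M.obj (X a) Z), G Z' (ρ q n) = M.ract (G Z n) q := by
      intro n
      simp only [G_apply, ρ, map_sum, LinearMap.sum_apply, M.lact_ract]
    simp only [LinearMap.sub_apply, LinearMap.comp_apply, e1, ρτ, e2, map_sub, M.lact_ract]
  · intro Z m
    have e : (dV Z + αV Z) (τ Z (F Z m)) + τ Z ((dV Z + αV Z) (F Z m)) = F Z m :=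
      LinearMap.congr_fun (hτ Z) (F Z m)
    rw [F_d] at e
    have e' := congrArg (G Z) e
    rw [map_add, ← G_d, GF] at e'
    simp only [LinearMap.sub_apply, LinearMap.comp_apply, map_sub, M.d_lact m h_mem, map_neg,
      ksign_neg, S.pairing_ι, ksign_one, neg_smul, one_smul]
    refine Eq.trans ?_ (sub_eq_iff_eq_add.2 e')
    abel

end DGBimod

namespace DGCat

variable {k : Type u} [CommRing k] {Γ : Type t} [AddCommGroup Γ] {S : GradingDatum Γ}

/-! ### The augmented bar complex -/

section AugBar

variable (D : DGCat.{v, w} k S) {J : Type w} (y : J → D.Obj)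

/-- The total differential of the bar complex. -/
def barD (Y' Y : D.Obj) : D.barSum y Y' Y →ₗ[k] D.barSum y Y' Y :=
  (D.barSum y Y' Y).d + D.barTwist y Y' Y

variable {D y}
variable {Y Y' Y'' Z : D.Obj} {b : J}

theorem barD_barD (u : D.barSum y Y' Y) : D.barD y Y' Y (D.barD y Y' Y u) = 0 :=
  ((D.barFamily y).obj Y Y').d_d u

theorem barD_mem {l : Γ} {u : D.barSum y Y' Y} (hu : u ∈ (D.barSum y Y' Y).gr l) :
    D.barD y Y' Y u ∈ (D.barSum y Y' Y).gr (l + S.ι) :=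
  ((D.barFamily y).obj Y Y').d_mem hu

theorem barD_barL {i : Γ} {g : D.Hom Y Z} (u : D.barSum y Y' Y) (hg : g ∈ (D.Hom Y Z).gr i) :
    D.barD y Y' Z (D.barL y Y' g u) = D.barL y Y' ((D.Hom Y Z).d g) u +
      ksign k (S.pairing S.ι i) • D.barL y Y' g (D.barD y Y' Y u) :=
  bar_d_lact u hg

theorem barD_barR {i : Γ} {u : D.barSum y Y' Y} (g : D.Hom Y'' Y')
    (hu : u ∈ (D.barSum y Y' Y).gr i) :
    D.barD y Y'' Y (D.barR y u g) = D.barR y (D.barD y Y' Y u) g +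
      ksign k (S.pairing S.ι i) • D.barR y u ((D.Hom Y'' Y').d g) :=
  bar_d_ract g hu

/-- Prepending an identity is a null-homotopy of the identity of the bar complex, up to the term
that involves the counit. -/
theorem barD_prepend_one (u : D.barSum y Y' (y b)) :
    D.barD y Y' (y b) (D.barPrepend y Y' b (y b) (D.one (y b)) u) =
      u - D.barPair y Y' b (y b) (D.one (y b)) (D.barCounit y Y' (y b) u) -
        D.barPrepend y Y' b (y b) (D.one (y b)) (D.barD y Y' (y b) u) := by
  have h0 : D.barL0 y Y' (D.one (y b)) u = u := by
    have := barL_eq (D.one_mem (y b)) (D.barSgn y 0 Y' (y b) u)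
    have h2 : ∀ v : D.barSum y Y' (y b), D.barSgn y 0 Y' (y b) v = v := fun v => by
      refine barSum_induction (P := fun v => D.barSgn y 0 Y' (y b) v = v) v (by simp) ?_ ?_
      · intro s t hs ht; simp only [map_add, hs, ht]
      · intro p t
        rw [barSgn_inc, map_zero, ksign_zero, one_smul]
    rw [h2, h2, barL_one] at this
    exact this.symm
  have h1 : (D.Hom (y b) (y b)).koszul S.ι (D.one (y b)) = D.one (y b) := by
    rw [DGMod.koszul_of_mem _ _ (D.one_mem _), map_zero, ksign_zero, one_smul]
  rw [barD, LinearMap.add_apply, barTwist_prepend, barSum_d, barD0_prepend, h0, h1, D.d_one,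
    map_zero, LinearMap.zero_apply, zero_add, barSgn_prepend, S.pairing_ι, ksign_one, ← barSum_d,
    LinearMap.add_apply, map_add]
  simp only [neg_smul, one_smul]
  abel

theorem barD_pair_one (g : D.Hom Y' (y b)) :
    D.barD y Y' (y b) (D.barPair y Y' b (y b) (D.one (y b)) g) =
      D.barPair y Y' b (y b) (D.one (y b)) ((D.Hom Y' (y b)).d g) := by
  have h1 : (D.Hom (y b) (y b)).koszul S.ι (D.one (y b)) = D.one (y b) := by
    rw [DGMod.koszul_of_mem _ _ (D.one_mem _), map_zero, ksign_zero, one_smul]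
  rw [barD, LinearMap.add_apply, barTwist_pair, add_zero, barSum_d, barD0_pair, h1, D.d_one,
    map_zero, LinearMap.zero_apply, zero_add, barSgn_pair]

theorem barR_prepend (f : D.Hom (y b) Y) (u : D.barSum y Y' (y b)) (g : D.Hom Y'' Y') :
    D.barR y (D.barPrepend y Y' b Y f u) g = D.barPrepend y Y'' b Y f (D.barR y u g) := by
  refine barSum_induction (P := fun u => D.barR y (D.barPrepend y Y' b Y f u) g =
    D.barPrepend y Y'' b Y f (D.barR y u g)) u (by simp) ?_ ?_
  · intro s t hs ht; simp only [map_add, LinearMap.add_apply, hs, ht]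
  · intro p t; rw [barPrepend_inc, barR_inc, barR_inc, barPrepend_inc, termR_cons]

theorem barCounit_mem {l : Γ} {u : D.barSum y Y' Y} (hu : u ∈ (D.barSum y Y' Y).gr l) :
    D.barCounit y Y' Y u ∈ (D.Hom Y' Y).gr l := by
  refine barSum_gr_induction (P := fun u => D.barCounit y Y' Y u ∈ (D.Hom Y' Y).gr l) hu ?_ ?_ ?_
  · rw [map_zero]; exact Submodule.zero_mem _
  · intro s t hs ht; rw [map_add]; exact Submodule.add_mem _ hs ht
  · rintro ⟨a, L⟩ i rfl t ht
    rw [barCounit_inc]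
    cases L with
    | nil =>
      rw [show i + barShift (S := S) (a, ([] : List J)) = i by simp [barShift]]
      exact barEps_mem ht
    | cons c L => rw [barEps_cons]; exact Submodule.zero_mem _

theorem barCounit_barL (g : D.Hom Y Z) (u : D.barSum y Y' Y) :
    D.barCounit y Y' Z (D.barL y Y' g u) = D.comp g (D.barCounit y Y' Y u) := by
  refine barSum_induction (P := fun u => D.barCounit y Y' Z (D.barL y Y' g u) =
    D.comp g (D.barCounit y Y' Y u)) u (by simp) ?_ ?_
  · intro s t hs ht; simp only [map_add, hs, ht]
  · rintro ⟨a, L⟩ t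
    rw [barL_inc, barCounit_inc, barCounit_inc, barEps_termL]
    cases L with
    | nil =>
      refine (D.Hom Y Z).hom_induction (P := fun g => D.comp ((D.Hom Y Z).koszul
        (barShift (S := S) (a, ([] : List J))) g) (D.barEps y Y' [] a Y t) =
          D.comp g (D.barEps y Y' [] a Y t)) g (by simp) ?_ ?_
      · intro s t hs ht; simp only [map_add, LinearMap.add_apply, hs, ht]
      · intro i g hg
        rw [DGMod.koszul_of_mem _ _ hg]
        simp only [barShift, List.length_nil, zero_smul, neg_zero, map_zero,
          AddMonoidHom.zero_apply, ksign_zero, one_smul]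
    | cons c L => rw [barEps_cons, map_zero, map_zero]

theorem barCounit_barR (u : D.barSum y Y' Y) (g : D.Hom Y'' Y') :
    D.barCounit y Y'' Y (D.barR y u g) = D.comp (D.barCounit y Y' Y u) g := by
  refine barSum_induction (P := fun u => D.barCounit y Y'' Y (D.barR y u g) =
    D.comp (D.barCounit y Y' Y u) g) u (by simp) ?_ ?_
  · intro s t hs ht; simp only [map_add, LinearMap.add_apply, hs, ht]
  · intro p t
    rw [barR_inc, barCounit_inc, barCounit_inc, barEps_termR]

theorem barCounit_barD (u : D.barSum y Y' Y) :
    D.barCounit y Y' Y (D.barD y Y' Y u) = (D.Hom Y' Y).d (D.barCounit y Y' Y u) := by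
  refine barSum_induction (P := fun u => D.barCounit y Y' Y (D.barD y Y' Y u) =
    (D.Hom Y' Y).d (D.barCounit y Y' Y u)) u (by simp) ?_ ?_
  · intro s t hs ht; simp only [map_add, hs, ht]
  · rintro ⟨a, L⟩ t
    rw [barD, LinearMap.add_apply, map_add, barTwist_inc, barCounit_barDelta, add_zero,
      barSum_d_inc, map_smul, barCounit_inc, barCounit_inc, barEps_d]
    cases L with
    | nil =>
      simp only [barShift, List.length_nil, zero_smul, neg_zero, map_zero, ksign_zero, one_smul]
    | cons c L => rw [barEps_cons, map_zero, smul_zero]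

variable (D y)

/-- The cone of the counit `ε : Bar → D` as a complex: the component of degree `l` is the sum of
those of degree `l + ι` of the bar complex and of degree `l` of `D`, and
`d (u, g) = (-d u, ε u + d g)`. -/
def augBarObj (Y Y' : D.Obj) : DGMod.{max v w} k S where
  carrier := D.barSum y Y' Y × D.Hom Y' Y
  gr l := ((D.barSum y Y' Y).gr (l + S.ι)).prod ((D.Hom Y' Y).gr l)
  indep := by
    classical
    refine iSupIndep_of_dec _ (LinearMap.coprod
      (Finsupp.lmapDomain _ k (fun l => l - S.ι) ∘ₗ
        Finsupp.mapRange.linearMap (LinearMap.inl k _ _) ∘ₗ (D.barSum y Y' Y).dec)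
      (Finsupp.mapRange.linearMap (LinearMap.inr k _ _) ∘ₗ (D.Hom Y' Y).dec)) ?_
    rintro l ⟨u, g⟩ ⟨hu, hg⟩
    simp [DGMod.dec_of_mem _ hu, DGMod.dec_of_mem _ hg, Finsupp.mapDomain_single,
      ← Finsupp.single_add]
  iSup_gr := by
    rw [eq_top_iff]
    rintro ⟨u, g⟩ -
    rw [← Prod.fst_add_snd (u, g)]
    refine Submodule.add_mem _ ?_ ?_
    · refine (D.barSum y Y' Y).hom_induction
        (P := fun u => ((u, 0) : D.barSum y Y' Y × D.Hom Y' Y) ∈ _) u ?_ ?_ ?_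
      · exact Submodule.zero_mem _
      · intro s t hs ht
        rw [show ((s + t, 0) : D.barSum y Y' Y × D.Hom Y' Y) = (s, 0) + (t, 0) by simp]
        exact Submodule.add_mem _ hs ht
      · intro i u hu
        refine Submodule.mem_iSup_of_mem (i - S.ι) ⟨?_, Submodule.zero_mem _⟩
        rw [sub_add_cancel]; exact hu
    · refine (D.Hom Y' Y).hom_induction
        (P := fun g => ((0, g) : D.barSum y Y' Y × D.Hom Y' Y) ∈ _) g ?_ ?_ ?_
      · exact Submodule.zero_mem _
      · intro s t hs ht
        rw [show ((0, s + t) : D.barSum y Y' Y × D.Hom Y' Y) = (0, s) + (0, t) by simp]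
        exact Submodule.add_mem _ hs ht
      · intro i g hg
        exact Submodule.mem_iSup_of_mem i ⟨Submodule.zero_mem _, hg⟩
  d := LinearMap.prod (-D.barD y Y' Y ∘ₗ LinearMap.fst k (D.barSum y Y' Y) (D.Hom Y' Y))
    (D.barCounit y Y' Y ∘ₗ LinearMap.fst k (D.barSum y Y' Y) (D.Hom Y' Y) +
      (D.Hom Y' Y).d ∘ₗ LinearMap.snd k (D.barSum y Y' Y) (D.Hom Y' Y))
  d_mem {l m} hm := ⟨Submodule.neg_mem _ (barD_mem hm.1),
    Submodule.add_mem _ (barCounit_mem hm.1) ((D.Hom Y' Y).d_mem hm.2)⟩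
  d_d m := by
    ext1
    · simp [barD_barD]
    · simp [barCounit_barD, DGMod.d_d]

variable {D y} in
theorem augBarObj_d (u : D.barSum y Y' Y) (g : D.Hom Y' Y) :
    (D.augBarObj y Y Y').d (u, g) =
      (-D.barD y Y' Y u, D.barCounit y Y' Y u + (D.Hom Y' Y).d g) := rfl

/-- The left action on the augmented bar complex,
`f · (u, g) = ((-1) ^ ⟨ι, |f|⟩ f · u, f ∘ g)`. -/
def augBarL (Y' : D.Obj) {Y Z : D.Obj} :
    D.Hom Y Z →ₗ[k] D.augBarObj y Y Y' →ₗ[k] D.augBarObj y Z Y' :=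
  LinearMap.mk₂ k (fun f m => (D.barL y Y' ((D.Hom Y Z).koszul S.ι f) m.1, D.comp f m.2))
    (fun f f' m => by simp only [map_add, LinearMap.add_apply]; rfl)
    (fun c f m => by simp only [map_smul, LinearMap.smul_apply]; rfl)
    (fun f m m' => congrArg₂ Prod.mk (map_add _ _ _) (map_add _ _ _))
    (fun c f m => congrArg₂ Prod.mk (map_smul _ _ _) (map_smul _ _ _))

/-- The right action on the augmented bar complex, `(u, g) · f = (u · f, g ∘ f)`. -/
def augBarR {Y' Y'' : D.Obj} {Y : D.Obj} :
    D.augBarObj y Y Y' →ₗ[k] D.Hom Y'' Y' →ₗ[k] D.augBarObj y Y Y'' :=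
  LinearMap.mk₂ k (fun m f => (D.barR y m.1 f, D.comp m.2 f))
    (fun m m' f => congrArg₂ Prod.mk (LinearMap.map_add₂ _ _ _ _) (LinearMap.map_add₂ _ _ _ _))
    (fun c m f => congrArg₂ Prod.mk (LinearMap.map_smul₂ _ _ _ _) (LinearMap.map_smul₂ _ _ _ _))
    (fun m f f' => by simp only [map_add]; rfl)
    (fun c m f => by simp only [map_smul]; rfl)

variable {D y}

theorem augBarL_apply (f : D.Hom Y Z) (u : D.barSum y Y' Y) (g : D.Hom Y' Y) :
    D.augBarL y Y' f (u, g) = (D.barL y Y' ((D.Hom Y Z).koszul S.ι f) u, D.comp f g) := rfl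

theorem augBarR_apply (u : D.barSum y Y' Y) (g : D.Hom Y' Y) (f : D.Hom Y'' Y') :
    D.augBarR y (u, g) f = (D.barR y u f, D.comp g f) := rfl

variable (D y)

/-- The augmented bar complex, i.e. the cone of the counit from the bar complex to the diagonal
bimodule. -/
def augBar : DGBimod.{v, w} D D where
  obj := D.augBarObj y
  lact {_ _ Y'} := D.augBarL y Y'
  ract := D.augBarR y
  one_lact := by
    rintro X Y ⟨u, g⟩
    rw [augBarL_apply, DGMod.koszul_of_mem _ _ (D.one_mem _), map_zero, ksign_zero, one_smul,
      barL_one, D.one_comp]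
  comp_lact := by
    rintro X X' X'' Y f f' ⟨u, g⟩
    simp only [augBarL_apply, D.koszul_comp, barL_comp, D.assoc]
    rfl
  ract_one := by
    rintro X Y ⟨u, g⟩
    rw [augBarR_apply, barR_one, D.comp_one]
  ract_comp := by
    rintro X Y Y' Y'' ⟨u, g⟩ f f'
    simp only [augBarR_apply, barR_comp, D.assoc]
    rfl
  lact_ract := by
    rintro X X' Y Y' f ⟨u, g⟩ f'
    simp only [augBarR_apply, augBarL_apply, barL_barR, D.assoc]
    rfl
  lact_mem := by
    rintro X X' Y i j f ⟨u, g⟩ hf ⟨hu, hg⟩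
    refine ⟨?_, D.comp_mem hf hg⟩
    rw [add_assoc]
    exact barL_mem ((D.Hom X X').koszul_mem _ hf) hu
  ract_mem := by
    rintro X Y Y' i j ⟨u, g⟩ f ⟨hu, hg⟩ hf
    refine ⟨?_, D.comp_mem hg hf⟩
    rw [add_right_comm]
    exact barR_mem hu hf
  d_lact := by
    rintro X X' Y i f ⟨u, g⟩ hf
    rw [augBarL_apply, augBarL_apply, augBarObj_d, augBarObj_d, augBarL_apply,
      barD_barL u ((D.Hom X X').koszul_mem _ hf), barCounit_barL, D.d_comp g hf,
      DGMod.koszul_of_mem _ _ hf, DGMod.koszul_of_mem _ _ ((D.Hom X X').d_mem hf), map_add,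
      ksign_add, S.pairing_ι, ksign_one]
    refine Prod.ext ?_ ?_
    · change _ = _ + ksign k (S.pairing S.ι i) • _
      simp only [map_neg, map_smul, LinearMap.smul_apply, smul_smul,
        mul_neg, mul_one, neg_smul, LinearMap.neg_apply, smul_neg, neg_add]
    · change _ = _ + ksign k (S.pairing S.ι i) • _
      simp only [map_add, map_smul, LinearMap.smul_apply, smul_add]
      abel
  d_ract := by
    rintro X Y Y' i ⟨u, g⟩ f ⟨hu, hg⟩
    rw [augBarR_apply, augBarObj_d, augBarObj_d, augBarR_apply, augBarR_apply,
      barD_barR f hu, barCounit_barR, D.d_comp f hg, map_add, ksign_add, S.pairing_ι, ksign_one]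
    refine Prod.ext ?_ ?_
    · change _ = _ + ksign k (S.pairing S.ι i) • _
      simp only [map_neg, mul_neg, mul_one, neg_smul, LinearMap.neg_apply, neg_add, neg_neg]
    · change _ = _ + ksign k (S.pairing S.ι i) • _
      simp only [map_add, LinearMap.add_apply]
      abel

/-- Prepending an identity contracts the augmented bar complex at the objects it is built from. -/
theorem rightContractible_augBar (b : J) : (D.augBar y).RightContractible (y b) := by
  refine ⟨fun Y' => LinearMap.prod
    (D.barPair y Y' b (y b) (D.one (y b)) ∘ₗ LinearMap.snd k _ _ -
      D.barPrepend y Y' b (y b) (D.one (y b)) ∘ₗ LinearMap.fst k _ _) 0, ?_, ?_, ?_⟩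
  · rintro Y' i ⟨u, g⟩ ⟨hu, hg⟩
    refine ⟨?_, Submodule.zero_mem _⟩
    rw [sub_add_cancel]
    refine Submodule.sub_mem _ ?_ ?_
    · have := barPair_mem (x := y) (D.one_mem (y b)) hg
      rwa [zero_add] at this
    · have := barPrepend_mem (D.one_mem (y b)) hu
      rwa [zero_add, add_sub_cancel_right] at this
  · rintro Y' Y'' ⟨u, g⟩ f
    refine Prod.ext ?_ ?_
    · change D.barPair y Y'' b (y b) (D.one (y b)) (D.comp g f) -
        D.barPrepend y Y'' b (y b) (D.one (y b)) (D.barR y u f) =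
        D.barR y (D.barPair y Y' b (y b) (D.one (y b)) g -
          D.barPrepend y Y' b (y b) (D.one (y b)) u) f
      rw [map_sub, LinearMap.sub_apply, barR_pair, barR_prepend]
    · exact (LinearMap.map_zero₂ D.comp f).symm
  · rintro Y' ⟨u, g⟩
    refine Prod.ext ?_ ?_
    · change -D.barD y Y' (y b) (D.barPair y Y' b (y b) (D.one (y b)) g -
          D.barPrepend y Y' b (y b) (D.one (y b)) u) +
        (D.barPair y Y' b (y b) (D.one (y b)) (D.barCounit y Y' (y b) u + (D.Hom Y' (y b)).d g) -
          D.barPrepend y Y' b (y b) (D.one (y b)) (-D.barD y Y' (y b) u)) = u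
      rw [map_sub, barD_pair_one, barD_prepend_one, map_add, map_neg]
      abel
    · change D.barCounit y Y' (y b) (D.barPair y Y' b (y b) (D.one (y b)) g -
          D.barPrepend y Y' b (y b) (D.one (y b)) u) + (D.Hom Y' (y b)).d 0 + 0 = g
      rw [map_sub, barCounit_pair, barCounit_prepend, D.one_comp, map_zero]
      abel

end AugBar

end DGCat

namespace DGBimod

variable {k : Type u} [CommRing k] {Γ : Type t} [AddCommGroup Γ] {S : GradingDatum Γ}
  {C D : DGCat.{v, w} k S}

theorem HomDeg.diff_apply {M N : DGBimod C D} {l : Γ} (φ : HomDeg M N l) {X : C.Obj} {Y : D.Obj}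
    (m : M.obj X Y) : φ.diff X Y m = (N.obj X Y).d (φ.app X Y m) -
      ksign k (S.pairing S.ι l) • φ.app X Y ((M.obj X Y).d m) := rfl

/-- The differential of a morphism of degree `l` is left linear of degree `ι + l`. -/
theorem HomDeg.diff_lact {M N : DGBimod C D} {l : Γ} (φ : HomDeg M N l) {X X' : C.Obj} {Y : D.Obj}
    {j : Γ} {f : C.Hom X X'} (m : M.obj X Y) (hf : f ∈ (C.Hom X X').gr j) :
    φ.diff X' Y (M.lact f m) =
      ksign k (S.pairing (S.ι + l) j) • N.lact f (φ.diff X Y m) := by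
  rw [diff_apply, diff_apply, φ.app_lact m hf, M.d_lact m hf, map_add,
    φ.app_lact m ((C.Hom X X').d_mem hf), map_smul, map_smul, φ.app_lact _ hf, N.d_lact _ hf,
    map_add (S.pairing l), map_add S.pairing, AddMonoidHom.add_apply, ksign_add, ksign_add,
    S.symm S.ι l, map_sub, map_smul]
  simp only [smul_add, smul_sub, smul_smul]
  have e : ksign k (S.pairing l S.ι) * (ksign k (S.pairing l j) * ksign k (S.pairing l S.ι)) =
      ksign k (S.pairing l j) := by
    rw [mul_comm, mul_assoc, ksign_mul_self, mul_one]
  rw [e, mul_comm (ksign k (S.pairing l j)) (ksign k (S.pairing S.ι j)), add_sub_add_left_eq_sub]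
  congr 2
  ring

end DGBimod

namespace DGCat

variable {k : Type u} [CommRing k] {Γ : Type t} [AddCommGroup Γ] {S : GradingDatum Γ}

/-! ### Morphisms from the bar complex to a contractible bimodule -/

section Lifting

variable {D : DGCat.{v, w} k S} {I : Type w} (x : I → D.Obj) (N : DGBimod D D)
  (s : ∀ a Y', N.obj (x a) Y' →ₗ[k] N.obj (x a) Y') {l : Γ}
  (F : DGBimod.HomDeg (D.barFamily x) N l)

/-- The components of a morphism from the bar complex, as linear maps on direct sums. -/
def barApp {x : I → D.Obj} {N : DGBimod D D} (F : DGBimod.HomDeg (D.barFamily x) N l)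
    (Y' Y : D.Obj) : D.barSum x Y' Y →ₗ[k] N.obj Y Y' := F.app Y Y'

/-- The restriction of `F` to the elements `[1, f_1, …, f_{r+1}]`. -/
def unitTerm (Y' : D.Obj) (L : List I) (a : I) : D.barTerm x Y' L (x a) →ₗ[k] N.obj (x a) Y' :=
  barApp F Y' (x a) ∘ₗ D.barInc x Y' (x a) (a, L) ∘ₗ D.barCons x Y' a L (x a) (D.one (x a))

/-- A primitive `H` of a closed bimodule morphism `F` from the bar complex to `N`, obtained from
contractions `s` of the right modules `N (x a)`, on the summand of `X_0, …, X_r`, here `X_0 = x a`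
and `L` lists the rest. It is determined by left linearity and the recursion
`H [1, f_1, …] = s (F [1, f_1, …] - (-1) ^ ⟨ι, l⟩ H [f_1, …])`, without the second term for
`r = 0`. -/
def primTerm (Y' : D.Obj) : ∀ (L : List I) (a : I) (Y : D.Obj),
    D.barTerm x Y' (a :: L) Y →ₗ[k] N.obj Y Y'
  | [], a, Y => TensorProduct.lift
      ((N.lact ∘ₗ (D.Hom (x a) Y).koszul (l - S.ι + barShift (S := S) (a, ([] : List I))) :
        D.Hom (x a) Y →ₗ[k] N.obj (x a) Y' →ₗ[k] N.obj Y Y').compl₂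
          (s a Y' ∘ₗ unitTerm x N F Y' [] a))
  | b :: L, a, Y => TensorProduct.lift
      ((N.lact ∘ₗ (D.Hom (x a) Y).koszul (l - S.ι + barShift (S := S) (a, b :: L)) :
        D.Hom (x a) Y →ₗ[k] N.obj (x a) Y' →ₗ[k] N.obj Y Y').compl₂
          (s a Y' ∘ₗ (unitTerm x N F Y' (b :: L) a -
            ksign k (S.pairing S.ι l) • primTerm Y' L b (x a))))

/-- The map with components `primTerm`. -/
def primSum (Y' Y : D.Obj) : D.barSum x Y' Y →ₗ[k] N.obj Y Y' :=
  D.barLift x fun p => primTerm x N s F Y' p.2 p.1 Y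

variable {x N s F} {Y Y' Y'' Z : D.Obj} {a : I} {L : List I}

theorem primTerm_nil (f : D.Hom (x a) Y) (g : D.barTerm x Y' [] (x a)) :
    primTerm x N s F Y' [] a Y (D.barCons x Y' a [] Y f g) =
      N.lact ((D.Hom (x a) Y).koszul (l - S.ι + barShift (S := S) (a, ([] : List I))) f)
        (s a Y' (unitTerm x N F Y' [] a g)) := rfl

theorem primTerm_cons {b : I} (f : D.Hom (x a) Y) (t : D.barTerm x Y' (b :: L) (x a)) :
    primTerm x N s F Y' (b :: L) a Y (D.barCons x Y' a (b :: L) Y f t) =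
      N.lact ((D.Hom (x a) Y).koszul (l - S.ι + barShift (S := S) (a, b :: L)) f)
        (s a Y' (unitTerm x N F Y' (b :: L) a t -
          ksign k (S.pairing S.ι l) • primTerm x N s F Y' L b (x a) t)) := rfl

theorem primTerm_barCons (f : D.Hom (x a) Y) (t : D.barTerm x Y' L (x a)) :
    primTerm x N s F Y' L a Y (D.barCons x Y' a L Y f t) =
      N.lact ((D.Hom (x a) Y).koszul (l - S.ι + barShift (S := S) (a, L)) f)
        (primTerm x N s F Y' L a (x a) (D.barCons x Y' a L (x a) (D.one (x a)) t)) := by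
  have h1 : ∀ j, (D.Hom (x a) (x a)).koszul j (D.one (x a)) = D.one (x a) := fun j => by
    rw [DGMod.koszul_of_mem _ _ (D.one_mem _), map_zero, ksign_zero, one_smul]
  cases L with
  | nil => rw [primTerm_nil, primTerm_nil, h1, N.one_lact]
  | cons b L => rw [primTerm_cons, primTerm_cons, h1, N.one_lact]

theorem primSum_inc (p : I × List I) (t : D.barTerm x Y' (p.1 :: p.2) Y) :
    primSum x N s F Y' Y (D.barInc x Y' Y p t) = primTerm x N s F Y' p.2 p.1 Y t :=
  barLift_inc _ _ _

theorem primSum_pair_one (g : D.Hom Y' (x a)) :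
    primSum x N s F Y' (x a) (D.barPair x Y' a (x a) (D.one (x a)) g) =
      s a Y' (barApp F Y' (x a) (D.barPair x Y' a (x a) (D.one (x a)) g)) := by
  refine (primSum_inc (a, []) (D.barCons x Y' a [] (x a) (D.one (x a)) g)).trans
    ((primTerm_nil _ _).trans ?_)
  rw [DGMod.koszul_of_mem _ _ (D.one_mem _), map_zero, ksign_zero, one_smul,
    N.one_lact]
  rfl

theorem primSum_prepend_one (u : D.barSum x Y' (x a)) :
    primSum x N s F Y' (x a) (D.barPrepend x Y' a (x a) (D.one (x a)) u) =
      s a Y' (barApp F Y' (x a) (D.barPrepend x Y' a (x a) (D.one (x a)) u) -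
        ksign k (S.pairing S.ι l) • primSum x N s F Y' (x a) u) := by
  refine barSum_induction (P := fun u =>
    primSum x N s F Y' (x a) (D.barPrepend x Y' a (x a) (D.one (x a)) u) =
      s a Y' (barApp F Y' (x a) (D.barPrepend x Y' a (x a) (D.one (x a)) u) -
        ksign k (S.pairing S.ι l) • primSum x N s F Y' (x a) u)) u ?_ ?_ ?_
  · simp only [map_zero, smul_zero, sub_zero]
  · intro u v hu hv
    simp only [map_add, map_sub, hu, hv, smul_add]
    abel
  · rintro ⟨b, L⟩ t
    rw [barPrepend_inc, primSum_inc, primSum_inc, primTerm_cons,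
      DGMod.koszul_of_mem _ _ (D.one_mem _), map_zero, ksign_zero, one_smul, N.one_lact]
    rfl

theorem primSum_barL {j : Γ} {g : D.Hom Y Z} (hg : g ∈ (D.Hom Y Z).gr j) (u : D.barSum x Y' Y) :
    primSum x N s F Y' Z (D.barL x Y' g u) =
      ksign k (S.pairing (l - S.ι) j) • N.lact g (primSum x N s F Y' Y u) := by
  refine barSum_induction (P := fun u => primSum x N s F Y' Z (D.barL x Y' g u) =
    ksign k (S.pairing (l - S.ι) j) • N.lact g (primSum x N s F Y' Y u)) u (by simp) ?_ ?_
  · intro u v hu hv; simp only [map_add, hu, hv, smul_add]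
  · rintro ⟨a, L⟩ t
    rw [barL_inc, primSum_inc, primSum_inc]
    refine barCons_induction (P := fun t => primTerm x N s F Y' L a Z (D.termL x Y' (a :: L)
      ((D.Hom Y Z).koszul (barShift (S := S) (a, L)) g) t) =
        ksign k (S.pairing (l - S.ι) j) • N.lact g (primTerm x N s F Y' L a Y t)) t (by simp) ?_ ?_
    · intro u v hu hv; simp only [map_add, hu, hv, smul_add]
    · intro f w
      rw [termL_cons, primTerm_barCons, primTerm_barCons f, D.koszul_comp,
        DGMod.koszul_of_mem _ _ hg, map_smul ((D.Hom Y Z).koszul _), DGMod.koszul_of_mem _ _ hg]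
      simp only [map_smul, LinearMap.smul_apply, N.comp_lact, smul_smul, map_add,
        AddMonoidHom.add_apply, ksign_add]
      rw [mul_left_comm, ksign_mul_self, mul_one]

theorem primSum_barR (hs : ∀ a {Y Y'} (m : N.obj (x a) Y) (g : D.Hom Y' Y),
      s a Y' (N.ract m g) = N.ract (s a Y m) g)
    (u : D.barSum x Y' Y) (g : D.Hom Y'' Y') :
    primSum x N s F Y'' Y (D.barR x u g) = N.ract (primSum x N s F Y' Y u) g := by
  have hu : ∀ L (a : I) (t : D.barTerm x Y' L (x a)),
      unitTerm x N F Y'' L a (D.termR x L t g) = N.ract (unitTerm x N F Y' L a t) g := by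
    intro L a t
    have := F.app_ract (D.barInc x Y' (x a) (a, L) (D.barCons x Y' a L (x a) (D.one (x a)) t)) g
    refine Eq.trans (congrArg (barApp F Y'' (x a)) ?_) this
    exact (barR_inc (a, L) (D.barCons x Y' a L (x a) (D.one (x a)) t) g).symm
  have hp : ∀ L (a : I) (Y : D.Obj) (t : D.barTerm x Y' (a :: L) Y),
      primTerm x N s F Y'' L a Y (D.termR x (a :: L) t g) =
        N.ract (primTerm x N s F Y' L a Y t) g := by
    intro L
    induction L with
    | nil =>
      intro a Y t
      refine barCons_induction (P := fun t => primTerm x N s F Y'' [] a Y (D.termR x [a] t g) =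
        N.ract (primTerm x N s F Y' [] a Y t) g) t (by simp) ?_ ?_
      · intro u v hu hv; simp only [map_add, LinearMap.add_apply, hu, hv]
      · intro f w
        rw [termR_cons, primTerm_nil, primTerm_nil, hu, hs, N.lact_ract]
    | cons b L ih =>
      intro a Y t
      refine barCons_induction (P := fun t => primTerm x N s F Y'' (b :: L) a Y
        (D.termR x (a :: b :: L) t g) = N.ract (primTerm x N s F Y' (b :: L) a Y t) g)
        t (by simp) ?_ ?_
      · intro u v hu hv; simp only [map_add, LinearMap.add_apply, hu, hv]
      · intro f w
        rw [termR_cons, primTerm_cons, primTerm_cons, hu, ih, N.lact_ract, ← hs, map_sub N.ract,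
          map_smul N.ract, LinearMap.sub_apply, LinearMap.smul_apply]
  refine barSum_induction (P := fun u => primSum x N s F Y'' Y (D.barR x u g) =
    N.ract (primSum x N s F Y' Y u) g) u (by simp) ?_ ?_
  · intro u v hu hv; simp only [map_add, LinearMap.add_apply, hu, hv]
  · intro p t
    rw [barR_inc, primSum_inc, primSum_inc, hp]

theorem primSum_mem (hs : ∀ a {Y i} {m : N.obj (x a) Y}, m ∈ (N.obj (x a) Y).gr i →
      s a Y m ∈ (N.obj (x a) Y).gr (i - S.ι))
    {i : Γ} {u : D.barSum x Y' Y} (hu : u ∈ (D.barSum x Y' Y).gr i) :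
    primSum x N s F Y' Y u ∈ (N.obj Y Y').gr (i + (l - S.ι)) := by
  have hu' : ∀ L (a : I) {j} {t : D.barTerm x Y' L (x a)}, t ∈ (D.barTerm x Y' L (x a)).gr j →
      unitTerm x N F Y' L a t ∈ (N.obj (x a) Y').gr (j + barShift (S := S) (a, L) + l) := by
    intro L a j t ht
    have h1 := barInc_mem (p := (a, L)) (barCons_mem (D.one_mem (x a)) ht)
    rw [zero_add] at h1
    exact F.app_mem h1
  have hp : ∀ L (a : I) (Y : D.Obj) {j} {t : D.barTerm x Y' (a :: L) Y},
      t ∈ (D.barTerm x Y' (a :: L) Y).gr j → primTerm x N s F Y' L a Y t ∈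
        (N.obj Y Y').gr (j + barShift (S := S) (a, L) + (l - S.ι)) := by
    intro L
    induction L with
    | nil =>
      intro a Y j t ht
      refine barCons_gr_induction (P := fun t => primTerm x N s F Y' [] a Y t ∈
        (N.obj Y Y').gr (j + barShift (S := S) (a, ([] : List I)) + (l - S.ι))) ht ?_ ?_ ?_ ?_
      · rw [map_zero]; exact Submodule.zero_mem _
      · intro u v hu hv; rw [map_add]; exact Submodule.add_mem _ hu hv
      · intro c t ht; rw [map_smul]; exact Submodule.smul_mem _ _ ht
      · rintro j j' rfl f hf w hw
        rw [primTerm_nil]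
        have := N.lact_mem ((D.Hom (x a) Y).koszul_mem (l - S.ι + barShift (S := S)
          (a, ([] : List I))) hf) (hs a (hu' [] a hw))
        rwa [show j + (j' + barShift (S := S) (a, ([] : List I)) + l - S.ι) =
          j + j' + barShift (S := S) (a, ([] : List I)) + (l - S.ι) by abel] at this
    | cons b L ih =>
      intro a Y j t ht
      refine barCons_gr_induction (P := fun t => primTerm x N s F Y' (b :: L) a Y t ∈
        (N.obj Y Y').gr (j + barShift (S := S) (a, b :: L) + (l - S.ι))) ht ?_ ?_ ?_ ?_
      · rw [map_zero]; exact Submodule.zero_mem _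
      · intro u v hu hv; rw [map_add]; exact Submodule.add_mem _ hu hv
      · intro c t ht; rw [map_smul]; exact Submodule.smul_mem _ _ ht
      · rintro j j' rfl f hf w hw
        rw [primTerm_cons]
        have h1 := ih b (x a) hw
        rw [show j' + barShift (S := S) (b, L) + (l - S.ι) =
          j' + barShift (S := S) (a, b :: L) + l by rw [barShift_cons]; abel] at h1
        have := N.lact_mem ((D.Hom (x a) Y).koszul_mem (l - S.ι + barShift (S := S) (a, b :: L)) hf)
          (hs a (Submodule.sub_mem _ (hu' (b :: L) a hw)
            (Submodule.smul_mem _ (ksign k (S.pairing S.ι l)) h1)))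
        rwa [show j + (j' + barShift (S := S) (a, b :: L) + l - S.ι) =
          j + j' + barShift (S := S) (a, b :: L) + (l - S.ι) by abel] at this
  refine barSum_gr_induction (P := fun u => primSum x N s F Y' Y u ∈
    (N.obj Y Y').gr (i + (l - S.ι))) hu ?_ ?_ ?_
  · rw [map_zero]; exact Submodule.zero_mem _
  · intro s t hs ht; rw [map_add]; exact Submodule.add_mem _ hs ht
  · rintro p j rfl t ht
    rw [primSum_inc]
    exact hp p.2 p.1 Y ht

/-- The elements `[1, f_1, …, f_{r+1}]` generate the bar complex as a left module. -/
theorem barInc_barCons_eq {j : Γ} {f : D.Hom (x a) Y} (hf : f ∈ (D.Hom (x a) Y).gr j)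
    (t : D.barTerm x Y' L (x a)) :
    D.barInc x Y' Y (a, L) (D.barCons x Y' a L Y f t) =
      ksign k (S.pairing (barShift (S := S) (a, L)) j) •
        D.barL x Y' f (D.barInc x Y' (x a) (a, L) (D.barCons x Y' a L (x a) (D.one (x a)) t)) := by
  rw [barL_inc, termL_cons, DGMod.koszul_of_mem _ _ hf, map_smul, LinearMap.smul_apply, D.comp_one,
    map_smul, LinearMap.smul_apply, map_smul, smul_smul, ksign_mul_self, one_smul]

/-- If the right modules `⟨x a|N` are contractible, then the complex of bimodule morphisms from the
bar complex built from the family `x` to `N` is acyclic. -/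
theorem exists_diff_eq (hN : ∀ a, N.RightContractible (x a))
    (F : DGBimod.HomDeg (D.barFamily x) N l) (hF : ∀ Y Y', F.diff Y Y' = 0) :
    ∃ H : DGBimod.HomDeg (D.barFamily x) N (l - S.ι), ∀ Y Y', H.diff Y Y' = F.app Y Y' := by
  choose s s_mem s_ract s_d using hN
  let H : DGBimod.HomDeg (D.barFamily x) N (l - S.ι) :=
    { app := fun Y Y' => primSum x N s F Y' Y
      app_mem := fun hm => primSum_mem s_mem hm
      app_lact := fun m hf => primSum_barL hf m
      app_ract := fun m g => primSum_barR s_ract m g }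
  let c : k := ksign k (S.pairing S.ι l)
  -- `E` and `F` are left linear of the same degree, so they are compared on `[1, f_1, …, f_{r+1}]`,
  -- by induction on `r`.
  let E : ∀ Y' Y, D.barSum x Y' Y →ₗ[k] N.obj Y Y' := fun Y' Y => H.diff Y Y'
  have dF : ∀ {Y Y'} (u : D.barSum x Y' Y), (N.obj Y Y').d (barApp F Y' Y u) =
      c • barApp F Y' Y (D.barD x Y' Y u) := fun u =>
    sub_eq_zero.1 (LinearMap.congr_fun (hF _ _) u)
  have E_apply : ∀ {Y Y'} (u : D.barSum x Y' Y), E Y' Y u =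
      (N.obj Y Y').d (primSum x N s F Y' Y u) + c • primSum x N s F Y' Y (D.barD x Y' Y u) := by
    intro Y Y' u
    have : ksign k (S.pairing S.ι (l - S.ι)) = -c := by
      rw [map_sub, CharTwo.sub_eq_add, ksign_add, S.pairing_ι, ksign_one, mul_neg_one]
    refine (DGBimod.HomDeg.diff_apply H u).trans ?_
    rw [this, neg_smul, sub_neg_eq_add]
    rfl
  have E_barL : ∀ {Y Y' Z j} {f : D.Hom Y Z} (u : D.barSum x Y' Y), f ∈ (D.Hom Y Z).gr j →
      E Y' Z (D.barL x Y' f u) = ksign k (S.pairing l j) • N.lact f (E Y' Y u) := by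
    intro Y Y' Z j f u hf
    have := H.diff_lact u hf
    rw [add_sub_cancel] at this
    exact this
  have F_barL : ∀ {Y Y' Z j} {f : D.Hom Y Z} (u : D.barSum x Y' Y), f ∈ (D.Hom Y Z).gr j →
      barApp F Y' Z (D.barL x Y' f u) = ksign k (S.pairing l j) • N.lact f (barApp F Y' Y u) :=
    fun u hf => F.app_lact u hf
  have pair : ∀ {a Y'} (g : D.Hom Y' (x a)),
      E Y' (x a) (D.barPair x Y' a (x a) (D.one (x a)) g) =
        barApp F Y' (x a) (D.barPair x Y' a (x a) (D.one (x a)) g) := by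
    intro a Y' g
    rw [E_apply, barD_pair_one, primSum_pair_one, primSum_pair_one, ← map_smul, ← barD_pair_one,
      ← dF, s_d]
  have prepend : ∀ {a Y'} (u : D.barSum x Y' (x a)), E Y' (x a) u = barApp F Y' (x a) u →
      E Y' (x a) (D.barPrepend x Y' a (x a) (D.one (x a)) u) =
        barApp F Y' (x a) (D.barPrepend x Y' a (x a) (D.one (x a)) u) := by
    intro a Y' u hu
    have e := s_d a Y' (barApp F Y' (x a) (D.barPrepend x Y' a (x a) (D.one (x a)) u) -
      c • primSum x N s F Y' (x a) u)
    rw [E_apply, ← eq_sub_iff_add_eq] at hu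
    rw [map_sub (N.obj (x a) Y').d, map_smul (N.obj (x a) Y').d, dF, barD_prepend_one, hu,
      ← eq_sub_iff_add_eq] at e
    rw [E_apply, barD_prepend_one, map_sub (primSum x N s F Y' (x a)),
      map_sub (primSum x N s F Y' (x a)), primSum_pair_one, primSum_prepend_one,
      primSum_prepend_one, e]
    simp only [map_sub, map_smul, smul_sub, smul_smul]
    simp only [c, ksign_mul_self, one_smul]
    abel
  have key : ∀ (Y' : D.Obj) L (a : I) (Y : D.Obj) (t : D.barTerm x Y' (a :: L) Y),
      E Y' Y (D.barInc x Y' Y (a, L) t) = barApp F Y' Y (D.barInc x Y' Y (a, L) t) := by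
    intro Y'
    have reduce : ∀ L a, (∀ w, E Y' (x a) (D.barInc x Y' (x a) (a, L)
          (D.barCons x Y' a L (x a) (D.one (x a)) w)) = barApp F Y' (x a)
            (D.barInc x Y' (x a) (a, L) (D.barCons x Y' a L (x a) (D.one (x a)) w))) →
        ∀ Y (t : D.barTerm x Y' (a :: L) Y), E Y' Y (D.barInc x Y' Y (a, L) t) =
          barApp F Y' Y (D.barInc x Y' Y (a, L) t) := by
      intro L a ha Y t
      refine barCons_induction (P := fun t => E Y' Y (D.barInc x Y' Y (a, L) t) =
        barApp F Y' Y (D.barInc x Y' Y (a, L) t)) t (by simp) ?_ ?_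
      · intro u v hu hv; simp only [map_add, hu, hv]
      · intro f w
        refine (D.Hom (x a) Y).hom_induction (P := fun f =>
          E Y' Y (D.barInc x Y' Y (a, L) (D.barCons x Y' a L Y f w)) =
          barApp F Y' Y (D.barInc x Y' Y (a, L) (D.barCons x Y' a L Y f w))) f (by simp) ?_ ?_
        · intro u v hu hv; simp only [map_add, LinearMap.add_apply, hu, hv]
        · intro j f hf
          rw [barInc_barCons_eq hf, map_smul, map_smul, E_barL _ hf, F_barL _ hf, ha]
    intro L
    induction L with
    | nil => exact fun a => reduce [] a fun w => pair w
    | cons b L ih =>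
      refine fun a => reduce _ a fun w => ?_
      have := prepend _ (ih b (x a) w)
      rwa [barPrepend_inc] at this
  refine ⟨H, fun Y Y' => LinearMap.ext fun u => ?_⟩
  refine barSum_induction (P := fun u => E Y' Y u = barApp F Y' Y u) u (by simp) ?_ ?_
  · intro u v hu hv; simp only [map_add, hu, hv]
  · rintro ⟨a, L⟩ t; exact key Y' L a Y t

end Lifting

end DGCat

/-! ### Comparison of bar complexes -/

namespace DGBimod.HomDeg

variable {k : Type u} [CommRing k] {Γ : Type t} [AddCommGroup Γ] {S : GradingDatum Γ}
  {C D : DGCat.{v, w} k S} {M N P : DGBimod C D} {l l' : Γ}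

/-- Transport along an equality of degrees. -/
def cast (h : l = l') (φ : HomDeg M N l) : HomDeg M N l' where
  app := φ.app
  app_mem hm := h ▸ φ.app_mem hm
  app_lact m hf := h ▸ φ.app_lact m hf
  app_ract := φ.app_ract

/-- The zero morphism of degree `l`. -/
def zero (M N : DGBimod C D) (l : Γ) : HomDeg M N l where
  app _ _ := 0
  app_mem _ := Submodule.zero_mem _
  app_lact _ _ := by simp
  app_ract _ _ := by simp

/-- The identity morphism. -/
def id (M : DGBimod C D) : HomDeg M M 0 where
  app _ _ := LinearMap.id
  app_mem hm := by simpa using hm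
  app_lact m hf := by simp [ksign_zero]
  app_ract _ _ := rfl

/-- The negative of a morphism. -/
def neg (φ : HomDeg M N l) : HomDeg M N l where
  app X Y := -φ.app X Y
  app_mem hm := Submodule.neg_mem _ (φ.app_mem hm)
  app_lact m hf := by simp [φ.app_lact m hf]
  app_ract m g := by simp [φ.app_ract m g]

/-- The difference of two morphisms. -/
def sub (φ ψ : HomDeg M N l) : HomDeg M N l where
  app X Y := φ.app X Y - ψ.app X Y
  app_mem hm := Submodule.sub_mem _ (φ.app_mem hm) (ψ.app_mem hm)
  app_lact m hf := by simp [φ.app_lact m hf, ψ.app_lact m hf, smul_sub]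
  app_ract m g := by simp [φ.app_ract m g, ψ.app_ract m g]

/-- The composition of two morphisms of degree zero. -/
def comp (φ : HomDeg N P 0) (ψ : HomDeg M N 0) : HomDeg M P 0 where
  app X Y := φ.app X Y ∘ₗ ψ.app X Y
  app_mem hm := by simpa using φ.app_mem (ψ.app_mem hm)
  app_lact m hf := by simp [φ.app_lact _ hf, ψ.app_lact m hf, ksign_zero]
  app_ract m g := by simp [φ.app_ract, ψ.app_ract]

theorem diff_eq_zero_iff {φ : HomDeg M N 0} : (∀ X Y, φ.diff X Y = 0) ↔
    ∀ {X Y} (m : M.obj X Y), (N.obj X Y).d (φ.app X Y m) = φ.app X Y ((M.obj X Y).d m) := by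
  simp only [LinearMap.ext_iff, diff_apply, map_zero, ksign_zero, one_smul, LinearMap.zero_apply,
    sub_eq_zero]

theorem ksign_ι_neg_ι : ksign k (S.pairing S.ι (-S.ι)) = -1 := by
  rw [map_neg, ksign_neg, S.pairing_ι, ksign_one]

end DGBimod.HomDeg

namespace DGCat

variable {k : Type u} [CommRing k] {Γ : Type t} [AddCommGroup Γ] {S : GradingDatum Γ}

section Comparison

open DGBimod

variable {D : DGCat.{v, w} k S} {I J : Type w} {x : I → D.Obj} {y : J → D.Obj} {l : Γ}

/-- The counit of the bar complex, on the underlying modules of the bimodule. -/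
def counit (x : I → D.Obj) (Y Y' : D.Obj) : (D.barFamily x).obj Y Y' →ₗ[k] D.Hom Y' Y :=
  D.barCounit x Y' Y

/-- The projection of the augmented bar complex to the (shifted) bar complex. -/
def augFst (y : J → D.Obj) (Y Y' : D.Obj) :
    (D.augBar y).obj Y Y' →ₗ[k] (D.barFamily y).obj Y Y' :=
  LinearMap.fst k (D.barSum y Y' Y) (D.Hom Y' Y)

/-- The projection of the augmented bar complex to the diagonal bimodule. -/
def augSnd (y : J → D.Obj) (Y Y' : D.Obj) : (D.augBar y).obj Y Y' →ₗ[k] D.Hom Y' Y :=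
  LinearMap.snd k (D.barSum y Y' Y) (D.Hom Y' Y)

theorem aug_ext {Y Y' : D.Obj} {m n : (D.augBar y).obj Y Y'}
    (h1 : augFst y Y Y' m = augFst y Y Y' n) (h2 : augSnd y Y Y' m = augSnd y Y Y' n) : m = n :=
  Prod.ext h1 h2

theorem augFst_d {Y Y' : D.Obj} (m : (D.augBar y).obj Y Y') :
    augFst y Y Y' (((D.augBar y).obj Y Y').d m) =
      -((D.barFamily y).obj Y Y').d (augFst y Y Y' m) := rfl

theorem augSnd_d {Y Y' : D.Obj} (m : (D.augBar y).obj Y Y') :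
    augSnd y Y Y' (((D.augBar y).obj Y Y').d m) =
      counit y Y Y' (augFst y Y Y' m) + (D.Hom Y' Y).d (augSnd y Y Y' m) := rfl

theorem augFst_lact {Y Y' Z : D.Obj} {j : Γ} {f : D.Hom Y Z} (hf : f ∈ (D.Hom Y Z).gr j)
    (m : (D.augBar y).obj Y Y') : augFst y Z Y' ((D.augBar y).lact f m) =
      ksign k (S.pairing S.ι j) • (D.barFamily y).lact f (augFst y Y Y' m) := by
  have : augFst y Z Y' ((D.augBar y).lact f m) =
    (D.barFamily y).lact ((D.Hom Y Z).koszul S.ι f) (augFst y Y Y' m) := rfl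
  rw [this, DGMod.koszul_of_mem _ _ hf, map_smul, LinearMap.smul_apply]

/-- A family of linear maps from the bar complex to the diagonal bimodule is a morphism of
bimodules of degree `l`. -/
structure IsDiagHom (K : ∀ Y Y', (D.barFamily x).obj Y Y' →ₗ[k] D.Hom Y' Y) (l : Γ) : Prop where
  mem : ∀ {Y Y' i m}, m ∈ ((D.barFamily x).obj Y Y').gr i → K Y Y' m ∈ (D.Hom Y' Y).gr (i + l)
  lact : ∀ {Y Y' Z j} {f : D.Hom Y Z} (m : (D.barFamily x).obj Y Y'), f ∈ (D.Hom Y Z).gr j →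
    K Z Y' ((D.barFamily x).lact f m) = ksign k (S.pairing l j) • D.comp f (K Y Y' m)
  ract : ∀ {Y Y' Y''} (m : (D.barFamily x).obj Y Y') (g : D.Hom Y'' Y'),
    K Y Y'' ((D.barFamily x).ract m g) = D.comp (K Y Y' m) g

theorem isDiagHom_counit : IsDiagHom (D := D) (counit x) 0 where
  mem hm := by rw [add_zero]; exact barCounit_mem hm
  lact {_ _ _ _ f} m hf := by
    rw [map_zero, AddMonoidHom.zero_apply, ksign_zero, one_smul]; exact barCounit_barL f m
  ract m g := barCounit_barR m g

/-- The morphism to the augmented bar complex with given components. -/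
def augMk (φ : HomDeg (D.barFamily x) (D.barFamily y) (l + S.ι))
    (K : ∀ Y Y', (D.barFamily x).obj Y Y' →ₗ[k] D.Hom Y' Y) (hK : IsDiagHom K l) :
    HomDeg (D.barFamily x) (D.augBar y) l where
  app Y Y' := LinearMap.prod (φ.app Y Y') (K Y Y')
  app_mem {Y Y' i m} hm := by
    have := φ.app_mem hm
    rw [← add_assoc] at this
    exact ⟨this, hK.mem hm⟩
  app_lact {Y Z Y' j f} m hf := by
    refine aug_ext ?_ ?_
    · rw [map_smul, augFst_lact hf, smul_smul]
      refine (φ.app_lact m hf).trans ?_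
      rw [map_add, AddMonoidHom.add_apply, ksign_add]
      rfl
    · rw [map_smul]
      exact hK.lact m hf
  app_ract m g := aug_ext (φ.app_ract m g) (hK.ract m g)

/-- The component in the bar complex of a morphism to the augmented bar complex. -/
def homFst (G : HomDeg (D.barFamily x) (D.augBar y) l) :
    HomDeg (D.barFamily x) (D.barFamily y) (l + S.ι) where
  app Y Y' := augFst y Y Y' ∘ₗ G.app Y Y'
  app_mem hm := by
    have := (G.app_mem hm).1
    rw [add_assoc] at this
    exact this
  app_lact m hf := by
    rw [LinearMap.comp_apply, LinearMap.comp_apply, G.app_lact m hf, map_smul, augFst_lact hf,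
      smul_smul, map_add, AddMonoidHom.add_apply, ksign_add]
  app_ract m g := by
    rw [LinearMap.comp_apply, G.app_ract m g]; rfl

theorem isDiagHom_snd (G : HomDeg (D.barFamily x) (D.augBar y) l) :
    IsDiagHom (fun Y Y' => augSnd y Y Y' ∘ₗ G.app Y Y') l where
  mem hm := (G.app_mem hm).2
  lact m hf := by
    rw [LinearMap.comp_apply, LinearMap.comp_apply, G.app_lact m hf, map_smul]; rfl
  ract m g := by
    rw [LinearMap.comp_apply, G.app_ract m g]; rfl

/-- The counit lifts along the counit of a second bar complex, up to homotopy: a primitive of the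
closed morphism `(0, ε)` to the augmented bar complex consists of the lift and of the homotopy. -/
theorem exists_lift (hy : ∀ a, (D.augBar y).RightContractible (x a)) :
    ∃ (φ : HomDeg (D.barFamily x) (D.barFamily y) 0)
      (K : ∀ Y Y', (D.barFamily x).obj Y Y' →ₗ[k] D.Hom Y' Y),
      (∀ Y Y', φ.diff Y Y' = 0) ∧ IsDiagHom K (-S.ι) ∧
      ∀ Y Y' m, counit y Y Y' (φ.app Y Y' m) + (D.Hom Y' Y).d (K Y Y' m) +
        K Y Y' (((D.barFamily x).obj Y Y').d m) = counit x Y Y' m := by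
  let F : HomDeg (D.barFamily x) (D.augBar y) 0 := augMk (HomDeg.zero _ _ _) _ isDiagHom_counit
  have hF : ∀ Y Y', F.diff Y Y' = 0 := by
    refine HomDeg.diff_eq_zero_iff.2 fun {Y Y'} m => aug_ext ?_ ?_
    · exact neg_eq_zero.2 (map_zero ((D.barFamily y).obj Y Y').d)
    · rw [augSnd_d]
      refine (congrArg₂ (· + ·) (map_zero (counit y Y Y')) (barCounit_barD m).symm).trans ?_
      exact zero_add _
  obtain ⟨G₀, hG⟩ := exists_diff_eq hy F hF
  let G : HomDeg (D.barFamily x) (D.augBar y) (-S.ι) := G₀.cast (zero_sub _)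
  have hs : ksign k (S.pairing S.ι (0 - S.ι)) = -1 := by rw [zero_sub, HomDeg.ksign_ι_neg_ι]
  have hG' : ∀ Y Y' m, ((D.augBar y).obj Y Y').d (G.app Y Y' m) +
      G.app Y Y' (((D.barFamily x).obj Y Y').d m) = F.app Y Y' m := by
    intro Y Y' m
    rw [← hG, HomDeg.diff_apply, hs, neg_smul, one_smul, sub_neg_eq_add]
    rfl
  refine ⟨(homFst G).cast (neg_add_cancel _), _, ?_, isDiagHom_snd G, ?_⟩
  · refine HomDeg.diff_eq_zero_iff.2 fun {Y Y'} m => ?_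
    have := congrArg (augFst y Y Y') (hG' Y Y' m)
    rw [map_add, augFst_d] at this
    exact (neg_add_eq_zero.1 this)
  · intro Y Y' m
    have := congrArg (augSnd y Y Y') (hG' Y Y' m)
    rw [map_add, augSnd_d] at this
    exact this

/-- A closed morphism between bar complexes whose composition with the counit is null-homotopic is
itself null-homotopic: together with the null-homotopy it is a closed morphism to the augmented bar
complex. -/
theorem exists_homotopy (hy : ∀ a, (D.augBar y).RightContractible (x a))
    (φ : HomDeg (D.barFamily x) (D.barFamily y) 0) (hφ : ∀ Y Y', φ.diff Y Y' = 0)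
    (K : ∀ Y Y', (D.barFamily x).obj Y Y' →ₗ[k] D.Hom Y' Y) (hK : IsDiagHom K (-S.ι))
    (h : ∀ Y Y' m, counit y Y Y' (φ.app Y Y' m) + (D.Hom Y' Y).d (K Y Y' m) +
        K Y Y' (((D.barFamily x).obj Y Y').d m) = 0) :
    ∃ H : HomDeg (D.barFamily x) (D.barFamily y) (-S.ι), ∀ Y Y', H.diff Y Y' = φ.app Y Y' := by
  let F : HomDeg (D.barFamily x) (D.augBar y) (-S.ι) :=
    augMk (φ.cast (neg_add_cancel S.ι).symm) K hK
  have hF : ∀ Y Y', F.diff Y Y' = 0 := by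
    refine fun Y Y' => LinearMap.ext fun m => ?_
    rw [HomDeg.diff_apply, HomDeg.ksign_ι_neg_ι, neg_smul, one_smul, sub_neg_eq_add]
    refine aug_ext ?_ ?_
    · rw [map_add, augFst_d]
      exact neg_add_eq_zero.2 (HomDeg.diff_eq_zero_iff.1 hφ m)
    · rw [map_add, augSnd_d]
      exact h Y Y' m
  obtain ⟨G, hG⟩ := exists_diff_eq hy F hF
  refine ⟨((homFst G).cast (sub_add_cancel _ _)).neg, fun Y Y' => LinearMap.ext fun m => ?_⟩
  have hs : ksign k (S.pairing S.ι (-S.ι - S.ι)) = 1 := by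
    rw [map_sub, map_neg, S.pairing_ι, CharTwo.neg_eq, sub_self, ksign_zero]
  have := congrArg (augFst y Y Y') (LinearMap.congr_fun (hG Y Y') m)
  rw [HomDeg.diff_apply, hs, one_smul, map_sub, augFst_d] at this
  rw [HomDeg.diff_apply, HomDeg.ksign_ι_neg_ι, neg_smul, one_smul, sub_neg_eq_add]
  refine Eq.trans (congrArg₂ (· + ·) ?_ rfl) ((sub_eq_add_neg _ _).symm.trans this)
  exact map_neg ((D.barFamily y).obj Y Y').d (augFst y Y Y' (G.app Y Y' m))

/-- Two lifts of the counits, as in `exists_lift`, compose to a morphism homotopic to the identity,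
since the difference is null-homotopic after composition with the counit. -/
theorem exists_homotopy_comp_sub_id (hx : ∀ a, (D.augBar x).RightContractible (x a))
    {φ : HomDeg (D.barFamily x) (D.barFamily y) 0} {ψ : HomDeg (D.barFamily y) (D.barFamily x) 0}
    (hφ : ∀ Y Y', φ.diff Y Y' = 0) (hψ : ∀ Y Y', ψ.diff Y Y' = 0)
    {K : ∀ Y Y', (D.barFamily x).obj Y Y' →ₗ[k] D.Hom Y' Y}
    {K' : ∀ Y Y', (D.barFamily y).obj Y Y' →ₗ[k] D.Hom Y' Y}
    (hK : IsDiagHom K (-S.ι)) (hK' : IsDiagHom K' (-S.ι))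
    (h : ∀ Y Y' m, counit y Y Y' (φ.app Y Y' m) + (D.Hom Y' Y).d (K Y Y' m) +
        K Y Y' (((D.barFamily x).obj Y Y').d m) = counit x Y Y' m)
    (h' : ∀ Y Y' m, counit x Y Y' (ψ.app Y Y' m) + (D.Hom Y' Y).d (K' Y Y' m) +
        K' Y Y' (((D.barFamily y).obj Y Y').d m) = counit y Y Y' m) :
    ∃ H : HomDeg (D.barFamily x) (D.barFamily x) (-S.ι),
      ∀ Y Y', H.diff Y Y' = ψ.app Y Y' ∘ₗ φ.app Y Y' - LinearMap.id := by
  rw [HomDeg.diff_eq_zero_iff] at hφ hψ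
  refine exists_homotopy hx ((ψ.comp φ).sub (HomDeg.id _)) ?_
    (fun Y Y' => K' Y Y' ∘ₗ φ.app Y Y' + K Y Y') ⟨?_, ?_, ?_⟩ ?_
  · refine HomDeg.diff_eq_zero_iff.2 fun {Y Y'} m => ?_
    simp only [HomDeg.sub, HomDeg.comp, HomDeg.id, LinearMap.sub_apply, LinearMap.comp_apply,
      LinearMap.id_apply, map_sub, hφ, hψ]
  · intro Y Y' i m hm
    have := φ.app_mem hm
    rw [add_zero] at this
    exact Submodule.add_mem _ (hK'.mem this) (hK.mem hm)
  · intro Y Y' Z j f m hf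
    simp only [LinearMap.add_apply, LinearMap.comp_apply, φ.app_lact m hf, hK.lact m hf,
      map_zero, AddMonoidHom.zero_apply, ksign_zero, one_smul, hK'.lact _ hf, map_add, smul_add]
  · intro Y Y' Y'' m g
    simp only [LinearMap.add_apply, LinearMap.comp_apply, φ.app_ract, hK.ract, hK'.ract, map_add]
  · intro Y Y' m
    have e := h Y Y' m
    have e' := h' Y Y' (φ.app Y Y' m)
    rw [hφ] at e'
    simp only [HomDeg.sub, HomDeg.comp, HomDeg.id, LinearMap.sub_apply, LinearMap.comp_apply,
      LinearMap.id_apply, map_sub, LinearMap.add_apply, map_add]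
    rw [← e, ← e']
    abel

/-- Bar complexes whose augmentations are contractible are homotopy equivalent. -/
theorem htpyEquiv_barFamily (hx : ∀ Y, (D.augBar x).RightContractible Y)
    (hy : ∀ Y, (D.augBar y).RightContractible Y) :
    DGBimod.HtpyEquiv (D.barFamily x) (D.barFamily y) := by
  obtain ⟨φ, K, hφ, hK, h⟩ := exists_lift (x := x) fun a => hy (x a)
  obtain ⟨ψ, K', hψ, hK', h'⟩ := exists_lift (x := y) fun a => hx (y a)
  exact ⟨φ, ψ, hφ, hψ, exists_homotopy_comp_sub_id (fun a => hx _) hφ hψ hK hK' h h',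
    exists_homotopy_comp_sub_id (fun a => hy _) hψ hφ hK' hK h' h⟩

theorem htpyEquiv_bar_relBar {𝒳 : Set D.Obj}
    (h : ∀ Y, (D.augBar fun X : 𝒳 => X.1).RightContractible Y) :
    DGBimod.HtpyEquiv D.bar (D.relBar 𝒳) :=
  htpyEquiv_barFamily (fun Y => D.rightContractible_augBar (fun X : D.Obj => X) Y) h

end Comparison

end DGCat

namespace DGCat

variable {k : Type u} [CommRing k] {Γ : Type t} [AddCommGroup Γ] {S : GradingDatum Γ}

theorem twMap_of_mem (C : DGCat.{v, w} k S) {X Y : C.Obj} (α : C.Hom X X) (β : C.Hom Y Y) {j : Γ}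
    {f : C.Hom X Y} (hf : f ∈ (C.Hom X Y).gr j) :
    C.twMap α β f = C.comp β f - ksign k (S.pairing S.ι j) • C.comp f α := by
  rw [twMap_apply, DGMod.koszul_of_mem _ _ hf, map_smul, LinearMap.smul_apply]

/-! ### Entries of morphisms of twisted complexes -/

section Entries

variable {C : DGCat.{v, w} k S}

/-- The family of the `q^(i_a) X_a` underlying a twisted complex `tw_α(⨁ q^(i_a) X_a)`. -/
abbrev twFam (T : C.SB.AddEnv.TwObj) : C.SB.FinFamily := T.obj

/-- The object `X_a` of a twisted complex `tw_α(⨁ q^(i_a) X_a)`. -/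
def twObj (T : C.SB.AddEnv.TwObj) (a : (twFam T).idx) : C.Obj := SBObj.obj ((twFam T).obj a)

/-- The shift `i_a` in a twisted complex `tw_α(⨁ q^(i_a) X_a)`. -/
def twDeg (T : C.SB.AddEnv.TwObj) (a : (twFam T).idx) : Γ := SBObj.deg ((twFam T).obj a)

/-- The entries of a morphism of twisted complexes, as morphisms of `C`. -/
def twEntry {T T' : C.SB.AddEnv.TwObj} (a : (twFam T').idx) (b : (twFam T).idx) :
    C.Twix.Hom T T' →ₗ[k] C.Hom (twObj T b) (twObj T' a) where
  toFun f := (f : C.SB.Mat (twFam T) (twFam T')) (a, b)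
  map_add' _ _ := rfl
  map_smul' _ _ := rfl

/-- The entries of the Maurer-Cartan element of a twisted complex. -/
def twMat (T : C.SB.AddEnv.TwObj) (a b : (twFam T).idx) : C.Hom (twObj T b) (twObj T a) :=
  twEntry (T := T) (T' := T) a b T.α

variable {T T' T'' : C.SB.AddEnv.TwObj}

theorem tw_ext {f g : C.Twix.Hom T T'} (h : ∀ a b, twEntry a b f = twEntry a b g) : f = g :=
  funext (f := (f : C.SB.Mat (twFam T) (twFam T'))) fun p => h p.1 p.2

theorem twEntry_mem {j : Γ} {f : C.Twix.Hom T T'} (hf : f ∈ (C.Twix.Hom T T').gr j) (a b) :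
    twEntry a b f ∈ (C.Hom (twObj T b) (twObj T' a)).gr (j - twDeg T' a + twDeg T b) := by
  have : twEntry a b f ∈ (C.Hom (twObj T b) (twObj T' a)).gr (j - (twDeg T' a + -twDeg T b)) :=
    hf (a, b) trivial
  rwa [show j - (twDeg T' a + -twDeg T b) = j - twDeg T' a + twDeg T b by abel] at this

theorem mem_of_twEntry_mem {j : Γ} {f : C.Twix.Hom T T'}
    (hf : ∀ a b, twEntry a b f ∈ (C.Hom (twObj T b) (twObj T' a)).gr
      (j - twDeg T' a + twDeg T b)) : f ∈ (C.Twix.Hom T T').gr j := by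
  rintro ⟨a, b⟩ -
  have := hf a b
  rw [show j - twDeg T' a + twDeg T b = j - (twDeg T' a + -twDeg T b) by abel] at this
  exact this

theorem twEntry_comp (f : C.Twix.Hom T' T'') (g : C.Twix.Hom T T') (a b) :
    twEntry a b (C.Twix.comp f g) = ∑ c, C.comp (twEntry a c f) (twEntry c b g) := rfl

theorem twEntry_d {j : Γ} {f : C.Twix.Hom T T'} (hf : f ∈ (C.Twix.Hom T T').gr j) (a b) :
    twEntry a b ((C.Twix.Hom T T').d f) =
      ksign k (S.pairing S.ι (twDeg T' a)) • (C.Hom (twObj T b) (twObj T' a)).d (twEntry a b f) +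
        (∑ c, C.comp (twMat T' a c) (twEntry c b f) -
          ksign k (S.pairing S.ι j) • ∑ c, C.comp (twEntry a c f) (twMat T c b)) := by
  have h : (C.Twix.Hom T T').d f = (C.SB.AddEnv.Hom T.obj T'.obj).d f +
      (C.SB.AddEnv.comp T'.α f - ksign k (S.pairing S.ι j) • C.SB.AddEnv.comp f T.α) :=
    congrArg ((C.SB.AddEnv.Hom T.obj T'.obj).d f + ·) (C.SB.AddEnv.twMap_of_mem T.α T'.α hf)
  rw [h]
  rfl

theorem twMat_mem (T : C.SB.AddEnv.TwObj) (a b) : twMat T a b ∈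
    (C.Hom (twObj T b) (twObj T a)).gr (S.ι - twDeg T a + twDeg T b) :=
  twEntry_mem (T := T) (T' := T) T.α_mem a b

theorem twMat_mc (T : C.SB.AddEnv.TwObj) (a b) :
    ksign k (S.pairing S.ι (twDeg T a)) • (C.Hom (twObj T b) (twObj T a)).d (twMat T a b) +
      ∑ c, C.comp (twMat T a c) (twMat T c b) = 0 :=
  congrFun (f := (((C.SB.AddEnv.Hom T.obj T.obj).d T.α + C.SB.AddEnv.comp T.α T.α :
    C.SB.AddEnv.Hom T.obj T.obj) : C.SB.Mat (twFam T) (twFam T))) T.mc (a, b)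

theorem twEntry_one_self (T : C.SB.AddEnv.TwObj) (a : (twFam T).idx) :
    twEntry a a (C.Twix.one T) = C.one (twObj T a) :=
  C.SB.matOne_self (twFam T) a

theorem twEntry_one_ne (T : C.SB.AddEnv.TwObj) {a b : (twFam T).idx} (h : b ≠ a) :
    twEntry a b (C.Twix.one T) = 0 :=
  C.SB.matOne_ne (twFam T) h

theorem twEntry_one_mem (T : C.SB.AddEnv.TwObj) (a b : (twFam T).idx) :
    twEntry a b (C.Twix.one T) ∈ (C.Hom (twObj T b) (twObj T a)).gr (-twDeg T a + twDeg T b) := by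
  have := twEntry_mem (C.Twix.one_mem T) a b
  rwa [zero_sub] at this

theorem sum_one_comp_twEntry (f : C.Twix.Hom T T') (a b) :
    ∑ c, C.comp (twEntry a c (C.Twix.one T')) (twEntry c b f) = twEntry a b f :=
  congrArg (twEntry (T := T) (T' := T') a b) (C.Twix.one_comp f)

theorem sum_twEntry_comp_one (f : C.Twix.Hom T T') (a b) :
    ∑ c, C.comp (twEntry a c f) (twEntry c b (C.Twix.one T)) = twEntry a b f :=
  congrArg (twEntry (T := T) (T' := T') a b) (C.Twix.comp_one f)

theorem twEntry_one_d (T : C.SB.AddEnv.TwObj) (a b : (twFam T).idx) :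
    (C.Hom (twObj T b) (twObj T a)).d (twEntry a b (C.Twix.one T)) = 0 := by
  by_cases h : b = a
  · subst h; rw [twEntry_one_self, C.d_one]
  · rw [twEntry_one_ne T h, map_zero]

/-- The object `X_a` of a twisted complex `tw_α(⨁ q^(i_a) X_a)`, as a twisted complex. -/
def twSingle (T : C.SB.AddEnv.TwObj) (a : (twFam T).idx) : C.SB.AddEnv.TwObj :=
  (C.toPretr (twObj T a)).1

/-- The projection of a twisted complex `tw_α(⨁ q^(i_a) X_a)` to `X_a`, of degree `-i_a`. -/
def twProj (T : C.SB.AddEnv.TwObj) (a : (twFam T).idx) : C.Twix.Hom T (twSingle T a) :=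
  fun p => twEntry a p.2 (C.Twix.one T)

/-- The inclusion of `X_a` into a twisted complex `tw_α(⨁ q^(i_a) X_a)`, of degree `i_a`. -/
def twIncl (T : C.SB.AddEnv.TwObj) (a : (twFam T).idx) : C.Twix.Hom (twSingle T a) T :=
  fun p => twEntry p.1 a (C.Twix.one T)

/-- The entry `α (a, b)` as a morphism of twisted complexes. -/
def twCoeff (T : C.SB.AddEnv.TwObj) (a b : (twFam T).idx) :
    C.Twix.Hom (twSingle T b) (twSingle T a) := fun _ => twMat T a b

theorem twProj_mem (T : C.SB.AddEnv.TwObj) (a) :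
    twProj T a ∈ (C.Twix.Hom T (twSingle T a)).gr (-twDeg T a) :=
  mem_of_twEntry_mem fun c b => by
    have : twDeg (twSingle T a) c = 0 := rfl
    rw [this, sub_zero]
    exact twEntry_one_mem T a b

theorem twIncl_mem (T : C.SB.AddEnv.TwObj) (a) :
    twIncl T a ∈ (C.Twix.Hom (twSingle T a) T).gr (twDeg T a) :=
  mem_of_twEntry_mem fun b c => by
    have : twDeg (twSingle T a) c = 0 := rfl
    rw [this, add_zero, sub_eq_neg_add]
    exact twEntry_one_mem T b a

theorem twCoeff_mem (T : C.SB.AddEnv.TwObj) (a b) : twCoeff T a b ∈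
    (C.Twix.Hom (twSingle T b) (twSingle T a)).gr (S.ι - twDeg T a + twDeg T b) :=
  mem_of_twEntry_mem fun c c' => by
    have h1 : twDeg (twSingle T a) c = 0 := rfl
    have h2 : twDeg (twSingle T b) c' = 0 := rfl
    rw [h1, h2, sub_zero, add_zero]
    exact twMat_mem T a b

theorem sum_twSingle {N : Type*} [AddCommMonoid N] (T : C.SB.AddEnv.TwObj) (a)
    (F : (twFam (twSingle T a)).idx → N) : ∑ c, F c = F PUnit.unit :=
  Fintype.sum_unique (ι := Unit) F

theorem twMat_twSingle (T : C.SB.AddEnv.TwObj) (a) (c c') : twMat (twSingle T a) c c' = 0 := rfl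

theorem twProj_d (T : C.SB.AddEnv.TwObj) (a) :
    ksign k (S.pairing S.ι (twDeg T a)) • (C.Twix.Hom T (twSingle T a)).d (twProj T a) +
      ∑ b, C.Twix.comp (twCoeff T a b) (twProj T b) = 0 := by
  rw [add_eq_zero_iff_eq_neg]
  refine tw_ext fun c b => ?_
  have h1 : (C.Hom (twObj T b) (twObj (twSingle T a) c)).d (twEntry c b (twProj T a)) = 0 :=
    twEntry_one_d T a b
  have h2 : ∑ e, C.comp (twEntry c e (twProj T a)) (twMat T e b) = twMat T a b :=
    sum_one_comp_twEntry (T := T) (T' := T) T.α a b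
  have h3 : ∀ d, ∑ e, C.comp (twEntry c e (twCoeff T a d)) (twEntry e b (twProj T d)) =
      C.comp (twMat T a d) (twEntry d b (C.Twix.one T)) := fun d => sum_twSingle T d _
  have h4 : ∑ d, C.comp (twMat T a d) (twEntry d b (C.Twix.one T)) = twMat T a b :=
    sum_twEntry_comp_one (T := T) (T' := T) T.α a b
  have h5 : ksign k (S.pairing S.ι (twDeg T a)) • ksign k (S.pairing S.ι (twDeg T a)) •
      twMat T a b = twMat T a b := by rw [smul_smul, ksign_mul_self, one_smul]
  rw [map_smul, twEntry_d (twProj_mem T a), h1, h2, map_neg (twEntry c b), map_sum]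
  simp only [twEntry_comp, h3, twMat_twSingle, map_zero, LinearMap.zero_apply,
    Finset.sum_const_zero, smul_zero, zero_add, zero_sub, map_neg, ksign_neg, smul_neg]
  exact congrArg Neg.neg (h5.trans h4.symm)

theorem twIncl_d (T : C.SB.AddEnv.TwObj) (b) :
    (C.Twix.Hom (twSingle T b) T).d (twIncl T b) =
      ∑ a, C.Twix.comp (twIncl T a) (twCoeff T a b) := by
  refine tw_ext fun c e => ?_
  have h1 : (C.Hom (twObj (twSingle T b) e) (twObj T c)).d (twEntry c e (twIncl T b)) = 0 :=
    twEntry_one_d T c b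
  have h2 : ∑ d, C.comp (twMat T c d) (twEntry d e (twIncl T b)) = twMat T c b :=
    sum_twEntry_comp_one (T := T) (T' := T) T.α c b
  have h3 : ∀ a, ∑ d, C.comp (twEntry c d (twIncl T a)) (twEntry d e (twCoeff T a b)) =
      C.comp (twEntry c a (C.Twix.one T)) (twMat T a b) := fun a => sum_twSingle T a _
  have h4 : ∑ a, C.comp (twEntry c a (C.Twix.one T)) (twMat T a b) = twMat T c b :=
    sum_one_comp_twEntry (T := T) (T' := T) T.α c b
  rw [twEntry_d (twIncl_mem T b), h1, h2, map_sum]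
  simp only [twEntry_comp, h3, twMat_twSingle, map_zero, Finset.sum_const_zero, smul_zero,
    zero_add]
  exact (sub_zero _).trans h4.symm

theorem twCoeff_mc (T : C.SB.AddEnv.TwObj) (a b) :
    ksign k (S.pairing S.ι (twDeg T a)) •
        (C.Twix.Hom (twSingle T b) (twSingle T a)).d (twCoeff T a b) +
      ∑ c, C.Twix.comp (twCoeff T a c) (twCoeff T c b) = 0 := by
  refine tw_ext fun e e' => ?_
  have h0 : ksign k (S.pairing S.ι (twDeg (twSingle T a) e)) = 1 := by
    have : twDeg (twSingle T a) e = 0 := rfl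
    rw [this, map_zero, ksign_zero]
  have h3 : ∀ c, ∑ d, C.comp (twEntry e d (twCoeff T a c)) (twEntry d e' (twCoeff T c b)) =
      C.comp (twMat T a c) (twMat T c b) := fun c => sum_twSingle T c _
  have h4 : twEntry e e' (twCoeff T a b) = twMat T a b := rfl
  rw [map_add, map_smul, twEntry_d (twCoeff_mem T a b), h0, one_smul, map_sum, map_zero]
  simp only [twEntry_comp, h3, h4, twMat_twSingle, map_zero, LinearMap.zero_apply,
    Finset.sum_const_zero, smul_zero, sub_zero, add_zero]
  exact twMat_mc T a b

theorem sum_twIncl_comp_twProj (T : C.SB.AddEnv.TwObj) :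
    ∑ a, C.Twix.comp (twIncl T a) (twProj T a) = C.Twix.one T := by
  refine tw_ext fun b c => ?_
  have h3 : ∀ a, ∑ d, C.comp (twEntry b d (twIncl T a)) (twEntry d c (twProj T a)) =
      C.comp (twEntry b a (C.Twix.one T)) (twEntry a c (C.Twix.one T)) :=
    fun a => sum_twSingle T a _
  rw [map_sum]
  simp only [twEntry_comp, h3, sum_one_comp_twEntry]

end Entries

/-! ### Contractibility from generation -/

/-- If `𝒳` generates `D`, then contractibility of `⟨X|M` for `X ∈ 𝒳` implies it for every object. A
homotopy equivalence in `pretr(D)` from the image of `Y` to a twisted complex of objects of `𝒳` is a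
family of entries, which are morphisms of `D` as in `DGBimod.RightContractible.of_twisted`. -/
theorem rightContractible_of_generates {D : DGCat.{v, w} k S} {𝒳 : Set D.Obj}
    (h𝒳 : D.Generates 𝒳) {M : DGBimod D D} (hM : ∀ X ∈ 𝒳, M.RightContractible X) (Y : D.Obj) :
    M.RightContractible Y := by
  obtain ⟨⟨T, r, hr⟩, hT, f, f_mem, g, g_mem, df, dg, ⟨h, h_mem, dh⟩, -⟩ := h𝒳 Y
  let Y' : D.SB.AddEnv.TwObj := (D.toPretr Y).1
  let e : (twFam Y').idx := PUnit.unit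
  let f' : D.Twix.Hom Y' T := f
  let g' : D.Twix.Hom T Y' := g
  let h' : D.Twix.Hom Y' Y' := h
  have he : twDeg Y' e = 0 := rfl
  have hY : ∀ a b, twMat Y' a b = 0 := fun _ _ => rfl
  have f_mem' : f' ∈ (D.Twix.Hom Y' T).gr 0 := f_mem
  have g_mem' : g' ∈ (D.Twix.Hom T Y').gr 0 := g_mem
  have h_mem' : h' ∈ (D.Twix.Hom Y' Y').gr (-S.ι) := h_mem
  refine DGBimod.RightContractible.of_twisted M (A := (twFam T).idx) r (X := twObj T)
    (fun a => hM _ (hT a)) (Y := Y) (twDeg T) (fun a => twEntry a e f') (fun a => twEntry e a g')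
    (twMat T) (twEntry e e h')
    ?_ ?_ (twMat_mem T) ?_ ?_ ?_ (twMat_mc T) (fun a b hab => hr a b hab) ?_
  · intro a
    have := twEntry_mem f_mem' a e
    rwa [he, zero_sub, add_zero] at this
  · intro a
    have := twEntry_mem g_mem' e a
    rwa [he, sub_zero, zero_add] at this
  · have := twEntry_mem h_mem' e e
    rwa [he, sub_zero, add_zero] at this
  · intro a
    have := congrArg (twEntry (T := Y') (T' := T) a e) df
    refine Eq.trans ?_ (this.trans (map_zero _))
    refine Eq.trans ?_ (twEntry_d f_mem' a e).symm
    simp only [hY, map_zero, Finset.sum_const_zero, smul_zero, sub_zero]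
    rfl
  · intro b
    have := congrArg (twEntry (T := T) (T' := Y') e b) dg
    have := (twEntry_d g_mem' e b).symm.trans (this.trans (map_zero _))
    simp only [hY, map_zero, LinearMap.zero_apply, Finset.sum_const_zero, zero_sub, ksign_zero,
      one_smul, he] at this
    exact add_neg_eq_zero.1 this
  · have := congrArg (twEntry (T := Y') (T' := Y') e e) dh
    have := (twEntry_d h_mem' e e).symm.trans this
    simp only [hY, map_zero, LinearMap.zero_apply, Finset.sum_const_zero, sub_zero, ksign_zero,
      one_smul, he, smul_zero, add_zero] at this
    refine this.trans ((map_sub (twEntry e e) (D.Twix.comp g' f') (D.Twix.one Y')).trans ?_)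
    exact congrArg (_ - ·) (twEntry_one_self Y' e)

/-- The shift `q^i X` is a twisted complex with the single term `X`: the identity of `X` is an
isomorphism of degree `i` from `X` to `q^i X`. -/
theorem rightContractible_SB {C : DGCat.{v, w} k S} {M : DGBimod C.SB C.SB}
    (hM : ∀ X, M.RightContractible (C.toSB X)) (Y : C.SB.Obj) : M.RightContractible Y := by
  let i : Γ := SBObj.deg Y
  let Z : C.Obj := SBObj.obj Y
  let f : C.SB.Hom Y (C.toSB Z) := C.one Z
  let g : C.SB.Hom (C.toSB Z) Y := C.one Z
  have h0 : ∀ c : k, (c • (C.Hom Z Z).d) (C.one Z) = 0 := fun c => by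
    rw [LinearMap.smul_apply, C.d_one, smul_zero]
  have df : (C.SB.Hom Y (C.toSB Z)).d f = 0 := h0 _
  have dg : (C.SB.Hom (C.toSB Z) Y).d g = 0 := h0 _
  have gf : C.SB.comp g f = C.SB.one Y := C.one_comp _
  refine DGBimod.RightContractible.of_twisted M (A := Unit) inferInstance
    (X := fun _ => C.toSB Z) (fun _ => hM Z) (fun _ => i) (fun _ => f) (fun _ => g)
    (fun _ _ => 0) 0 ?_ ?_ (fun _ _ => Submodule.zero_mem _) (Submodule.zero_mem _) ?_ ?_ ?_
    (fun _ _ _ => rfl) ?_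
  · intro _
    have := C.one_mem Z
    rwa [show (0 : Γ) = -i - (0 + -i) by abel] at this
  · intro _
    have := C.one_mem Z
    rwa [show (0 : Γ) = i - (i + -0) by abel] at this
  · intro _
    rw [df]
    simp
  · intro _
    rw [dg]
    simp
  · intro _ _
    simp
  · rw [map_zero, Fintype.sum_unique, gf, sub_self]

/-- A finite direct sum is a twisted complex with `α = 0`, by its inclusions and projections. -/
theorem rightContractible_addEnv {C : DGCat.{v, w} k S} {M : DGBimod C.AddEnv C.AddEnv}
    (hM : ∀ X, M.RightContractible (C.toAdd X)) (Y : C.AddEnv.Obj) : M.RightContractible Y := by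
  let Z : C.FinFamily := Y
  -- Any partial order will do, as `α = 0`.
  let r : PartialOrder Z.idx :=
    { le := fun a b => a = b
      le_refl := fun _ => rfl
      le_trans := fun _ _ _ => Eq.trans
      le_antisymm := fun _ _ h _ => h }
  let f : ∀ a, C.AddEnv.Hom Y (C.toAdd (Z.obj a)) := fun a p => C.matOne Z (a, p.2)
  let g : ∀ a, C.AddEnv.Hom (C.toAdd (Z.obj a)) Y := fun a p => C.matOne Z (p.1, a)
  have df : ∀ a, (C.AddEnv.Hom Y (C.toAdd (Z.obj a))).d (f a) = 0 := fun a =>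
    funext fun p => congrFun (C.AddEnv.d_one Y) (a, p.2)
  have dg : ∀ a, (C.AddEnv.Hom (C.toAdd (Z.obj a)) Y).d (g a) = 0 := fun a =>
    funext fun p => congrFun (C.AddEnv.d_one Y) (p.1, a)
  have gf : ∑ a, C.AddEnv.comp (g a) (f a) = C.AddEnv.one Y := by
    refine Eq.trans ?_ (C.AddEnv.one_comp (C.AddEnv.one Y))
    funext p
    refine (Finset.sum_apply p _ _).trans (Finset.sum_congr rfl fun a _ => ?_)
    exact Fintype.sum_unique (ι := Unit) fun u => C.comp (C.matOne Z (p.1, a)) (C.matOne Z (a, p.2))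
  refine DGBimod.RightContractible.of_twisted M (A := Z.idx) r
    (X := fun a => C.toAdd (Z.obj a)) (fun a => hM _) (fun _ => 0) f g
    (fun _ _ => 0) 0 ?_ ?_ (fun _ _ => Submodule.zero_mem _) (Submodule.zero_mem _) ?_ ?_ ?_
    (fun _ _ _ => rfl) ?_
  · intro a
    rw [neg_zero]
    exact fun p _ => C.AddEnv.one_mem Y (a, p.2) trivial
  · exact fun a p _ => C.AddEnv.one_mem Y (p.1, a) trivial
  · intro a
    rw [df]
    simp
  · intro b
    rw [dg]
    simp
  · intro _ _
    simp
  · rw [map_zero, gf, sub_self]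

/-- The inclusions and projections exhibit `tw_α(⨁ q^(i_a) X_a)` as a twisted complex of the objects
`X_a` inside the pretriangulated envelope. -/
theorem rightContractible_pretr {C : DGCat.{v, w} k S} {M : DGBimod C.Pretr C.Pretr}
    (hM : ∀ X, M.RightContractible (C.toPretr X)) (Y : C.Pretr.Obj) : M.RightContractible Y := by
  let T : C.SB.AddEnv.TwObj := Y.1
  obtain ⟨r, hr⟩ : OneSided T := Y.2
  refine DGBimod.RightContractible.of_twisted M (A := (twFam T).idx) r
    (X := fun a => C.toPretr (twObj T a)) (fun a => hM _) (twDeg T) (twProj T) (twIncl T)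
    (twCoeff T) 0 (twProj_mem T) (twIncl_mem T) (twCoeff_mem T) (Submodule.zero_mem _)
    (twProj_d T) (twIncl_d T) (twCoeff_mc T) (fun a b hab => funext fun _ => hr a b hab) ?_
  rw [map_zero, eq_comm, sub_eq_zero]
  exact sum_twIncl_comp_twProj T

end DGCat

end

theorem mainTheorem2 {k : Type u} [CommRing k] {Γ : Type t} [AddCommGroup Γ]
    (S : GradingDatum Γ) :
    (∀ (D : DGCat.{v, w} k S) (𝒳 : Set D.Obj), D.Generates 𝒳 →
      DGBimod.HtpyEquiv D.bar (D.relBar 𝒳)) ∧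
    (∀ C : DGCat.{v, w} k S,
      DGBimod.HtpyEquiv C.SB.bar (C.SB.relBar (Set.range C.toSB)) ∧
      DGBimod.HtpyEquiv C.AddEnv.bar (C.AddEnv.relBar (Set.range C.toAdd)) ∧
      DGBimod.HtpyEquiv C.Pretr.bar (C.Pretr.relBar (Set.range C.toPretr))) := by
  refine ⟨fun D 𝒳 h𝒳 => DGCat.htpyEquiv_bar_relBar (DGCat.rightContractible_of_generates h𝒳
    fun X hX => D.rightContractible_augBar (fun X : 𝒳 => X.1) ⟨X, hX⟩), fun C => ⟨?_, ?_, ?_⟩⟩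
  · exact DGCat.htpyEquiv_bar_relBar (DGCat.rightContractible_SB fun X =>
      C.SB.rightContractible_augBar (fun X : Set.range C.toSB => X.1) ⟨_, X, rfl⟩)
  · exact DGCat.htpyEquiv_bar_relBar (DGCat.rightContractible_addEnv fun X =>
      C.AddEnv.rightContractible_augBar (fun X : Set.range C.toAdd => X.1) ⟨_, X, rfl⟩)
  · exact DGCat.htpyEquiv_bar_relBar (DGCat.rightContractible_pretr fun X =>
      C.Pretr.rightContractible_augBar (fun X : Set.range C.toPretr => X.1) ⟨_, X, rfl⟩)
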